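/- For a finite graph $G$ let $\mathcal E(G)=(\mathbb Z/2)^{E(G)}$, with subgraphs of $G$ (regarded as sets of edges) identified with their indicator vectors. Let the cycle space $\mathcal C(G)\subseteq\mathcal E(G)$ be the subspace spanned by the cycles of $G$, and the triangle space $\mathcal T(G)\subseteq\mathcal C(G)$ the subspace spanned by the triangles of $G$. Let $X(G)$ be the clique complex of $G$, i.e. the simplicial complex whose faces are the vertex sets of the (nonempty) cliques of $G$. Let $G_{n,p}$ be the random graph on the vertex set $\{1,\dots,n\}$ in which each of the $\binom n2$ possible edges is present independently with probability $p$. Theorem. Let $C>\sqrt{3/2}$ be fixed, and let $p=p(n)\in[0,1]$ satisfy $p(n)>C\sqrt{\ln n/n}$ for all sufficiently large $n$. Then, with probability tending to $1$ as $n\to\infty$, the graph $G=G_{n,p}$ satisfies $\mathcal T(G)=\mathcal C(G)$ and, equivalently, $H_1(X(G),\mathbb Z/2)=0$. -/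

import Mathlib

open Filter Topology

noncomputable section

namespace TriangleSpace

variable {V : Type*}

/-- The edge space `(ℤ/2)^{E(G)}` of a graph `G`. -/
abbrev EdgeSpace (G : SimpleGraph V) : Type _ := G.edgeSet → ZMod 2

open Classical in
/-- The element of the edge space that corresponds to a set `F` of edges: its indicator. -/
def edgeVec (G : SimpleGraph V) (F : Set (Sym2 V)) : EdgeSpace G :=
  fun e => if (e : Sym2 V) ∈ F then 1 else 0

/-- The cycle space of `G`: the span, in the edge space, of the (edge sets of) cycles of `G`. -/
def cycleSpace (G : SimpleGraph V) : Submodule (ZMod 2) (EdgeSpace G) :=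
  Submodule.span (ZMod 2)
    {x | ∃ (v : V) (c : G.Walk v v), c.IsCycle ∧ x = edgeVec G {e | e ∈ c.edges}}

/-- The triangle space of `G`: the span, in the edge space, of the (edge sets of) triangles
of `G`. -/
def triangleSpace (G : SimpleGraph V) : Submodule (ZMod 2) (EdgeSpace G) :=
  Submodule.span (ZMod 2)
    {x | ∃ u v w : V, G.Adj u v ∧ G.Adj v w ∧ G.Adj u w ∧
      x = edgeVec G {s(u, v), s(v, w), s(u, w)}}

/-- The clique complex of `G`: the simplicial complex on the vertex set of `G` whose faces are the
nonempty finite sets of vertices that are cliques of `G`. -/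
def cliqueComplex (G : SimpleGraph V) : AbstractSimplicialComplex V where
  faces := {s | s.Nonempty ∧ G.IsClique (s : Set V)}
  isRelLowerSet_faces := fun _ hs =>
    ⟨hs.1, fun _ hts ht => ⟨ht, hs.2.subset (Finset.coe_subset.mpr hts)⟩⟩
  singleton_mem := fun v => ⟨Finset.singleton_nonempty v, by simp⟩

/-- The `k`-dimensional faces of a simplicial complex: those with `k + 1` vertices. -/
abbrev Face (K : AbstractSimplicialComplex V) (k : ℕ) : Type _ :=
  {s : Finset V // s ∈ K.faces ∧ s.card = k + 1}

/-- The simplicial `k`-chains with coefficients in `ℤ/2`. -/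
abbrev Chain (K : AbstractSimplicialComplex V) (k : ℕ) : Type _ := Face K k →₀ ZMod 2

/-- The facet of the `(k+1)`-dimensional face `s` that is opposite to its vertex `v`. -/
def facet [DecidableEq V] {K : AbstractSimplicialComplex V} {k : ℕ} (s : Face K (k + 1))
    (v : {v // v ∈ s.1}) : Face K k :=
  ⟨s.1.erase v.1, by
    have hc : (s.1.erase v.1).card = k + 1 := by
      rw [Finset.card_erase_of_mem v.2, s.2.2]; rfl
    exact ⟨(K.isRelLowerSet_faces s.2.1).2 (Finset.erase_subset _ _)
      (Finset.card_pos.mp (by omega)), hc⟩⟩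

/-- The boundary map `C_{k+1}(K; ℤ/2) → C_k(K; ℤ/2)`, which sends a face to the sum of its facets
(no signs are needed over `ℤ/2`). -/
def boundary [DecidableEq V] (K : AbstractSimplicialComplex V) (k : ℕ) :
    Chain K (k + 1) →ₗ[ZMod 2] Chain K k :=
  Finsupp.linearCombination (ZMod 2)
    (fun s : Face K (k + 1) => ∑ v : {v // v ∈ s.1}, Finsupp.single (facet s v) (1 : ZMod 2))

/-- The homology `ker g / im f` at the middle term of a pair of linear maps
`A --f--> B --g--> C` (with `g ∘ f = 0`). -/
abbrev Homology {R A B C : Type*} [Ring R] [AddCommGroup A] [AddCommGroup B] [AddCommGroup C]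
    [Module R A] [Module R B] [Module R C] (f : A →ₗ[R] B) (g : B →ₗ[R] C) : Type _ :=
  LinearMap.ker g ⧸ (LinearMap.range f).submoduleOf (LinearMap.ker g)

/-- The first simplicial homology group `H₁(K; ℤ/2)`: the 1-cycles modulo the 1-boundaries. -/
abbrev H1 [DecidableEq V] (K : AbstractSimplicialComplex V) : Type _ :=
  Homology (boundary K 1) (boundary K 0)

end TriangleSpace

end

/-! The problem is dualized. A subspace is the common kernel of the functionals that vanish on it,
so both 𝒯 = 𝒞 and H₁ = 0 follow once every cocycle (a function f on the edges with sum 0 on each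
triangle) is a coboundary f(xy) = h(x) + h(y). Put m = np². Two facts combine, each holding with
high probability.

Every cocycle is close to a coboundary (`tendsto_far_cocycle`). The edges at a set S of about √n/p
vertices are exposed. As p²|S| ≈ √m → ∞, almost all pairs have a common neighbour in S; yet there
are only about n²p/√m exposed edges, so f has just exp(o(n²p)) restrictions to them. A restriction
prescribes f, as f₀ say, on all edges whose ends have a common neighbour in S. Let z run over a
reserved set Z. If f₀(xy) = f₀(zx) + f₀(zy) for almost all pairs xy and some z, then h = f₀(z·) is
the required potential. Otherwise, for most z, a positive proportion of pairs violates this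
identity, and a cocycle f forbids every triangle zxy on those pairs. That has probability
exp(-Ω(n²p)) apart from a factor n (`Pr_no_triangle_le`), which beats the union bound.

A cocycle close to a coboundary is a coboundary (`exists_eq_coboundary`); this is deterministic in a
pseudorandom graph. Let h minimize the number of defects, and let A_v be the set of neighbours of v
across defect edges, so |A_v| ≤ deg(v)/2. Each triangle has 0 or 2 defect edges, so the differences
X_v = e(A_v, N_v ∖ A_v) - 2e(A_v) sum to 0. Pseudorandomness makes X_v at least a positive multiple
of m|A_v| unless |A_v| > deg(v)/4, and never very negative. Hence the defects concentrate on the set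
W of exceptional vertices. Closeness makes W small, small sets span few edges, so W is empty and no
defect is left.

The constant 3/2 is sharp only where every edge must lie in many triangles: about n²p·exp(-m) edges
are expected to lie in none, and this tends to 0 when m ≥ K log n with K > 3/2. -/

noncomputable section

namespace RandomSubset

open Finset

set_option linter.unusedSectionVars false

/-! ### Product measure on subsets of a finite set, as finite sums -/

section Basic

variable {α : Type*} [DecidableEq α]

/-- The expectation of `φ` at the random subset of `E` that contains each element of `E`
independently with probability `p`. -/
def Ex (p : ℝ) (E : Finset α) (φ : Finset α → ℝ) : ℝ :=
  ∑ ω ∈ E.powerset, p ^ #ω * (1 - p) ^ #(E \ ω) * φ ω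

open Classical in
/-- The probability of `P` at the random subset of `E` that contains each element of `E`
independently with probability `p`. -/
def Pr (p : ℝ) (E : Finset α) (P : Finset α → Prop) : ℝ :=
  Ex p E (fun ω => if P ω then 1 else 0)

variable {p : ℝ} {E E₁ E₂ : Finset α} {φ ψ : Finset α → ℝ} {P Q : Finset α → Prop}

theorem Ex_empty : Ex p (∅ : Finset α) φ = φ ∅ := by simp [Ex]

theorem Ex_congr (h : ∀ ω ⊆ E, φ ω = ψ ω) : Ex p E φ = Ex p E ψ :=
  sum_congr rfl fun ω hω => by rw [h ω (mem_powerset.1 hω)]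

/-- Expansion of ∏ (p g(e) + (1 - p)) over subsets. All exponential moments below are instances, and
g = 1 shows that the weights sum to one. -/
theorem Ex_prod (g : α → ℝ) :
    Ex p E (fun ω => ∏ e ∈ ω, g e) = ∏ e ∈ E, (1 + p * (g e - 1)) := by
  have h : ∀ e ∈ E, 1 + p * (g e - 1) = p * g e + (1 - p) := fun e _ => by ring
  rw [prod_congr rfl h, prod_add]
  refine sum_congr rfl fun ω _ => ?_
  rw [prod_mul_distrib, prod_const, prod_const]
  ring

theorem Ex_const (c : ℝ) : Ex p E (fun _ => c) = c := by
  have h := Ex_prod (p := p) (E := E) (fun _ => 1)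
  simp only [prod_const_one, sub_self, mul_zero, add_zero, Ex, mul_one] at h
  rw [Ex, ← sum_mul, h, one_mul]

theorem Ex_insert {a : α} (ha : a ∉ E) :
    Ex p (insert a E) φ = (1 - p) * Ex p E φ + p * Ex p E (fun ω => φ (insert a ω)) := by
  rw [Ex, sum_powerset_insert ha, Ex, Ex, mul_sum, mul_sum]
  congr 1
  · refine sum_congr rfl fun ω hω => ?_
    have haω : a ∉ ω := fun h => ha (mem_powerset.1 hω h)
    rw [insert_sdiff_of_notMem _ haω, card_insert_of_notMem (by simp [ha])]
    ring
  · refine sum_congr rfl fun ω hω => ?_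
    have haω : a ∉ ω := fun h => ha (mem_powerset.1 hω h)
    rw [card_insert_of_notMem haω, insert_sdiff_insert, sdiff_insert_of_notMem ha]
    ring

/-- Fubini, by revealing the elements one at a time. It permits exposing the random set in two
rounds. -/
theorem Ex_union (h : Disjoint E₁ E₂) :
    Ex p (E₁ ∪ E₂) φ = Ex p E₁ (fun ω₁ => Ex p E₂ (fun ω₂ => φ (ω₁ ∪ ω₂))) := by
  induction E₁ using Finset.induction_on generalizing φ with
  | empty => simp [Ex_empty]
  | insert a s ha ih =>
    rw [disjoint_insert_left] at h
    rw [insert_union, Ex_insert (by simp [ha, h.1]), Ex_insert ha, ih h.2, ih h.2]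
    simp only [insert_union]

theorem Ex_mono (hp0 : 0 ≤ p) (hp1 : p ≤ 1) (h : ∀ ω ⊆ E, φ ω ≤ ψ ω) : Ex p E φ ≤ Ex p E ψ :=
  sum_le_sum fun ω hω => mul_le_mul_of_nonneg_left (h ω (mem_powerset.1 hω))
    (mul_nonneg (pow_nonneg hp0 _) (pow_nonneg (sub_nonneg.2 hp1) _))

theorem Ex_le (hp0 : 0 ≤ p) (hp1 : p ≤ 1) {c : ℝ} (h : ∀ ω ⊆ E, φ ω ≤ c) : Ex p E φ ≤ c :=
  (Ex_mono hp0 hp1 h).trans_eq (Ex_const c)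

theorem Ex_nonneg (hp0 : 0 ≤ p) (hp1 : p ≤ 1) (h : ∀ ω ⊆ E, 0 ≤ φ ω) : 0 ≤ Ex p E φ :=
  (Ex_const (p := p) (E := E) 0).symm.le.trans (Ex_mono hp0 hp1 h)

theorem Ex_add : Ex p E (fun ω => φ ω + ψ ω) = Ex p E φ + Ex p E ψ := by
  simp [Ex, mul_add, sum_add_distrib]

theorem Ex_const_mul (c : ℝ) : Ex p E (fun ω => c * φ ω) = c * Ex p E φ := by
  simp only [Ex, mul_sum]
  exact sum_congr rfl fun _ _ => by ring

theorem Ex_mul_const (c : ℝ) : Ex p E (fun ω => φ ω * c) = Ex p E φ * c := by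
  simp only [Ex, sum_mul]
  exact sum_congr rfl fun _ _ => by ring

theorem Ex_sum {ι : Type*} (I : Finset ι) (φ : ι → Finset α → ℝ) :
    Ex p E (fun ω => ∑ i ∈ I, φ i ω) = ∑ i ∈ I, Ex p E (φ i) := by
  simp only [Ex, mul_sum]
  rw [sum_comm]

theorem Ex_of_subset (h : E₁ ⊆ E) (hφ : ∀ ω ⊆ E, φ ω = φ (ω ∩ E₁)) : Ex p E φ = Ex p E₁ φ := by
  rw [← union_sdiff_of_subset h, Ex_union disjoint_sdiff]
  refine Ex_congr fun ω₁ h₁ => ?_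
  rw [Ex_congr (ψ := fun _ => φ ω₁), Ex_const]
  intro ω₂ h₂
  rw [hφ _ (union_subset (h₁.trans h) (h₂.trans sdiff_subset))]
  congr 1
  ext e
  have : e ∈ ω₁ → e ∈ E₁ := fun h => h₁ h
  have : e ∈ ω₂ → e ∉ E₁ := fun h => (mem_sdiff.1 (h₂ h)).2
  simp only [mem_inter, mem_union]
  tauto

/-- Independence over disjoint blocks. It makes codegrees binomial and separates the stars at
different vertices. -/
theorem Ex_biUnion {ι : Type*} [DecidableEq ι] (I : Finset ι) (E : ι → Finset α)
    (φ : ι → Finset α → ℝ) (hd : (I : Set ι).PairwiseDisjoint E) :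
    Ex p (I.biUnion E) (fun ω => ∏ i ∈ I, φ i (ω ∩ E i)) = ∏ i ∈ I, Ex p (E i) (φ i) := by
  induction I using Finset.induction_on with
  | empty => simp [Ex_empty]
  | insert a s ha ih =>
    have hdis : Disjoint (E a) (s.biUnion E) := by
      rw [disjoint_biUnion_right]
      intro i hi
      exact hd (by simp) (by simp [hi]) (fun h => ha (h ▸ hi))
    rw [biUnion_insert, Ex_union hdis, prod_insert ha, ← ih (hd.subset (by simp)), ← Ex_mul_const]
    refine Ex_congr fun ω₁ h₁ => ?_
    rw [← Ex_const_mul]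
    refine Ex_congr fun ω₂ h₂ => ?_
    rw [prod_insert ha]
    have hE : ∀ e, e ∈ E a → e ∉ s.biUnion E := fun e h => disjoint_left.1 hdis h
    congr 1
    · congr 1
      ext e
      have := hE e
      have : e ∈ ω₁ → e ∈ E a := fun h => h₁ h
      have : e ∈ ω₂ → e ∈ s.biUnion E := fun h => h₂ h
      simp only [mem_inter, mem_union]
      tauto
    · refine prod_congr rfl fun i hi => ?_
      congr 1
      ext e
      have := hE e
      have : e ∈ ω₁ → e ∈ E a := fun h => h₁ h
      have : e ∈ E i → e ∈ s.biUnion E := fun h => mem_biUnion.2 ⟨i, hi, h⟩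
      simp only [mem_inter, mem_union]
      tauto

theorem Ex_image {β : Type*} [DecidableEq β] {F : Finset β} {f : β → α}
    (hf : Set.InjOn f F) : Ex p (F.image f) φ = Ex p F (fun ω => φ (ω.image f)) := by
  induction F using Finset.induction_on generalizing φ with
  | empty => simp [Ex_empty]
  | insert a s ha ih =>
    have hs : Set.InjOn f s := hf.mono (by simp)
    have hfa : f a ∉ s.image f := by
      simp only [mem_image, not_exists, not_and]
      intro b hb hab
      exact ha (hf (by simp [hb]) (by simp) hab ▸ hb)
    rw [image_insert, Ex_insert hfa, Ex_insert ha, ih hs, ih hs]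
    simp only [image_insert]

theorem Pr_eq_Ex (p : ℝ) (E : Finset α) (P : Finset α → Prop) [DecidablePred P] :
    Pr p E P = Ex p E (fun ω => if P ω then 1 else 0) := by
  unfold Pr
  congr! 3

theorem Pr_mono (hp0 : 0 ≤ p) (hp1 : p ≤ 1) (h : ∀ ω ⊆ E, P ω → Q ω) : Pr p E P ≤ Pr p E Q := by
  classical
  refine Ex_mono hp0 hp1 fun ω hω => ?_
  have := h ω hω
  split_ifs <;> simp_all

theorem Pr_nonneg (hp0 : 0 ≤ p) (hp1 : p ≤ 1) : 0 ≤ Pr p E P := by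
  classical
  exact Ex_nonneg hp0 hp1 fun ω _ => by split_ifs <;> norm_num

theorem Pr_le_one (hp0 : 0 ≤ p) (hp1 : p ≤ 1) : Pr p E P ≤ 1 := by
  classical
  exact Ex_le hp0 hp1 fun ω _ => by split_ifs <;> norm_num

theorem Pr_union (h : Disjoint E₁ E₂) :
    Pr p (E₁ ∪ E₂) P = Ex p E₁ (fun ω₁ => Pr p E₂ (fun ω₂ => P (ω₁ ∪ ω₂))) :=
  Ex_union h

theorem Pr_or_le (hp0 : 0 ≤ p) (hp1 : p ≤ 1) :
    Pr p E (fun ω => P ω ∨ Q ω) ≤ Pr p E P + Pr p E Q := by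
  classical
  unfold Pr
  rw [← Ex_add]
  refine Ex_mono hp0 hp1 fun ω _ => ?_
  by_cases h1 : P ω <;> by_cases h2 : Q ω <;> simp [h1, h2]

theorem Pr_exists_le (hp0 : 0 ≤ p) (hp1 : p ≤ 1) {ι : Type*} (I : Finset ι)
    (P : ι → Finset α → Prop) :
    Pr p E (fun ω => ∃ i ∈ I, P i ω) ≤ ∑ i ∈ I, Pr p E (P i) := by
  classical
  unfold Pr
  rw [← Ex_sum]
  refine Ex_mono hp0 hp1 fun ω _ => ?_
  split_ifs with h
  · obtain ⟨i, hi, h⟩ := h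
    refine le_trans (by simp [h]) (single_le_sum (f := fun i => if P i ω then (1 : ℝ) else 0)
      (fun j _ => by split_ifs <;> norm_num) hi)
  · exact sum_nonneg fun j _ => by split_ifs <;> norm_num

theorem Pr_exists_le_card_mul (hp0 : 0 ≤ p) (hp1 : p ≤ 1) {ι : Type*} (I : Finset ι)
    (P : ι → Finset α → Prop) {c : ℝ} (h : ∀ i ∈ I, Pr p E (P i) ≤ c) :
    Pr p E (fun ω => ∃ i ∈ I, P i ω) ≤ #I * c := by
  refine (Pr_exists_le hp0 hp1 I P).trans ((sum_le_sum h).trans_eq ?_)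
  simp

theorem Pr_of_subset (h : E₁ ⊆ E) (hP : ∀ ω ⊆ E, (P ω ↔ P (ω ∩ E₁))) : Pr p E P = Pr p E₁ P := by
  classical
  exact Ex_of_subset h fun ω hω => by simp only [← hP ω hω]

theorem Pr_le_Ex (hp0 : 0 ≤ p) (hp1 : p ≤ 1) (h0 : ∀ ω ⊆ E, 0 ≤ φ ω)
    (h : ∀ ω ⊆ E, P ω → 1 ≤ φ ω) : Pr p E P ≤ Ex p E φ := by
  classical
  refine Ex_mono hp0 hp1 fun ω hω => ?_
  split_ifs with hP
  exacts [h ω hω hP, h0 ω hω]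

/-- Exponential Markov inequality for a weighted count of the elements of a random subset. -/
theorem Pr_le_exp (hp0 : 0 ≤ p) (hp1 : p ≤ 1) (w : α → ℝ) (t : ℝ) :
    Pr p E (fun ω => t ≤ ∑ e ∈ ω, w e) ≤
      Real.exp (-t + p * ∑ e ∈ E, (Real.exp (w e) - 1)) := by
  calc Pr p E (fun ω => t ≤ ∑ e ∈ ω, w e)
      ≤ Ex p E (fun ω => Real.exp (-t) * ∏ e ∈ ω, Real.exp (w e)) := by
        refine Pr_le_Ex hp0 hp1 (fun ω _ => by positivity) fun ω _ h => ?_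
        rw [← Real.exp_sum, ← Real.exp_add]
        exact Real.one_le_exp (by linarith)
    _ = Real.exp (-t) * ∏ e ∈ E, (1 + p * (Real.exp (w e) - 1)) := by
        rw [Ex_const_mul, Ex_prod]
    _ ≤ Real.exp (-t) * ∏ e ∈ E, Real.exp (p * (Real.exp (w e) - 1)) := by
        gcongr with e
        · intro e _
          nlinarith [Real.exp_pos (w e)]
        · linarith [Real.add_one_le_exp (p * (Real.exp (w e) - 1))]
    _ = _ := by rw [← Real.exp_sum, ← Real.exp_add, mul_sum]

/-- With c = 2 this averages the number of subsets of the exposed edges, the cost of a union bound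
over them; with c = 0 it is the probability of the empty set. -/
theorem Ex_pow_card (c : ℝ) : Ex p E (fun ω => c ^ #ω) = (1 + p * (c - 1)) ^ #E := by
  have h := Ex_prod (p := p) (E := E) (fun _ => c)
  simpa using h

theorem Pr_inter_eq_empty (h : E₁ ⊆ E) : Pr p E (fun ω => Disjoint ω E₁) = (1 - p) ^ #E₁ := by
  rw [Pr_of_subset h, Pr_eq_Ex, ← zero_add (1 - p)]
  · have := Ex_pow_card (p := p) (E := E₁) 0
    rw [zero_sub, mul_neg, mul_one, ← sub_eq_add_neg] at this
    rw [zero_add, ← this]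
    refine Ex_congr fun ω hω => ?_
    by_cases h0 : ω = ∅
    · simp [h0]
    · have : ¬ Disjoint ω E₁ := fun hd => h0 (by
        rw [← inter_eq_left.2 hω]; exact disjoint_iff_inter_eq_empty.1 hd)
      simp [this, h0]
  · intro ω _
    rw [disjoint_iff_inter_eq_empty, disjoint_iff_inter_eq_empty, inter_assoc, inter_self]

end Basic


/-! ### Counts of adjacent ordered pairs and their tails -/

section Pairs

variable {V : Type*} [Fintype V] [DecidableEq V]

/-- The set of all unordered pairs of distinct vertices. -/
def pairs (V : Type*) [Fintype V] [DecidableEq V] : Finset (Sym2 V) :=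
  univ.filter fun e => ¬ e.IsDiag

/-- The neighbours of `v` in the graph with edge set `ω`. -/
def nb (ω : Finset (Sym2 V)) (v : V) : Finset V := univ.filter fun x => s(v, x) ∈ ω

/-- The number of ordered pairs in `D` that are edges of `ω`. -/
def cnt (ω : Finset (Sym2 V)) (D : Finset (V × V)) : ℕ := #{q ∈ D | s(q.1, q.2) ∈ ω}

/-- The function on unordered pairs obtained from `g` by symmetrization. -/
def symmetrize (g : V → V → ℝ) : Sym2 V → ℝ :=
  Sym2.lift ⟨fun x y => g x y + g y x, fun _ _ => add_comm _ _⟩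

@[simp] theorem symmetrize_mk (g : V → V → ℝ) (x y : V) : symmetrize g s(x, y) = g x y + g y x := rfl

@[simp] theorem mem_pairs {x y : V} : s(x, y) ∈ pairs V ↔ x ≠ y := by simp [pairs]

@[simp] theorem mem_nb {ω : Finset (Sym2 V)} {v x : V} : x ∈ nb ω v ↔ s(v, x) ∈ ω := by simp [nb]

theorem ne_of_mem {ω : Finset (Sym2 V)} (hω : ω ⊆ pairs V) {x y : V} (h : s(x, y) ∈ ω) : x ≠ y :=
  mem_pairs.1 (hω h)

theorem sum_symmetrize {ω : Finset (Sym2 V)} (hω : ω ⊆ pairs V) (g : V → V → ℝ) :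
    ∑ e ∈ ω, symmetrize g e = ∑ q : V × V, if s(q.1, q.2) ∈ ω then g q.1 q.2 else 0 := by
  rw [← sum_filter, ← sum_fiberwise_of_maps_to (s := univ.filter fun q : V × V => s(q.1, q.2) ∈ ω)
    (t := ω) (g := fun q => s(q.1, q.2)) (fun q hq => (mem_filter.1 hq).2)]
  refine sum_congr rfl fun e he => ?_
  induction e using Sym2.ind with
  | _ a b =>
    have hab := ne_of_mem hω he
    have : ((univ.filter fun q : V × V => s(q.1, q.2) ∈ ω).filter fun q => s(q.1, q.2) = s(a, b))
        = {(a, b), (b, a)} := by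
      ext ⟨x, y⟩
      simp only [mem_filter, mem_univ, true_and, mem_insert, mem_singleton, Prod.mk.injEq,
        Sym2.eq_iff]
      constructor
      · exact fun h => h.2
      · rintro (⟨rfl, rfl⟩ | ⟨rfl, rfl⟩)
        · exact ⟨he, by simp⟩
        · exact ⟨Sym2.eq_swap ▸ he, by simp⟩
    rw [this, sum_pair (by simp [hab]), symmetrize_mk]

theorem sum_edges {ω : Finset (Sym2 V)} (hω : ω ⊆ pairs V) (H : Sym2 V → ℝ) :
    ∑ e ∈ ω, H e = (∑ q : V × V, if s(q.1, q.2) ∈ ω then H s(q.1, q.2) else 0) / 2 := by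
  have h := sum_symmetrize hω (fun x y => H s(x, y) / 2)
  have h1 : ∀ e, symmetrize (fun x y => H s(x, y) / 2) e = H e := fun e => by
    induction e using Sym2.ind with
    | _ a b => rw [symmetrize_mk, Sym2.eq_swap]; ring
  simp only [h1] at h
  rw [h, sum_div]
  exact sum_congr rfl fun q _ => by split_ifs <;> simp

theorem sum_ite_mem_eq_cnt (ω : Finset (Sym2 V)) (D : Finset (V × V)) (c : ℝ) :
    (∑ q : V × V, if s(q.1, q.2) ∈ ω then (if q ∈ D then c else 0) else 0) = cnt ω D * c := by
  simp only [← ite_and]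
  rw [← sum_filter, sum_const, cnt, nsmul_eq_mul]
  congr 3
  ext q
  simp [and_comm]

theorem cnt_le_card (ω : Finset (Sym2 V)) (D : Finset (V × V)) : cnt ω D ≤ #D :=
  card_filter_le _ _

theorem cnt_mono {ω ω' : Finset (Sym2 V)} {D D' : Finset (V × V)} (h : ω ⊆ ω') (h' : D ⊆ D') :
    cnt ω D ≤ cnt ω' D' :=
  card_le_card fun q hq => by
    simp only [mem_filter] at hq ⊢
    exact ⟨h' hq.1, h hq.2⟩

theorem cnt_product (ω : Finset (Sym2 V)) (A B : Finset V) :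
    cnt ω (A ×ˢ B) = ∑ x ∈ A, #(nb ω x ∩ B) := by
  rw [cnt, card_eq_sum_card_fiberwise (f := Prod.fst) (t := A)
    (fun q hq => (mem_product.1 (mem_filter.1 hq).1).1)]
  refine sum_congr rfl fun x hx => ?_
  rw [← card_image_of_injective (nb ω x ∩ B) (Prod.mk_right_injective x)]
  congr 1
  ext ⟨a, b⟩
  simp only [mem_filter, mem_product, mem_image, mem_inter, mem_nb, Prod.mk.injEq]
  constructor
  · rintro ⟨⟨⟨_, hb⟩, h⟩, rfl⟩
    exact ⟨b, ⟨h, hb⟩, rfl, rfl⟩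
  · rintro ⟨y, ⟨h, hy⟩, rfl, rfl⟩
    exact ⟨⟨⟨hx, hy⟩, h⟩, rfl⟩

theorem cnt_swap (ω : Finset (Sym2 V)) (A B : Finset V) : cnt ω (A ×ˢ B) = cnt ω (B ×ˢ A) := by
  unfold cnt
  refine card_bij (fun q _ => q.swap) ?_ ?_ ?_
  · rintro ⟨a, b⟩ h
    simp only [mem_filter, mem_product, Prod.swap_prod_mk] at h ⊢
    exact ⟨⟨h.1.2, h.1.1⟩, Sym2.eq_swap ▸ h.2⟩
  · rintro ⟨a, b⟩ _ ⟨c, d⟩ _ h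
    simpa [and_comm] using h
  · rintro ⟨a, b⟩ h
    refine ⟨(b, a), ?_, rfl⟩
    simp only [mem_filter, mem_product] at h ⊢
    exact ⟨⟨h.1.2, h.1.1⟩, Sym2.eq_swap ▸ h.2⟩

variable {p : ℝ} {E : Finset (Sym2 V)}

theorem exp_sub_one_le {u : ℝ} (hu : |u| ≤ 1) : Real.exp u - 1 ≤ u + u ^ 2 := by
  have := (abs_le.1 (Real.abs_exp_sub_one_sub_id_le hu)).2
  linarith

/-- Exponential Markov inequality for weighted counts of ordered pairs, with bounded weights. -/
theorem Pr_pairs_le (hp0 : 0 ≤ p) (hp1 : p ≤ 1) (hE : E ⊆ pairs V) (g : V → V → ℝ)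
    (hg : ∀ x y, |g x y| ≤ 1 / 2) (t : ℝ) :
    Pr p E (fun ω => t ≤ ∑ q : V × V, if s(q.1, q.2) ∈ ω then g q.1 q.2 else 0) ≤
      Real.exp (-t + p * ∑ q : V × V,
        if s(q.1, q.2) ∈ E then g q.1 q.2 + 2 * g q.1 q.2 ^ 2 else 0) := by
  have h1 : Pr p E (fun ω => t ≤ ∑ q : V × V, if s(q.1, q.2) ∈ ω then g q.1 q.2 else 0) ≤
      Pr p E (fun ω => t ≤ ∑ e ∈ ω, symmetrize g e) :=
    Pr_mono hp0 hp1 fun ω hω h => by rwa [sum_symmetrize (hω.trans hE)]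
  refine h1.trans ((Pr_le_exp hp0 hp1 _ _).trans ?_)
  gcongr
  rw [← sum_symmetrize hE (fun x y => g x y + 2 * g x y ^ 2)]
  refine sum_le_sum fun e _ => ?_
  induction e using Sym2.ind with
  | _ a b =>
    rw [symmetrize_mk, symmetrize_mk]
    have ha := hg a b
    have hb := hg b a
    -- Both orientations of an edge depend on the same coin, so the exponent is the sum of two
    -- weights. The inequality (a + b)² ≤ 2a² + 2b² produces the factor 2, and |g| ≤ 1/2 keeps the
    -- sum in the range of the quadratic bound.
    have h := exp_sub_one_le (u := g a b + g b a) (by linarith [abs_add_le (g a b) (g b a)])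
    nlinarith [sq_nonneg (g a b - g b a)]

theorem Pr_le_cnt_le (hp0 : 0 ≤ p) (hp1 : p ≤ 1) (hE : E ⊆ pairs V) (D : Finset (V × V)) {l : ℝ}
    (hl0 : 0 ≤ l) (hl : l ≤ 1 / 2) (t : ℝ) :
    Pr p E (fun ω => t ≤ cnt ω D) ≤ Real.exp (-(l * t) + p * #D * (l + 2 * l ^ 2)) := by
  have h := Pr_pairs_le hp0 hp1 hE (fun x y => if (x, y) ∈ D then l else 0)
    (fun x y => by
      show |if (x, y) ∈ D then l else 0| ≤ _
      split_ifs
      · rwa [abs_of_nonneg hl0]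
      · norm_num) (l * t)
  refine (Pr_mono hp0 hp1 ?_).trans (h.trans ?_)
  · intro ω _ ht
    rw [sum_ite_mem_eq_cnt, mul_comm]
    gcongr
  · refine Real.exp_le_exp.2 (add_le_add_right ?_ _)
    rw [mul_assoc]
    refine mul_le_mul_of_nonneg_left ?_ hp0
    have : ∀ q : V × V, ((if (q.1, q.2) ∈ D then l else 0) +
        2 * (if (q.1, q.2) ∈ D then l else 0) ^ 2) = if q ∈ D then l + 2 * l ^ 2 else 0 :=
      fun q => by split_ifs <;> simp
    simp only [this]
    rw [sum_ite_mem_eq_cnt]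
    gcongr
    exact cnt_le_card _ _

theorem Pr_cnt_le_le (hp0 : 0 ≤ p) (hp1 : p ≤ 1) (hE : E ⊆ pairs V) (D : Finset (V × V)) {l : ℝ}
    (hl0 : 0 ≤ l) (hl : l ≤ 1 / 2) (hD : ∀ q ∈ D, s(q.1, q.2) ∈ E) (t : ℝ) :
    Pr p E (fun ω => cnt ω D ≤ t) ≤ Real.exp (l * t - p * #D * (l - 2 * l ^ 2)) := by
  have h := Pr_pairs_le hp0 hp1 hE (fun x y => if (x, y) ∈ D then -l else 0)
    (fun x y => by
      show |if (x, y) ∈ D then -l else 0| ≤ _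
      split_ifs
      · rwa [abs_neg, abs_of_nonneg hl0]
      · norm_num) (-(l * t))
  refine (Pr_mono hp0 hp1 ?_).trans (h.trans ?_)
  · intro ω _ ht
    rw [sum_ite_mem_eq_cnt, mul_comm l t]
    nlinarith
  · gcongr
    have : ∀ q : V × V, ((if (q.1, q.2) ∈ D then -l else 0) +
        2 * (if (q.1, q.2) ∈ D then -l else 0) ^ 2) = if q ∈ D then -l + 2 * l ^ 2 else 0 :=
      fun q => by split_ifs <;> simp
    simp only [this]
    rw [sum_ite_mem_eq_cnt]
    have : cnt E D = #D := by
      rw [cnt, filter_true_of_mem hD]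
    rw [this]
    linarith

/-- Large deviations for the number of edges inside a set. -/
theorem Pr_le_cnt_self_le (hp0 : 0 ≤ p) (hp1 : p ≤ 1) (hE : E ⊆ pairs V) (A : Finset V) {l : ℝ}
    (hl : 0 ≤ l) (t : ℝ) :
    Pr p E (fun ω => t ≤ cnt ω (A ×ˢ A)) ≤
      Real.exp (-(l * t) + p * (#A : ℝ) ^ 2 * (Real.exp (2 * l) / 2)) := by
  set g : V → V → ℝ := fun x y => if (x, y) ∈ A ×ˢ A then l else 0 with hgdef
  have hsym : ∀ x y, symmetrize g s(x, y) = if (x, y) ∈ A ×ˢ A then 2 * l else 0 := fun x y => by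
    simp only [symmetrize_mk, hgdef, mem_product, and_comm (a := y ∈ A)]
    split_ifs <;> ring
  refine (Pr_mono hp0 hp1 (Q := fun ω => l * t ≤ ∑ e ∈ ω, symmetrize g e) ?_).trans
    ((Pr_le_exp hp0 hp1 _ _).trans ?_)
  · intro ω hω ht
    rw [sum_symmetrize (hω.trans hE), sum_ite_mem_eq_cnt, mul_comm]
    gcongr
  · refine Real.exp_le_exp.2 (add_le_add_right ?_ _)
    -- An edge inside A is two ordered pairs, hence weight 2l and a halved sum. The exact moment is
    -- kept because l will be large.
    rw [sum_edges hE, mul_assoc]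
    refine mul_le_mul_of_nonneg_left ?_ hp0
    have : ∀ q : V × V, Real.exp (symmetrize g s(q.1, q.2)) - 1 =
        if q ∈ A ×ˢ A then Real.exp (2 * l) - 1 else 0 := fun q => by
      rw [hsym]; split_ifs <;> simp
    simp only [this]
    rw [sum_ite_mem_eq_cnt, ← mul_div_assoc]
    have h1 : (cnt E (A ×ˢ A) : ℝ) ≤ (#A : ℝ) ^ 2 := by
      have := cnt_le_card E (A ×ˢ A)
      rw [card_product] at this
      rw [sq]
      exact_mod_cast this
    have h2 : 1 ≤ Real.exp (2 * l) := Real.one_le_exp (by linarith)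
    gcongr
    linarith

end Pairs


/-! ### Common neighbours of two vertices -/

section Codegree

variable {V : Type*} [Fintype V] [DecidableEq V] {p : ℝ} {E : Finset (Sym2 V)}

/-- The common neighbours of `x` and `y` in the graph with edge set `ω`. -/
def conb (ω : Finset (Sym2 V)) (x y : V) : Finset V := nb ω x ∩ nb ω y

@[simp] theorem mem_conb {ω : Finset (Sym2 V)} {x y z : V} :
    z ∈ conb ω x y ↔ s(x, z) ∈ ω ∧ s(y, z) ∈ ω := by simp [conb]

theorem Ex_pair_of_ne {a b : Sym2 V} (hab : a ≠ b) (r : ℝ) :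
    Ex p {a, b} (fun ω => if a ∈ ω ∧ b ∈ ω then r else 1) = 1 + p ^ 2 * (r - 1) := by
  rw [Ex_insert (by simpa using hab), ← insert_empty_eq b, Ex_insert (by simp),
    Ex_insert (by simp)]
  simp only [Ex_empty]
  simp [hab, hab.symm]
  ring

/-- The blocks {xz, yz} for z ∈ T are disjoint because x, y ∉ T, so the number of common neighbours
in T is binomial with success probability p². -/
theorem Ex_pow_conb {x y : V} (hxy : x ≠ y) {T : Finset V} (hx : x ∉ T) (hy : y ∉ T)
    (hE : ∀ z ∈ T, s(x, z) ∈ E ∧ s(y, z) ∈ E) (r : ℝ) :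
    Ex p E (fun ω => r ^ #(conb ω x y ∩ T)) = (1 + p ^ 2 * (r - 1)) ^ #T := by
  set B : V → Finset (Sym2 V) := fun z => {s(x, z), s(y, z)} with hB
  have hprod : ∀ ω : Finset (Sym2 V), r ^ #(conb ω x y ∩ T) =
      ∏ z ∈ T, if s(x, z) ∈ ω ∩ B z ∧ s(y, z) ∈ ω ∩ B z then r else 1 := fun ω => by
    rw [← prod_filter, prod_const]
    congr 2
    ext z
    simp [hB, and_comm]
  have hne : ∀ z ∈ T, s(x, z) ≠ s(y, z) := fun z hz => by
    rw [Ne, Sym2.eq_iff]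
    rintro (h | h)
    exacts [hxy h.1, hx (h.1 ▸ hz)]
  have hsub : T.biUnion B ⊆ E := by
    simp only [biUnion_subset, hB, insert_subset_iff, singleton_subset_iff]
    exact hE
  rw [Ex_of_subset hsub]
  · rw [Ex_congr fun ω _ => hprod ω, Ex_biUnion T B
      (fun z ω => if s(x, z) ∈ ω ∧ s(y, z) ∈ ω then r else 1)]
    · rw [prod_congr rfl fun z hz => Ex_pair_of_ne (hne z hz) r, prod_const]
    · intro z hz z' hz' hzz'
      rw [Function.onFun, disjoint_left]
      intro e he he'
      simp only [hB, mem_insert, mem_singleton] at he he'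
      have hz : z ∈ T := hz
      rcases he with rfl | rfl <;> rcases he' with h | h <;> rw [Sym2.eq_iff] at h <;>
        rcases h with h | h <;> grind
  · intro ω _
    congr 2
    ext z
    simp only [mem_inter, mem_conb]
    constructor
    · rintro ⟨h, hz⟩
      exact ⟨⟨⟨h.1, mem_biUnion.2 ⟨z, hz, by simp [hB]⟩⟩,
        ⟨h.2, mem_biUnion.2 ⟨z, hz, by simp [hB]⟩⟩⟩, hz⟩
    · rintro ⟨h, hz⟩
      exact ⟨⟨h.1.1, h.2.1⟩, hz⟩

theorem Pr_conb_disjoint_le (hp1 : p ≤ 1) (hp0 : 0 ≤ p) {x y : V} (hxy : x ≠ y) {T : Finset V}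
    (hx : x ∉ T) (hy : y ∉ T) (hE : ∀ z ∈ T, s(x, z) ∈ E ∧ s(y, z) ∈ E) :
    Pr p E (fun ω => conb ω x y ∩ T = ∅) ≤ Real.exp (-(p ^ 2 * #T)) := by
  -- Since 0 ^ 0 = 1, the power with base 0 is the indicator of having no common neighbour in T.
  refine (Pr_le_Ex hp0 hp1 (φ := fun ω => (0 : ℝ) ^ #(conb ω x y ∩ T)) (fun _ _ => by positivity)
    (fun ω _ h => by rw [h]; simp)).trans ?_
  rw [Ex_pow_conb hxy hx hy hE]
  calc (1 + p ^ 2 * (0 - 1)) ^ #T ≤ Real.exp (-p ^ 2) ^ #T := by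
        gcongr
        · nlinarith
        · linarith [Real.add_one_le_exp (-p ^ 2)]
    _ = _ := by rw [← Real.exp_nat_mul]; congr 1; ring

theorem conb_inter_compl {ω : Finset (Sym2 V)} (hω : ω ⊆ pairs V) (x y : V) :
    conb ω x y ∩ ({x, y}ᶜ) = conb ω x y := by
  refine inter_eq_left.2 fun z hz => ?_
  rw [mem_conb] at hz
  have h1 := ne_of_mem hω hz.1
  have h2 := ne_of_mem hω hz.2
  simp [h1.symm, h2.symm]

theorem Pr_le_card_conb_le (hp1 : p ≤ 1) (hp0 : 0 ≤ p) {x y : V} (hxy : x ≠ y) (t : ℝ) :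
    Pr p (pairs V) (fun ω => t ≤ #(conb ω x y)) ≤
      Real.exp (-t + 2 * (Fintype.card V * p ^ 2)) := by
  refine (Pr_le_Ex hp0 hp1
    (φ := fun ω => Real.exp (-t) * Real.exp 1 ^ #(conb ω x y ∩ ({x, y}ᶜ)))
    (fun _ _ => by positivity) (fun ω hω h => ?_)).trans ?_
  · rw [conb_inter_compl hω, ← Real.exp_nat_mul, ← Real.exp_add]
    exact Real.one_le_exp (by linarith)
  rw [Ex_const_mul, Ex_pow_conb hxy (by simp) (by simp)
    (by simp only [mem_compl, mem_insert, mem_singleton, mem_pairs]; grind),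
    Real.exp_add]
  have h3 : Real.exp 1 ≤ 3 := by linarith [Real.exp_one_lt_d9]
  have h1 : 1 ≤ Real.exp 1 := Real.one_le_exp (by norm_num)
  gcongr
  calc (1 + p ^ 2 * (Real.exp 1 - 1)) ^ #({x, y}ᶜ)
      ≤ (1 + p ^ 2 * (Real.exp 1 - 1)) ^ (Fintype.card V) := by
        gcongr
        · have : 0 ≤ p ^ 2 * (Real.exp 1 - 1) := by
            have : 0 ≤ Real.exp 1 - 1 := by linarith
            positivity
          linarith
        · exact card_le_univ _
    _ ≤ Real.exp (2 * p ^ 2) ^ (Fintype.card V) := by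
        have : 0 ≤ p ^ 2 * (Real.exp 1 - 1) := by
          have : 0 ≤ Real.exp 1 - 1 := by linarith
          positivity
        gcongr
        nlinarith [Real.add_one_le_exp (2 * p ^ 2), sq_nonneg p]
    _ = _ := by rw [← Real.exp_nat_mul]; congr 1; ring

/-- The edge xy is independent of the codegree, which depends on other pairs only. The resulting
factor p lowers the threshold constant from 2 to 3/2 in the union bound over pairs. The 2 in the
exponent pays for excluding x and y as common neighbours. -/
theorem Pr_mem_and_card_conb_le (hp1 : p ≤ 1) (hp0 : 0 ≤ p) {x y : V} (hxy : x ≠ y) {l : ℝ}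
    (hl : 0 ≤ l) (t : ℝ) :
    Pr p (pairs V) (fun ω => s(x, y) ∈ ω ∧ #(conb ω x y) ≤ t) ≤
      p * Real.exp (l * t + 2 - (1 - Real.exp (-l)) * (Fintype.card V * p ^ 2)) := by
  have hl1 : Real.exp (-l) ≤ 1 := Real.exp_le_one_iff.2 (by linarith)
  have hl0 := Real.exp_pos (-l)
  set e := s(x, y) with he
  set T : Finset V := {x, y}ᶜ with hT
  refine (Pr_le_Ex hp0 hp1
    (φ := fun ω => Real.exp (l * t) * if e ∈ ω then Real.exp (-l) ^ #(conb ω x y ∩ T) else 0)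
    (fun _ _ => by split_ifs <;> positivity) (fun ω hω h => ?_)).trans ?_
  · rw [conb_inter_compl hω, if_pos h.1, ← Real.exp_nat_mul, ← Real.exp_add]
    exact Real.one_le_exp (by nlinarith [h.2])
  rw [Ex_const_mul]
  have hmem : e ∈ pairs V := mem_pairs.2 hxy
  have hconb : ∀ ω : Finset (Sym2 V), conb (insert e ω) x y ∩ T = conb ω x y ∩ T := fun ω => by
    ext z
    simp only [mem_inter, mem_conb, mem_insert, he, Sym2.eq_iff, hT, mem_compl,
      mem_singleton]
    grind
  have h1 : Ex p (pairs V) (fun ω => if e ∈ ω then Real.exp (-l) ^ #(conb ω x y ∩ T) else 0) =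
      p * (1 + p ^ 2 * (Real.exp (-l) - 1)) ^ #T := by
    rw [← insert_erase hmem, Ex_insert (notMem_erase _ _),
      Ex_congr (E := (pairs V).erase e) (ψ := fun _ => 0), Ex_const, mul_zero, zero_add]
    · simp only [mem_insert, true_or, if_true, hconb]
      rw [Ex_pow_conb hxy (by simp [hT]) (by simp [hT])]
      intro z hz
      simp only [hT, mem_compl, mem_insert, mem_singleton] at hz
      simp only [mem_erase, mem_pairs, he, Ne, Sym2.eq_iff]
      grind
    · intro ω hω
      rw [if_neg fun h => notMem_erase _ _ (hω h)]
  have hTc : (Fintype.card V : ℝ) ≤ #T + 2 := by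
    have h := card_add_card_compl ({x, y} : Finset V)
    have h2 : #({x, y} : Finset V) ≤ 2 := card_le_two
    have : Fintype.card V ≤ #T + 2 := by rw [hT]; omega
    exact_mod_cast this
  rw [h1, mul_left_comm]
  refine mul_le_mul_of_nonneg_left ?_ hp0
  calc Real.exp (l * t) * (1 + p ^ 2 * (Real.exp (-l) - 1)) ^ #T
      ≤ Real.exp (l * t) * Real.exp (p ^ 2 * (Real.exp (-l) - 1)) ^ #T := by
        gcongr
        · nlinarith
        · linarith [Real.add_one_le_exp (p ^ 2 * (Real.exp (-l) - 1))]
    _ = Real.exp (l * t + #T * (p ^ 2 * (Real.exp (-l) - 1))) := by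
        rw [← Real.exp_nat_mul, Real.exp_add]
    _ ≤ _ := by
        refine Real.exp_le_exp.2 ?_
        have h2 : p ^ 2 * (1 - Real.exp (-l)) ≤ 1 := by nlinarith
        have h3 : 0 ≤ p ^ 2 * (1 - Real.exp (-l)) := mul_nonneg (sq_nonneg p) (by linarith)
        nlinarith

end Codegree


/-! ### Random sets that avoid the edges of a bipartite graph -/

section Avoid

variable {α : Type*} [DecidableEq α] {p : ℝ}

theorem Pr_le_of_antitone (hp0 : 0 ≤ p) (hp1 : p ≤ 1) {E₁ E : Finset α} (h : E₁ ⊆ E)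
    {P : Finset α → Prop} (hP : ∀ ω ω', ω ⊆ ω' → P ω' → P ω) : Pr p E P ≤ Pr p E₁ P := by
  calc Pr p E P ≤ Pr p E (fun ω => P (ω ∩ E₁)) :=
        Pr_mono hp0 hp1 fun ω _ hω => hP _ _ inter_subset_left hω
    _ = Pr p E₁ (fun ω => P (ω ∩ E₁)) :=
        Pr_of_subset h fun ω _ => by rw [inter_assoc, inter_self]
    _ ≤ Pr p E₁ P := Pr_mono hp0 hp1 fun ω hω h => by rwa [inter_eq_left.2 hω] at h

theorem Pr_card_le_le (hp0 : 0 ≤ p) (hp1 : p ≤ 1) (E : Finset α) (s : ℝ) :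
    Pr p E (fun ω => #ω ≤ s) ≤ Real.exp (s - p * #E / 2) := by
  refine (Pr_mono hp0 hp1 (Q := fun ω => -s ≤ ∑ e ∈ ω, (-1 : ℝ)) fun ω _ h => ?_).trans
    ((Pr_le_exp hp0 hp1 _ _).trans ?_)
  · simpa using h
  · have h1 : Real.exp (-1) ≤ 1 / 2 := by
      rw [Real.exp_neg, inv_eq_one_div]
      gcongr
      linarith [Real.add_one_le_exp (1 : ℝ)]
    rw [sum_const, nsmul_eq_mul]
    refine Real.exp_le_exp.2 ?_
    nlinarith [mul_nonneg hp0 (Nat.cast_nonneg (α := ℝ) #E)]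

/-- Greedy union: a new set meets the earlier ones in at most (#X - 1) k ≤ d / 2 elements, so it
contributes at least d / 2 new ones. -/
theorem card_mul_le_card_biUnion {β : Type*} [DecidableEq β] (X : Finset α) (N : α → Finset β)
    {d k : ℝ} (hd : ∀ x ∈ X, d ≤ #(N x)) (hk : ∀ x ∈ X, ∀ y ∈ X, x ≠ y → #(N x ∩ N y) ≤ k)
    (hk0 : 0 ≤ k) (hX : (#X - 1) * k ≤ d / 2) : #X * (d / 2) ≤ #(X.biUnion N) := by
  suffices h : ∀ X' ⊆ X, #X' * (d / 2) ≤ #(X'.biUnion N) from h X subset_rfl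
  intro X'
  induction X' using Finset.induction_on with
  | empty => simp
  | insert a s ha ih =>
    intro hs
    have ih := ih ((subset_insert _ _).trans hs)
    have hsX : ((#s : ℕ) : ℝ) ≤ #X - 1 := by
      have := card_le_card hs
      rw [card_insert_of_notMem ha] at this
      have : ((#s + 1 : ℕ) : ℝ) ≤ #X := by exact_mod_cast this
      push_cast at this
      linarith
    have hint : (#(N a ∩ s.biUnion N) : ℝ) ≤ #s * k := by
      rw [inter_biUnion]
      calc (#(s.biUnion fun x => N a ∩ N x) : ℝ) ≤ ∑ x ∈ s, (#(N a ∩ N x) : ℝ) := by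
            exact_mod_cast card_biUnion_le
        _ ≤ ∑ x ∈ s, k := sum_le_sum fun x hx =>
            hk a (hs (mem_insert_self _ _)) x (hs (mem_insert_of_mem hx))
              (fun h => ha (h ▸ hx))
        _ = _ := by simp
    have hcard := card_union_add_card_inter (N a) (s.biUnion N)
    have hcard : (#(N a ∪ s.biUnion N) : ℝ) + #(N a ∩ s.biUnion N) = #(N a) + #(s.biUnion N) := by
      exact_mod_cast hcard
    have ha' := hd a (hs (mem_insert_self _ _))
    rw [biUnion_insert, card_insert_of_notMem ha]
    push_cast
    nlinarith

/-- A random subset rarely avoids all edges of a bipartite graph between `X` and `Y` with large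
degrees and small codegrees. -/
theorem Pr_avoid_le (hp0 : 0 ≤ p) (hp1 : p ≤ 1) {X Y : Finset α} (hXY : Disjoint X Y)
    (N : α → Finset α) (hN : ∀ x ∈ X, N x ⊆ Y) {d k : ℝ} (hd : ∀ x ∈ X, d ≤ #(N x))
    (hk : ∀ x ∈ X, ∀ y ∈ X, x ≠ y → #(N x ∩ N y) ≤ k) (hk0 : 0 ≤ k) (t : ℕ)
    (ht : (t - 1) * k ≤ d / 2) :
    Pr p (X ∪ Y) (fun ω => ∀ x ∈ X, x ∈ ω → ∀ y ∈ N x, y ∉ ω) ≤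
      Real.exp (t - p * #X / 2) + Real.exp (-(p * t * (d / 2))) := by
  classical
  rw [Pr_union hXY]
  -- The part in X is revealed first. It rarely has at most t elements. Otherwise exactly t of them
  -- are retained, so that the overlaps stay below d / 2, and the part in Y must miss their joint
  -- neighbourhood of at least t d / 2 elements.
  calc _ ≤ Ex p X (fun ω => (if (#ω : ℝ) ≤ t then 1 else 0) + Real.exp (-(p * t * (d / 2)))) := by
        refine Ex_mono hp0 hp1 fun ω hω => ?_
        by_cases hc : (#ω : ℝ) ≤ t
        · rw [if_pos hc]
          linarith [Pr_le_one (p := p) (E := Y)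
            (P := fun ω₂ => ∀ x ∈ X, x ∈ ω ∪ ω₂ → ∀ y ∈ N x, y ∉ ω ∪ ω₂) hp0 hp1,
            Real.exp_pos (-(p * t * (d / 2)))]
        · rw [if_neg hc, zero_add]
          have hc : t ≤ #ω := by exact_mod_cast (not_le.1 hc).le
          obtain ⟨X', hX', hX't⟩ := exists_subset_card_eq hc
          have hsub := hX'.trans hω
          have hU := card_mul_le_card_biUnion X' N (fun x hx => hd x (hsub hx))
            (fun x hx y hy => hk x (hsub hx) y (hsub hy)) hk0 (by rwa [hX't])
          have hUY : X'.biUnion N ⊆ Y := biUnion_subset.2 fun x hx => hN x (hsub hx)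
          calc _ ≤ Pr p Y (fun ω₂ => Disjoint ω₂ (X'.biUnion N)) := by
                refine Pr_mono hp0 hp1 fun ω₂ _ h => ?_
                rw [disjoint_right]
                intro y hy hyω
                obtain ⟨x, hx, hy⟩ := mem_biUnion.1 hy
                exact h x (hsub hx) (mem_union_left _ (hX' hx)) y hy (mem_union_right _ hyω)
            _ = (1 - p) ^ #(X'.biUnion N) := Pr_inter_eq_empty hUY
            _ ≤ Real.exp (-p) ^ #(X'.biUnion N) := by
                gcongr
                linarith [Real.add_one_le_exp (-p)]
            _ ≤ _ := by
                rw [← Real.exp_nat_mul]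
                refine Real.exp_le_exp.2 ?_
                rw [hX't] at hU
                nlinarith
    _ = Pr p X (fun ω => #ω ≤ (t : ℝ)) + Real.exp (-(p * t * (d / 2))) := by
        rw [Ex_add, Ex_const, Pr_eq_Ex]
    _ ≤ _ := by gcongr; exact Pr_card_le_le hp0 hp1 X t

end Avoid


/-! ### Absence of triangles on a dense family of triples -/

section NoTriangle

variable {V : Type*} [Fintype V] [DecidableEq V] {p : ℝ}

theorem nb_mono {ω ω' : Finset (Sym2 V)} (h : ω ⊆ ω') (v : V) : nb ω v ⊆ nb ω' v := fun x hx => by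
  rw [mem_nb] at hx ⊢
  exact h hx

theorem conb_mono {ω ω' : Finset (Sym2 V)} (h : ω ⊆ ω') (x y : V) : conb ω x y ⊆ conb ω' x y :=
  inter_subset_inter (nb_mono h x) (nb_mono h y)

/-- The pairs in `ω` from the first coordinate `x` on, in a set `J` of ordered pairs. -/
def row (ω : Finset (Sym2 V)) (J : Finset (V × V)) (x : V) : Finset V :=
  univ.filter fun y => (x, y) ∈ J ∧ s(x, y) ∈ ω

@[simp] theorem mem_row {ω : Finset (Sym2 V)} {J : Finset (V × V)} {x y : V} :
    y ∈ row ω J x ↔ (x, y) ∈ J ∧ s(x, y) ∈ ω := by simp [row]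

theorem cnt_eq_sum_row (ω : Finset (Sym2 V)) {J : Finset (V × V)} {X : Finset V}
    (hJ : ∀ q ∈ J, q.1 ∈ X) : cnt ω J = ∑ x ∈ X, #(row ω J x) := by
  rw [cnt, card_eq_sum_card_fiberwise (f := Prod.fst) (t := X)
    (fun q hq => hJ q (mem_filter.1 hq).1)]
  refine sum_congr rfl fun x hx => ?_
  rw [← card_image_of_injective (row ω J x) (Prod.mk_right_injective x)]
  congr 1
  ext ⟨a, b⟩
  simp only [mem_filter, mem_image, row, mem_univ, true_and, Prod.mk.injEq]
  constructor
  · rintro ⟨h, rfl⟩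
    exact ⟨b, h, rfl, rfl⟩
  · rintro ⟨y, h, rfl, rfl⟩
    exact ⟨h, rfl⟩

/-- If a sum over `X` of numbers that are at most `D` exceeds `r D + n d`, then more than `r` of
them are at least `d`. -/
theorem le_card_filter_of_sum {α : Type*} (X : Finset α) (a : α → ℝ) {D d n r : ℝ}
    (hD : ∀ x ∈ X, a x ≤ D) (hD0 : 0 < D) (hd : 0 ≤ d) (hn : #X ≤ n)
    (h : r * D + n * d ≤ ∑ x ∈ X, a x) : r ≤ #{x ∈ X | d ≤ a x} := by
  have h1 : ∑ x ∈ X, a x ≤ ∑ x ∈ X, ((if d ≤ a x then D else 0) + d) := by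
    refine sum_le_sum fun x hx => ?_
    have := hD x hx
    split_ifs with h <;> linarith
  rw [sum_add_distrib, ← sum_filter, sum_const, sum_const, nsmul_eq_mul, nsmul_eq_mul] at h1
  have h2 : #X * d ≤ n * d := by gcongr
  have h3 : r * D ≤ #{x ∈ X | d ≤ a x} * D := by linarith
  exact le_of_mul_le_mul_right h3 hD0

/-- The edges of `ω` form a graph with degrees at most `D` and codegrees at most `k`. -/
def BoundedDegrees (D k : ℝ) (ω : Finset (Sym2 V)) : Prop :=
  (∀ v, #(nb ω v) ≤ D) ∧ ∀ x y, x ≠ y → #(conb ω x y) ≤ k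

theorem BoundedDegrees.mono {D k : ℝ} {ω ω' : Finset (Sym2 V)} (h : ω ⊆ ω')
    (hω : BoundedDegrees D k ω') : BoundedDegrees D k ω := by
  refine ⟨fun v => le_trans ?_ (hω.1 v), fun x y hxy => le_trans ?_ (hω.2 x y hxy)⟩
  · exact_mod_cast card_le_card (nb_mono h v)
  · exact_mod_cast card_le_card (conb_mono h x y)

theorem mk_right_injective (z : V) : Function.Injective fun y : V => s(z, y) := fun a b h => by
  rcases Sym2.eq_iff.1 h with h | h
  exacts [h.2, h.2.trans h.1]

/-- For fixed ω the star at z is a random subset of Y, and the absence of triangles over J means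
that it avoids the bipartite graph of the pairs of J in ω. The degree bound D forces many x to have
at least d partners there; the codegree bound k controls overlaps in `Pr_avoid_le`. -/
theorem Pr_star_avoid_le (hp0 : 0 ≤ p) (hp1 : p ≤ 1) (ω : Finset (Sym2 V)) {X Y : Finset V}
    (hXY : X ⊆ Y) {z : V} {J : Finset (V × V)} (hJ : J ⊆ X ×ˢ (Y \ X)) {D k d r M : ℝ}
    (hD0 : 0 < D) (hk0 : 0 ≤ k) (hd0 : 0 ≤ d) (hω : BoundedDegrees D k ω) (hM : M ≤ cnt ω J)
    (hr : r * D + Fintype.card V * d ≤ M) (t : ℕ) (ht : (t - 1) * k ≤ d / 2) :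
    Pr p (Y.image fun y => s(z, y))
      (fun ω' => ∀ x y, (x, y) ∈ J → s(x, y) ∈ ω → s(z, x) ∈ ω' → s(z, y) ∉ ω') ≤
      Real.exp (t - p * r / 2) + Real.exp (-(p * t * (d / 2))) := by
  classical
  rw [Pr_eq_Ex, Ex_image (mk_right_injective z).injOn, ← Pr_eq_Ex]
  set X' := {x ∈ X | d ≤ #(row ω J x)} with hX'
  have hX'd : ∀ x ∈ X', d ≤ #(row ω J x) := fun x hx => by
    rw [hX', mem_filter] at hx
    exact hx.2
  have hrow : ∀ x, row ω J x ⊆ Y \ X := fun x y hy =>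
    (mem_product.1 (hJ (mem_row.1 hy).1)).2
  have hrX' : r ≤ #X' := by
    refine le_card_filter_of_sum X (fun x => (#(row ω J x) : ℝ)) (D := D) (fun x _ => ?_) hD0 hd0
      (n := Fintype.card V) (by exact_mod_cast card_le_univ X) ?_
    · refine le_trans ?_ (hω.1 x)
      exact_mod_cast card_le_card fun y hy => mem_nb.2 (mem_row.1 hy).2
    · rw [cnt_eq_sum_row ω fun q hq => (mem_product.1 (hJ hq)).1] at hM
      push_cast at hM
      linarith
  have hdis : Disjoint X' (Y \ X) := disjoint_sdiff.mono_left (filter_subset _ _)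
  calc _ ≤ Pr p (X' ∪ (Y \ X)) (fun R => ∀ x ∈ X', x ∈ R → ∀ y ∈ row ω J x, y ∉ R) := by
        refine (Pr_mono hp0 hp1 (Q := fun R => ∀ x ∈ X', x ∈ R → ∀ y ∈ row ω J x, y ∉ R) ?_).trans
          (Pr_le_of_antitone hp0 hp1 (union_subset ((filter_subset _ _).trans hXY) sdiff_subset) ?_)
        · intro R _ h x _ hxR y hy hyR
          obtain ⟨hy1, hy2⟩ := mem_row.1 hy
          exact h x y hy1 hy2 (mem_image_of_mem _ hxR) (mem_image_of_mem _ hyR)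
        · exact fun R R' hR h x hx hxR y hy hyR => h x hx (hR hxR) y hy (hR hyR)
    _ ≤ Real.exp (t - p * #X' / 2) + Real.exp (-(p * t * (d / 2))) := by
        refine Pr_avoid_le hp0 hp1 hdis (row ω J) (fun x _ => hrow x)
          hX'd (fun x _ y _ hxy => ?_) hk0 t ht
        refine le_trans ?_ (hω.2 x y hxy)
        have hsub : row ω J x ∩ row ω J y ⊆ conb ω x y := fun w hw => by
          obtain ⟨h1, h2⟩ := mem_inter.1 hw
          exact mem_conb.2 ⟨(mem_row.1 h1).2, (mem_row.1 h2).2⟩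
        exact_mod_cast card_le_card hsub
    _ ≤ _ := by gcongr

/-- It is very unlikely that no triangle of a random graph meets a dense set of prescribed
triples. -/
theorem Pr_no_triangle_le (hp0 : 0 ≤ p) (hp1 : p ≤ 1) {E : Finset (Sym2 V)} (hE : E ⊆ pairs V)
    {Y Z : Finset V} (hYZ : Disjoint Z Y) (hEY : ∀ x ∈ Y, ∀ y ∈ Y, x ≠ y → s(x, y) ∈ E)
    (hEZ : ∀ z ∈ Z, ∀ y ∈ Y, s(z, y) ∈ E) (X : V → Finset V) (J : V → Finset (V × V))
    (hX : ∀ z ∈ Z, X z ⊆ Y) (hJ : ∀ z ∈ Z, J z ⊆ X z ×ˢ (Y \ X z)) {D k d r M : ℝ}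
    (hD0 : 0 < D) (hk0 : 0 ≤ k) (hd0 : 0 ≤ d) (hM : ∀ z ∈ Z, M ≤ #(J z))
    (hr : r * D + Fintype.card V * d ≤ p * M / 4) (t : ℕ) (ht : (t - 1) * k ≤ d / 2) :
    Pr p E (fun ω => BoundedDegrees D k ω ∧ ∀ z ∈ Z, ∀ x y, (x, y) ∈ J z → s(x, y) ∈ ω →
      s(z, x) ∈ ω → s(z, y) ∉ ω) ≤
      #Z * Real.exp (-(p * M / 16)) +
        (Real.exp (t - p * r / 2) + Real.exp (-(p * t * (d / 2)))) ^ #Z := by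
  classical
  set EY := E.filter (fun e => ∀ x ∈ e, x ∈ Y) with hEYdef
  set S : V → Finset (Sym2 V) := fun z => Y.image fun y => s(z, y) with hS
  have hSsub : Z.biUnion S ⊆ E := by
    refine biUnion_subset.2 fun z hz e he => ?_
    obtain ⟨y, hy, rfl⟩ := mem_image.1 he
    exact hEZ z hz y hy
  have hdis : Disjoint EY (Z.biUnion S) := by
    rw [disjoint_left]
    intro e he he'
    obtain ⟨z, hz, he'⟩ := mem_biUnion.1 he'
    obtain ⟨y, hy, rfl⟩ := mem_image.1 he'
    exact disjoint_left.1 hYZ hz ((mem_filter.1 he).2 z (Sym2.mem_mk_left _ _))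
  have hSd : (Z : Set V).PairwiseDisjoint S := by
    intro z hz z' hz' hzz'
    rw [Function.onFun, disjoint_left]
    intro e he he'
    obtain ⟨y, hy, rfl⟩ := mem_image.1 he
    obtain ⟨y', hy', h⟩ := mem_image.1 he'
    rw [Sym2.eq_iff] at h
    rcases h with h | h
    · exact hzz' h.1.symm
    · exact disjoint_left.1 hYZ hz (h.2 ▸ hy')
  set q := Real.exp (t - p * r / 2) + Real.exp (-(p * t * (d / 2))) with hq
  have hq0 : 0 ≤ q := by positivity
  have hsub : EY ∪ Z.biUnion S ⊆ E := union_subset (filter_subset _ _) hSsub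
  -- The event is inherited by smaller edge sets, so all pairs except those inside Y and those
  -- between Z and Y can be dropped.
  refine (Pr_le_of_antitone hp0 hp1 hsub ?_).trans ?_
  · exact fun ω ω' h hω => ⟨hω.1.mono h, fun z hz x y hxy h1 h2 h3 =>
      hω.2 z hz x y hxy (h h1) (h h2) (h h3)⟩
  rw [Pr_union hdis]
  -- The edges inside Y are revealed first. Either some `J z` receives far fewer edges than
  -- expected, or the stars at the vertices of Z, which are independent, each succeed with
  -- probability at most q.
  calc _ ≤ Ex p EY (fun ω => (if ∃ z ∈ Z, cnt ω (J z) ≤ p * M / 4 then 1 else 0) + q ^ #Z) := by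
        refine Ex_mono hp0 hp1 fun ω hω => ?_
        by_cases hc : ∃ z ∈ Z, cnt ω (J z) ≤ p * M / 4
        · rw [if_pos hc]
          exact (Pr_le_one hp0 hp1).trans (by linarith [pow_nonneg hq0 #Z])
        rw [if_neg hc, zero_add]
        push Not at hc
        by_cases hb : BoundedDegrees D k ω
        · obtain ⟨φ, hφ⟩ : ∃ φ : V → Finset (Sym2 V) → ℝ, φ = fun z ω'' =>
              if ∀ x y, (x, y) ∈ J z → s(x, y) ∈ ω → s(z, x) ∈ ω'' → s(z, y) ∉ ω''
                then (1 : ℝ) else 0 := ⟨_, rfl⟩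
          calc _ ≤ Ex p (Z.biUnion S) (fun ω' => ∏ z ∈ Z, φ z (ω' ∩ S z)) := by
                refine Pr_le_Ex hp0 hp1 (fun ω' _ => prod_nonneg fun z _ => ?_)
                  fun ω' _ h => (prod_eq_one fun z hz => ?_).ge
                · rw [hφ]
                  dsimp only
                  split_ifs <;> norm_num
                · rw [hφ]
                  exact if_pos fun x y hxy h1 h2 h3 => h.2 z hz x y hxy
                    (mem_union_left _ h1) (mem_union_right _ (mem_inter.1 h2).1)
                    (mem_union_right _ (mem_inter.1 h3).1)
            _ = ∏ z ∈ Z, Pr p (S z) (fun ω'' => ∀ x y, (x, y) ∈ J z → s(x, y) ∈ ω →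
                  s(z, x) ∈ ω'' → s(z, y) ∉ ω'') := by
                rw [Ex_biUnion Z S φ hSd, hφ]
                exact prod_congr rfl fun z _ => (Pr_eq_Ex _ _ _).symm
            _ ≤ ∏ z ∈ Z, q := by
                refine prod_le_prod (fun z _ => Pr_nonneg hp0 hp1) fun z hz => ?_
                exact Pr_star_avoid_le hp0 hp1 ω (hX z hz) (hJ z hz) hD0 hk0 hd0 hb
                  (hc z hz).le hr t ht
            _ = q ^ #Z := prod_const _
        · refine (Pr_mono hp0 hp1 (Q := fun _ => False) fun ω' _ h => ?_).trans ?_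
          · exact hb (h.1.mono subset_union_left)
          · rw [Pr_eq_Ex]
            simpa [Ex_const] using pow_nonneg hq0 #Z
    _ = Pr p EY (fun ω => ∃ z ∈ Z, cnt ω (J z) ≤ p * M / 4) + q ^ #Z := by
        rw [Ex_add, Ex_const, Pr_eq_Ex]
    _ ≤ _ := by
        gcongr
        refine Pr_exists_le_card_mul hp0 hp1 Z _ fun z hz => ?_
        -- With l = 1/4 the exponent is at most p M / 16 - p M / 8.
        refine (Pr_cnt_le_le hp0 hp1 ((filter_subset _ _).trans hE) (J z) (l := 1 / 4) (by norm_num)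
          (by norm_num) ?_ _).trans ?_
        · intro w hw
          obtain ⟨h1, h2⟩ := mem_product.1 (hJ z hz hw)
          obtain ⟨h2, h3⟩ := mem_sdiff.1 h2
          refine mem_filter.2 ⟨hEY _ (hX z hz h1) _ h2 fun h => h3 (h ▸ h1), ?_⟩
          intro x hx
          rcases Sym2.mem_iff.1 hx with rfl | rfl
          exacts [hX z hz h1, h2]
        · refine Real.exp_le_exp.2 ?_
          have := hM z hz
          have : p * M ≤ p * #(J z) := by gcongr
          linarith

end NoTriangle

/-! ### Bipartite parts of dense relations -/

section Dense

variable {V : Type*} [Fintype V] [DecidableEq V]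

/-- A dense relation has a dense bipartite part. -/
theorem exists_dense_bipartite {Y : Finset V} {D : Finset (V × V)} (hD : D ⊆ Y ×ˢ Y) {δ : ℝ}
    (hδ0 : 0 < δ) (hδ : δ * Fintype.card V ^ 2 ≤ #D) (hn : 8 ≤ δ * Fintype.card V) :
    ∃ X ⊆ Y, ∃ J ⊆ D, J ⊆ X ×ˢ (Y \ X) ∧ δ ^ 2 / 32 * Fintype.card V ^ 2 ≤ #J := by
  classical
  set n : ℝ := ((Fintype.card V : ℕ) : ℝ) with hndef
  have hn0 : 0 < n := by
    by_contra h
    nlinarith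
  set a : V → Finset V := fun x => univ.filter fun y => (x, y) ∈ D with ha
  have hcard : ∀ J : Finset (V × V), ∀ X : Finset V, (∀ q ∈ J, q.1 ∈ X) →
      #J = ∑ x ∈ X, #(univ.filter fun y => (x, y) ∈ J) := by
    intro J X hJ
    rw [card_eq_sum_card_fiberwise (f := Prod.fst) (t := X) (fun q hq => hJ q hq)]
    refine sum_congr rfl fun x hx => ?_
    rw [← card_image_of_injective (univ.filter fun y => (x, y) ∈ J) (Prod.mk_right_injective x)]
    congr 1
    ext ⟨b, c⟩
    simp only [mem_filter, mem_image, mem_univ, true_and, Prod.mk.injEq]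
    constructor
    · rintro ⟨h, rfl⟩
      exact ⟨c, h, rfl, rfl⟩
    · rintro ⟨y, h, rfl, rfl⟩
      exact ⟨h, rfl⟩
  have hhigh : δ * n / 2 ≤ #{x ∈ Y | δ * n / 2 ≤ #(a x)} := by
    refine le_card_filter_of_sum Y (fun x => (#(a x) : ℝ)) (D := n) (n := n) (fun x _ => ?_) hn0
      (by positivity) ?_ ?_
    · exact Nat.cast_le.2 (card_le_univ _)
    · exact Nat.cast_le.2 (card_le_univ _)
    · rw [hcard D Y fun q hq => (mem_product.1 (hD hq)).1] at hδ
      push_cast at hδ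
      nlinarith
  -- Only about δ n / 8 of the high-degree vertices enter X. Then |X| ≤ δ n / 4, and each x ∈ X
  -- keeps at least half of its δ n / 2 partners outside X.
  have hceil : ⌈δ * n / 8⌉₊ ≤ #{x ∈ Y | δ * n / 2 ≤ #(a x)} :=
    Nat.ceil_le.2 (by nlinarith)
  obtain ⟨X, hX, hXc⟩ := exists_subset_card_eq hceil
  have hX1 : δ * n / 8 ≤ #X := by rw [hXc]; exact Nat.le_ceil _
  have hX2 : (#X : ℝ) ≤ δ * n / 4 := by
    rw [hXc]
    have := Nat.ceil_lt_add_one (show 0 ≤ δ * n / 8 by positivity)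
    linarith
  have hXY : X ⊆ Y := hX.trans (filter_subset _ _)
  refine ⟨X, hXY, D.filter (fun q => q.1 ∈ X ∧ q.2 ∉ X), filter_subset _ _, ?_, ?_⟩
  · intro q hq
    obtain ⟨h1, h2, h3⟩ := mem_filter.1 hq
    exact mem_product.2 ⟨h2, mem_sdiff.2 ⟨(mem_product.1 (hD h1)).2, h3⟩⟩
  · rw [hcard _ X fun q hq => (mem_filter.1 hq).2.1]
    push_cast
    calc δ ^ 2 / 32 * n ^ 2 = (δ * n / 8) * (δ * n / 4) := by ring
      _ ≤ #X * (δ * n / 4) := by gcongr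
      _ = ∑ x ∈ X, δ * n / 4 := by simp
      _ ≤ _ := by
        refine sum_le_sum fun x hx => ?_
        have h1 : a x ⊆ (univ.filter fun y => (x, y) ∈ D.filter (fun q => q.1 ∈ X ∧ q.2 ∉ X)) ∪ X := by
          intro y hy
          have hy := (mem_filter.1 hy).2
          by_cases h : y ∈ X
          · exact mem_union_right _ h
          · exact mem_union_left _ (by simp [hy, hx, h])
        have h2 := (card_le_card h1).trans (card_union_le _ _)
        have h3 := (mem_filter.1 (hX hx)).2
        have h2 : (#(a x) : ℝ) ≤ #(univ.filter fun y => (x, y) ∈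
            D.filter (fun q => q.1 ∈ X ∧ q.2 ∉ X)) + #X := by exact_mod_cast h2
        linarith

end Dense


/-! ### Cocycles whose values are prescribed on most pairs -/

section Stability

variable {V : Type*} [Fintype V] [DecidableEq V] {p : ℝ}

/-- `f` is a cocycle: every triangle of the graph with edge set `ω` has an even number of edges at
which `f` is nonzero. -/
def IsCocycle (ω : Finset (Sym2 V)) (f : Sym2 V → ZMod 2) : Prop :=
  ∀ x y z, s(x, y) ∈ ω → s(y, z) ∈ ω → s(x, z) ∈ ω → f s(x, y) + f s(y, z) + f s(x, z) = 0

theorem IsCocycle.mono {ω ω' : Finset (Sym2 V)} {f : Sym2 V → ZMod 2} (h : ω ⊆ ω')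
    (hf : IsCocycle ω' f) : IsCocycle ω f :=
  fun x y z h1 h2 h3 => hf x y z (h h1) (h h2) (h h3)

theorem IsCocycle.eq_add {ω : Finset (Sym2 V)} {f : Sym2 V → ZMod 2} (hf : IsCocycle ω f)
    {x y z : V} (hxy : s(x, y) ∈ ω) (hzx : s(z, x) ∈ ω) (hzy : s(z, y) ∈ ω) :
    f s(x, y) = f s(z, x) + f s(z, y) := by
  have h := hf z x y hzx hxy hzy
  generalize f s(x, y) = a at *
  generalize f s(z, x) = b at *
  generalize f s(z, y) = c at *
  revert a b c
  decide

/-- The ordered pairs in `Q` that are edges of `ω` at which `f` differs from the coboundary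
of `h`. -/
def defect (ω : Finset (Sym2 V)) (f : Sym2 V → ZMod 2) (h : V → ZMod 2) (Q : Finset (V × V)) :
    Finset (V × V) :=
  {q ∈ Q | s(q.1, q.2) ∈ ω ∧ f s(q.1, q.2) ≠ h q.1 + h q.2}

@[simp] theorem mem_defect {ω : Finset (Sym2 V)} {f : Sym2 V → ZMod 2} {h : V → ZMod 2}
    {Q : Finset (V × V)} {q : V × V} :
    q ∈ defect ω f h Q ↔ q ∈ Q ∧ s(q.1, q.2) ∈ ω ∧ f s(q.1, q.2) ≠ h q.1 + h q.2 := by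
  simp [defect]

open Classical in
/-- If `f` is prescribed on most edges, then typically a cocycle `f` is close to a coboundary. -/
theorem Pr_prescribed_cocycle_le (hp0 : 0 ≤ p) (hp1 : p ≤ 1) {E : Finset (Sym2 V)}
    (hE : E ⊆ pairs V) {Y Z : Finset V} (hYZ : Disjoint Z Y)
    (hEY : ∀ x ∈ Y, ∀ y ∈ Y, x ≠ y → s(x, y) ∈ E) (hEZ : ∀ z ∈ Z, ∀ y ∈ Y, s(z, y) ∈ E)
    (cov : V → V → Prop) (f₀ : V → V → ZMod 2) {D k d r δ τ : ℝ} (hD0 : 0 < D) (hk0 : 0 ≤ k)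
    (hd0 : 0 ≤ d) (hδ0 : 0 < δ) (hn : 16 ≤ δ * Fintype.card V)
    (hcov : (#{q ∈ (Z ∪ Y) ×ˢ (Z ∪ Y) | q.1 ≠ q.2 ∧ ¬ cov q.1 q.2} : ℝ) ≤
      δ / 4 * Fintype.card V ^ 2)
    (hcovZ : (#{q ∈ (Z ∪ Y) ×ˢ (Z ∪ Y) | q.1 ≠ q.2 ∧ ¬ cov q.1 q.2} : ℝ) ≤
      δ * #Z * Fintype.card V / 16)
    (hr : r * D + Fintype.card V * d ≤ p * (δ ^ 2 / 128 * Fintype.card V ^ 2) / 4)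
    (t : ℕ) (ht : (t - 1) * k ≤ d / 2)
    (hq1 : Real.exp (t - p * r / 2) + Real.exp (-(p * t * (d / 2))) ≤ 1) :
    Pr p E (fun ω => BoundedDegrees D k ω ∧ ∃ f, IsCocycle ω f ∧
      (∀ x y, cov x y → s(x, y) ∈ ω → f s(x, y) = f₀ x y) ∧
      ∀ h, τ < #(defect ω f h (Y ×ˢ Y))) ≤
      Real.exp (-(τ / 2) + p * (δ * Fintype.card V ^ 2)) +
      (Fintype.card V * Real.exp (-(p * (δ ^ 2 / 128 * Fintype.card V ^ 2) / 16)) +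
        (Real.exp (t - p * r / 2) + Real.exp (-(p * t * (d / 2)))) ^ ((#Z : ℝ) / 2)) := by
  set n : ℝ := ((Fintype.card V : ℕ) : ℝ) with hndef
  have hn0 : 0 < n := by
    by_contra h
    nlinarith
  set M := δ ^ 2 / 128 * n ^ 2 with hM
  set q₀ := Real.exp (t - p * r / 2) + Real.exp (-(p * t * (d / 2))) with hq₀
  have hq₀0 : 0 < q₀ := by positivity
  -- The candidate potential is h = f₀ z: off `bad z` its coboundary agrees with f, while a pair of
  -- `odd z` cannot lie in a triangle with z.
  set bad : V → Finset (V × V) := fun z => (Y ×ˢ Y).filter fun q => q.1 ≠ q.2 ∧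
    ¬ (cov z q.1 ∧ cov z q.2 ∧ cov q.1 q.2 ∧ f₀ q.1 q.2 = f₀ z q.1 + f₀ z q.2) with hbad
  set odd : V → Finset (V × V) := fun z => (Y ×ˢ Y).filter fun q => q.1 ≠ q.2 ∧
    cov z q.1 ∧ cov z q.2 ∧ cov q.1 q.2 ∧ f₀ q.1 q.2 ≠ f₀ z q.1 + f₀ z q.2 with hodd
  -- If some z has few bad pairs, all defects of f₀ z are edges among them, and a fixed sparse set
  -- of pairs rarely carries τ edges. Otherwise most z have many odd pairs.
  by_cases hcase : ∃ z ∈ Z, (#(bad z) : ℝ) ≤ δ * n ^ 2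
  · obtain ⟨z, hz, hzb⟩ := hcase
    have hrest : 0 ≤ n * Real.exp (-(p * M / 16)) + q₀ ^ ((#Z : ℝ) / 2) := by positivity
    refine le_trans ?_ (le_add_of_nonneg_right hrest)
    refine (Pr_mono hp0 hp1 (Q := fun ω => τ ≤ cnt ω (bad z)) ?_).trans
      ((Pr_le_cnt_le hp0 hp1 hE (bad z) (l := 1 / 2) (by norm_num) le_rfl τ).trans ?_)
    · rintro ω hω ⟨_, f, hf, hf₀, hh⟩
      refine (hh fun x => f₀ z x).le.trans (Nat.cast_le.2 (card_le_card ?_))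
      intro q hq
      obtain ⟨h1, h2, h3⟩ := mem_defect.1 hq
      refine mem_filter.2 ⟨mem_filter.2 ⟨h1, ne_of_mem (hω.trans hE) h2, ?_⟩, h2⟩
      rintro ⟨_, _, h6, h7⟩
      exact h3 (by rw [hf₀ _ _ h6 h2, h7])
    · refine Real.exp_le_exp.2 ?_
      have : p * #(bad z) ≤ p * (δ * n ^ 2) := by gcongr
      linarith
  · push Not at hcase
    have hrest : 0 ≤ Real.exp (-(τ / 2) + p * (δ * n ^ 2)) := by positivity
    refine le_trans ?_ (le_add_of_nonneg_left hrest)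
    set Z' := Z.filter fun z => δ / 2 * n ^ 2 ≤ #(odd z) with hZ'
    set U : Finset (V × V) :=
      ((Z ∪ Y) ×ˢ (Z ∪ Y)).filter fun q => q.1 ≠ q.2 ∧ ¬ cov q.1 q.2 with hU
    set u : V → Finset V := fun z => Y.filter fun x => ¬ cov z x with hu
    have hbadle : ∀ z, (#(bad z) : ℝ) ≤ #(odd z) + (#U + 2 * (#(u z) * n)) := by
      intro z
      have hsub : bad z ⊆ odd z ∪ (U ∪ (u z ×ˢ univ ∪ univ ×ˢ u z)) := by
        intro q hq
        simp only [hbad, hodd, hU, hu, mem_filter, mem_union, mem_product, mem_univ, true_and,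
          and_true] at hq ⊢
        tauto
      have h := (card_le_card hsub).trans ((card_union_le _ _).trans (Nat.add_le_add_left
        ((card_union_le _ _).trans (Nat.add_le_add_left (card_union_le _ _) _)) _))
      rw [card_product, card_product, card_univ] at h
      have h : (#(bad z) : ℝ) ≤ #(odd z) + (#U + (#(u z) * n + n * #(u z))) := by
        rw [hndef]; exact_mod_cast h
      linarith
    -- Here z has more than δ n² bad pairs but fewer than δ n² / 2 odd ones. Since |U| ≤ δ n² / 4,
    -- at least δ n / 8 pairs at z are unprescribed, and those for different z are distinct elements
    -- of U.
    have hsum : (#(Z.filter fun z => ¬ δ / 2 * n ^ 2 ≤ #(odd z)) : ℝ) * (δ / 8 * n) ≤ #U := by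
      set Z'' := Z.filter fun z => ¬ δ / 2 * n ^ 2 ≤ #(odd z) with hZ''
      have h1 : #(Z''.sigma u) ≤ #U := by
        refine card_le_card_of_injOn (fun a => (a.1, a.2)) ?_ ?_
        · rintro ⟨z, x⟩ h
          obtain ⟨h1, h2⟩ := mem_sigma.1 (mem_coe.1 h)
          have h1 := (mem_filter.1 h1).1
          obtain ⟨h2, h3⟩ := mem_filter.1 h2
          refine mem_coe.2 (mem_filter.2 ⟨mem_product.2 ⟨mem_union_left _ h1,
            mem_union_right _ h2⟩, ?_, h3⟩)
          exact fun h => disjoint_left.1 hYZ h1 ((show z = x from h) ▸ h2)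
        · rintro ⟨z, x⟩ _ ⟨z', x'⟩ _ h
          simp only [Prod.mk.injEq] at h
          obtain ⟨rfl, rfl⟩ := h
          rfl
      rw [card_sigma] at h1
      calc (#Z'' : ℝ) * (δ / 8 * n) = ∑ z ∈ Z'', δ / 8 * n := by simp
        _ ≤ ∑ z ∈ Z'', (#(u z) : ℝ) := by
            refine sum_le_sum fun z hz => ?_
            obtain ⟨hz1, hz2⟩ := mem_filter.1 hz
            have h2 := hcase z hz1
            have h3 := hbadle z
            have h4 : δ / 4 * n ^ 2 ≤ 2 * (#(u z) * n) := by linarith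
            have h5 : (δ / 8 * n) * n ≤ #(u z) * n := by linarith
            exact le_of_mul_le_mul_right h5 hn0
        _ ≤ #U := by exact_mod_cast h1
    have hZ'card : (#Z : ℝ) / 2 ≤ #Z' := by
      have h1 := card_filter_add_card_filter_not (s := Z) fun z => δ / 2 * n ^ 2 ≤ #(odd z)
      have h1 : (#Z' : ℝ) + #(Z.filter fun z => ¬ δ / 2 * n ^ 2 ≤ #(odd z)) = #Z := by
        exact_mod_cast h1
      have h2 := hsum.trans hcovZ
      have h3 : (#(Z.filter fun z => ¬ δ / 2 * n ^ 2 ≤ #(odd z)) : ℝ) ≤ #Z / 2 := by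
        have h4 : (#(Z.filter fun z => ¬ δ / 2 * n ^ 2 ≤ #(odd z)) : ℝ) * (δ / 8 * n) ≤
          #Z / 2 * (δ / 8 * n) := by linarith
        exact le_of_mul_le_mul_right h4 (by positivity)
      linarith
    -- Density δ / 2 in `exists_dense_bipartite` gives (δ / 2)² / 32 = δ² / 128.
    have hex : ∀ z ∈ Z', ∃ X ⊆ Y, ∃ J ⊆ odd z, J ⊆ X ×ˢ (Y \ X) ∧ M ≤ #J := by
      intro z hz
      have hz := (mem_filter.1 hz).2
      obtain ⟨X, hX, J, hJ, hJX, hJM⟩ := exists_dense_bipartite (Y := Y) (D := odd z)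
        (filter_subset _ _) (half_pos hδ0) hz (by linarith)
      exact ⟨X, hX, J, hJ, hJX, by rw [hM]; convert hJM using 1; ring⟩
    choose! X hX J hJodd hJX hJM using hex
    have hZ'Z : Z' ⊆ Z := filter_subset _ _
    calc _ ≤ Pr p E (fun ω => BoundedDegrees D k ω ∧ ∀ z ∈ Z', ∀ x y, (x, y) ∈ J z → s(x, y) ∈ ω →
              s(z, x) ∈ ω → s(z, y) ∉ ω) := by
          refine Pr_mono hp0 hp1 ?_
          rintro ω hω ⟨hb, f, hf, hf₀, -⟩
          refine ⟨hb, fun z hz x y hxy h1 h2 h3 => ?_⟩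
          obtain ⟨-, -, h4, h5, h6, h7⟩ := mem_filter.1 (hJodd z hz hxy)
          refine h7 ?_
          rw [← hf₀ _ _ h4 h2, ← hf₀ _ _ h5 h3, ← hf₀ _ _ h6 h1]
          exact hf.eq_add h1 h2 h3
      _ ≤ #Z' * Real.exp (-(p * M / 16)) + q₀ ^ #Z' :=
          Pr_no_triangle_le hp0 hp1 hE (hYZ.mono_left hZ'Z) hEY (fun z hz => hEZ z (hZ'Z hz))
            X J hX hJX hD0 hk0 hd0 hJM hr t ht
      _ ≤ _ := by
          gcongr
          · exact Nat.cast_le.2 (card_le_univ _)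
          · rw [← Real.rpow_natCast]
            exact Real.rpow_le_rpow_of_exponent_ge hq₀0 hq1 hZ'card

end Stability


/-! ### Exposing the edges at a small set S -/

section Exposure

variable {V : Type*} [Fintype V] [DecidableEq V] {p : ℝ}

/-- The ordered pairs of vertices outside `S` without a common neighbour in `S`. -/
def uncovered (S : Finset V) (ω : Finset (Sym2 V)) : Finset (V × V) :=
  {q ∈ Sᶜ ×ˢ Sᶜ | q.1 ≠ q.2 ∧ conb ω q.1 q.2 ∩ S = ∅}

/-- Markov's inequality suffices, because only the density of uncovered pairs matters later. -/
theorem Pr_lt_card_uncovered_le (hp0 : 0 ≤ p) (hp1 : p ≤ 1) (S : Finset V) {c : ℝ} (hc : 0 < c) :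
    Pr p (pairs V) (fun ω => c < #(uncovered S ω)) ≤
      Fintype.card V ^ 2 * Real.exp (-(p ^ 2 * #S)) / c := by
  classical
  set I : Finset (V × V) := (Sᶜ ×ˢ Sᶜ).filter fun q => q.1 ≠ q.2 with hI
  have h1 : Pr p (pairs V) (fun ω => c < #(uncovered S ω)) ≤
      Ex p (pairs V) (fun ω => (∑ q ∈ I, if conb ω q.1 q.2 ∩ S = ∅ then 1 else 0) * c⁻¹) := by
    refine Pr_le_Ex hp0 hp1 (fun ω _ => ?_) fun ω _ h => ?_
    · exact mul_nonneg (sum_nonneg fun _ _ => by split_ifs <;> norm_num) (inv_nonneg.2 hc.le)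
    · rw [← sum_filter, sum_const, nsmul_eq_mul, mul_one, hI, filter_filter, ← div_eq_mul_inv,
        le_div_iff₀ hc, one_mul]
      exact h.le
  refine h1.trans ?_
  rw [Ex_mul_const, Ex_sum, div_eq_mul_inv]
  gcongr
  calc _ ≤ ∑ q ∈ I, Real.exp (-(p ^ 2 * #S)) := by
        refine sum_le_sum fun q hq => ?_
        obtain ⟨hq, hne⟩ := mem_filter.1 hq
        obtain ⟨hq1, hq2⟩ := mem_product.1 hq
        rw [mem_compl] at hq1 hq2
        rw [← Pr_eq_Ex]
        refine Pr_conb_disjoint_le hp1 hp0 hne hq1 hq2 fun z hz => ?_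
        rw [mem_pairs, mem_pairs]
        exact ⟨fun h => hq1 (h ▸ hz), fun h => hq2 (h ▸ hz)⟩
    _ = #I * Real.exp (-(p ^ 2 * #S)) := by simp
    _ ≤ _ := by
        gcongr
        have := card_le_univ I
        rw [Fintype.card_prod] at this
        rw [sq]
        exact_mod_cast this

theorem sum_row_card_le (ω : Finset (Sym2 V)) {D k : ℝ} (hω : BoundedDegrees D k ω)
    (A : Finset V) : (cnt ω (A ×ˢ univ) : ℝ) ≤ #A * D := by
  rw [cnt_product]
  push_cast
  calc _ ≤ ∑ x ∈ A, D := sum_le_sum fun x _ => by rw [inter_univ]; exact hω.1 x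
    _ = _ := by simp

/-- The value at `(x, y)` of a cocycle with support `F` among the edges `ω` at `S`, read off from a
common neighbour of `x` and `y` in `S`. -/
def readOff (S : Finset V) (ω F : Finset (Sym2 V)) (x y : V) : ZMod 2 := by
  classical
  exact if h : (conb ω x y ∩ S).Nonempty then
    (if s(h.choose, x) ∈ F then 1 else 0) + (if s(h.choose, y) ∈ F then 1 else 0) else 0

/-- The triangle through the chosen common neighbour forces the value, and the default 0 never
intervenes. The choice of neighbour depends on ω and not on f, so f enters only through its support
in ω; hence at most 2 ^ #ω prescriptions cover all cocycles. -/
theorem readOff_eq {S : Finset V} {ω ω' : Finset (Sym2 V)} (hω : ω ⊆ ω') {f : Sym2 V → ZMod 2}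
    (hf : IsCocycle ω' f) {x y : V} (h : (conb ω x y ∩ S).Nonempty) (hxy : s(x, y) ∈ ω') :
    f s(x, y) = readOff S ω (ω.filter fun e => f e ≠ 0) x y := by
  have hz := (mem_inter.1 h.choose_spec).1
  rw [mem_conb, Sym2.eq_swap, Sym2.eq_swap (a := y)] at hz
  rw [readOff, dif_pos h, hf.eq_add hxy (hω hz.1) (hω hz.2)]
  have hval : ∀ a : ZMod 2, a = if a ≠ 0 then 1 else 0 := by decide
  simp only [mem_filter, hz.1, hz.2, true_and]
  rw [← hval, ← hval]

/-- For fixed exposed edges ω₁ there are 2 ^ #ω₁ possible supports, each handled by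
`Pr_prescribed_cocycle_le` on the unexposed pairs. The average of 2 ^ #ω₁ is (1 + p) ^ #E₁, which
gives the factor in front. The term 2 (|S| + |Z|) D allows every edge at S ∪ Z to be a defect. -/
theorem Pr_far_cocycle_le (hp0 : 0 ≤ p) (hp1 : p ≤ 1) {S Z : Finset V} (hSZ : Disjoint S Z)
    {D k d r δ τ : ℝ} (hD0 : 0 < D) (hk0 : 0 ≤ k) (hd0 : 0 ≤ d) (hδ0 : 0 < δ)
    (hn : 16 ≤ δ * Fintype.card V)
    (hr : r * D + Fintype.card V * d ≤ p * (δ ^ 2 / 128 * Fintype.card V ^ 2) / 4)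
    (t : ℕ) (ht : (t - 1) * k ≤ d / 2)
    (hq1 : Real.exp (t - p * r / 2) + Real.exp (-(p * t * (d / 2))) ≤ 1) {c : ℝ}
    (hc1 : c ≤ δ / 4 * Fintype.card V ^ 2) (hc2 : c ≤ δ * #Z * Fintype.card V / 16) :
    Pr p (pairs V) (fun ω => BoundedDegrees D k ω ∧ #(uncovered S ω) ≤ c ∧ ∃ f, IsCocycle ω f ∧
      ∀ h, τ + 2 * ((#S + #Z) * D) < #(defect ω f h univ)) ≤
      Real.exp (p * (#S * Fintype.card V)) *
      (Real.exp (-(τ / 2) + p * (δ * Fintype.card V ^ 2)) +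
      (Fintype.card V * Real.exp (-(p * (δ ^ 2 / 128 * Fintype.card V ^ 2) / 16)) +
        (Real.exp (t - p * r / 2) + Real.exp (-(p * t * (d / 2)))) ^ ((#Z : ℝ) / 2))) := by
  classical
  set β := Real.exp (-(τ / 2) + p * (δ * Fintype.card V ^ 2)) +
      (Fintype.card V * Real.exp (-(p * (δ ^ 2 / 128 * Fintype.card V ^ 2) / 16)) +
        (Real.exp (t - p * r / 2) + Real.exp (-(p * t * (d / 2)))) ^ ((#Z : ℝ) / 2)) with hβ
  have hβ0 : 0 ≤ β := by positivity
  set Y : Finset V := (S ∪ Z)ᶜ with hY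
  set E₁ := (pairs V).filter fun e => ∃ v ∈ S, v ∈ e with hE₁
  set E₂ := (pairs V).filter fun e => ¬ ∃ v ∈ S, v ∈ e with hE₂
  have hE : pairs V = E₁ ∪ E₂ := (filter_union_filter_not_eq _ _).symm
  have hdis : Disjoint E₁ E₂ := disjoint_filter_filter_not _ _ _
  have hmem : ∀ x y, x ∉ S → y ∉ S → x ≠ y → s(x, y) ∈ E₂ := by
    intro x y hx hy hxy
    refine mem_filter.2 ⟨mem_pairs.2 hxy, ?_⟩
    rintro ⟨v, hv, hv'⟩
    rcases Sym2.mem_iff.1 hv' with rfl | rfl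
    exacts [hx hv, hy hv]
  have hYS : ∀ {x}, x ∈ Y → x ∉ S := fun hx h => by simp [hY, h] at hx
  have hYZ : Disjoint Z Y := by
    rw [disjoint_left]
    intro x hx hxY
    simp [hY, hx] at hxY
  have hZYS : Z ∪ Y = Sᶜ := by
    ext x
    have := fun h : x ∈ S => disjoint_left.1 hSZ h
    simp only [hY, mem_union, mem_compl]
    tauto
  -- Whether a pair is covered depends only on edges at S, so it is settled in the first round.
  have hconb : ∀ ω₁ ω₂, ω₂ ⊆ E₂ → ∀ x y, conb (ω₁ ∪ ω₂) x y ∩ S = conb ω₁ x y ∩ S := by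
    intro ω₁ ω₂ h₂ x y
    ext v
    have h : ∀ w, v ∈ S → s(w, v) ∉ ω₂ := fun w hv hw =>
      (mem_filter.1 (h₂ hw)).2 ⟨v, hv, Sym2.mem_mk_right _ _⟩
    have hx := h x
    have hy := h y
    simp only [mem_inter, mem_conb, mem_union]
    tauto
  have hfix : ∀ ω₁ ⊆ E₁, Pr p E₂ (fun ω₂ => BoundedDegrees D k (ω₁ ∪ ω₂) ∧
      #(uncovered S (ω₁ ∪ ω₂)) ≤ c ∧ ∃ f, IsCocycle (ω₁ ∪ ω₂) f ∧
      ∀ h, τ + 2 * ((#S + #Z) * D) < #(defect (ω₁ ∪ ω₂) f h univ)) ≤ 2 ^ #ω₁ * β := by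
    intro ω₁ hω₁
    have hunc : ∀ ω₂ ⊆ E₂, uncovered S (ω₁ ∪ ω₂) = uncovered S ω₁ := fun ω₂ h₂ => by
      simp only [uncovered, hconb ω₁ ω₂ h₂]
    by_cases hc : (#(uncovered S ω₁) : ℝ) ≤ c
    swap
    · refine (Pr_mono hp0 hp1 (Q := fun _ => False) fun ω₂ h₂ h => ?_).trans ?_
      · rw [hunc ω₂ h₂] at h
        exact hc h.2.1
      · rw [Pr_eq_Ex]
        simp only [if_false, Ex_const]
        positivity
    set cov : V → V → Prop := fun x y => (conb ω₁ x y ∩ S).Nonempty with hcov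
    have hU : ((Z ∪ Y) ×ˢ (Z ∪ Y)).filter (fun q => q.1 ≠ q.2 ∧ ¬ cov q.1 q.2) =
        uncovered S ω₁ := by
      rw [hZYS, uncovered]
      simp only [hcov, not_nonempty_iff_eq_empty]
    calc _ ≤ Pr p E₂ (fun ω₂ => ∃ F ∈ ω₁.powerset, BoundedDegrees D k ω₂ ∧ ∃ f, IsCocycle ω₂ f ∧
              (∀ x y, cov x y → s(x, y) ∈ ω₂ → f s(x, y) = readOff S ω₁ F x y) ∧
              ∀ h, τ < #(defect ω₂ f h (Y ×ˢ Y))) := by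
          refine Pr_mono hp0 hp1 ?_
          rintro ω₂ h₂ ⟨hb, -, f, hf, hh⟩
          refine ⟨ω₁.filter fun e => f e ≠ 0, mem_powerset.2 (filter_subset _ _),
            hb.mono subset_union_right, f, hf.mono subset_union_right, ?_, fun h => ?_⟩
          · exact fun x y hxy hω => readOff_eq subset_union_left hf hxy (mem_union_right _ hω)
          · have hsub : defect (ω₁ ∪ ω₂) f h univ ⊆ defect ω₂ f h (Y ×ˢ Y) ∪
                (((S ∪ Z) ×ˢ univ).filter (fun q => s(q.1, q.2) ∈ ω₁ ∪ ω₂) ∪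
                (univ ×ˢ (S ∪ Z)).filter (fun q => s(q.1, q.2) ∈ ω₁ ∪ ω₂)) := by
              rintro ⟨x, y⟩ hq
              obtain ⟨-, h1, h2⟩ := mem_defect.1 hq
              by_cases hx : x ∈ S ∪ Z
              · exact mem_union_right _ (mem_union_left _
                  (mem_filter.2 ⟨mem_product.2 ⟨hx, mem_univ _⟩, h1⟩))
              by_cases hy : y ∈ S ∪ Z
              · exact mem_union_right _ (mem_union_right _
                  (mem_filter.2 ⟨mem_product.2 ⟨mem_univ _, hy⟩, h1⟩))
              refine mem_union_left _ (mem_defect.2 ⟨?_, ?_, h2⟩)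
              · exact mem_product.2 ⟨mem_compl.2 hx, mem_compl.2 hy⟩
              · refine (mem_union.1 h1).resolve_left fun h1 => ?_
                obtain ⟨-, v, hv, hv'⟩ := mem_filter.1 (hω₁ h1)
                rcases Sym2.mem_iff.1 hv' with rfl | rfl
                exacts [hx (mem_union_left _ hv), hy (mem_union_left _ hv)]
            have h1 := (card_le_card hsub).trans ((card_union_le _ _).trans
              (Nat.add_le_add_left (card_union_le _ _) _))
            have h1 : (#(defect (ω₁ ∪ ω₂) f h univ) : ℝ) ≤ #(defect ω₂ f h (Y ×ˢ Y)) +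
                (cnt (ω₁ ∪ ω₂) ((S ∪ Z) ×ˢ univ) + cnt (ω₁ ∪ ω₂) (univ ×ˢ (S ∪ Z))) := by
              exact_mod_cast h1
            rw [cnt_swap _ univ] at h1
            have h2 := sum_row_card_le _ hb (S ∪ Z)
            rw [card_union_of_disjoint hSZ] at h2
            push_cast at h2
            linarith [hh h]
      _ ≤ #ω₁.powerset * β := by
          refine Pr_exists_le_card_mul hp0 hp1 _ _ fun F _ => ?_
          refine Pr_prescribed_cocycle_le hp0 hp1 (filter_subset _ _) hYZ
            (fun x hx y hy => hmem x y (hYS hx) (hYS hy))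
            (fun z hz y hy => hmem z y (disjoint_right.1 hSZ hz) (hYS hy)
              fun h => disjoint_left.1 hYZ hz (h ▸ hy)) cov _ hD0 hk0 hd0 hδ0 hn ?_ ?_ hr t ht hq1
          · exact le_trans (by rw [← hU]; exact le_of_eq (by congr!)) (hc.trans hc1)
          · exact le_trans (by rw [← hU]; exact le_of_eq (by congr!)) (hc.trans hc2)
      _ = _ := by rw [card_powerset]; norm_num
  rw [hE, Pr_union hdis]
  calc _ ≤ Ex p E₁ (fun ω₁ => 2 ^ #ω₁ * β) := Ex_mono hp0 hp1 hfix
    _ = (1 + p * (2 - 1)) ^ #E₁ * β := by rw [Ex_mul_const, Ex_pow_card]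
    _ ≤ Real.exp p ^ #E₁ * β := by
        gcongr
        linarith [Real.add_one_le_exp p]
    _ ≤ _ := by
        rw [← Real.exp_nat_mul, mul_comm _ p]
        refine mul_le_mul_of_nonneg_right (Real.exp_le_exp.2 ?_) hβ0
        refine mul_le_mul_of_nonneg_left ?_ hp0
        have hsub : E₁ ⊆ (S ×ˢ univ).image fun q : V × V => s(q.1, q.2) := by
          intro e he
          obtain ⟨-, v, hv, hve⟩ := mem_filter.1 he
          obtain ⟨y, rfl⟩ := Sym2.mem_iff_exists.1 hve
          exact mem_image.2 ⟨(v, y), by simp [hv], rfl⟩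
        have h := (card_le_card hsub).trans card_image_le
        rw [card_product, card_univ] at h
        exact_mod_cast h

end Exposure


/-! ### Pseudorandom properties: degrees, sparse sets, links -/

section Pseudorandom

variable {V : Type*} [Fintype V] [DecidableEq V] {p : ℝ}

theorem card_nb_eq_cnt (ω : Finset (Sym2 V)) (v : V) : #(nb ω v) = cnt ω ({v} ×ˢ univ) := by
  rw [cnt_product, sum_singleton, inter_univ]

theorem Pr_le_card_nb_le (hp0 : 0 ≤ p) (hp1 : p ≤ 1) (v : V) :
    Pr p (pairs V) (fun ω => 2 * (Fintype.card V * p) ≤ #(nb ω v)) ≤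
      Real.exp (-(Fintype.card V * p / 8)) := by
  simp only [card_nb_eq_cnt]
  refine (Pr_le_cnt_le hp0 hp1 subset_rfl _ (l := 1 / 4) (by norm_num) (by norm_num) _).trans ?_
  rw [card_product, card_singleton, one_mul, card_univ]
  exact Real.exp_le_exp.2 (by linarith)

theorem Pr_card_nb_le_le (hp0 : 0 ≤ p) (hp1 : p ≤ 1) (v : V) :
    Pr p (pairs V) (fun ω => #(nb ω v) ≤ Fintype.card V * p / 2) ≤
      Real.exp (1 - Fintype.card V * p / 32) := by
  have hV : 1 ≤ Fintype.card V := Fintype.card_pos_iff.2 ⟨v⟩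
  refine (Pr_mono hp0 hp1 (Q := fun ω => cnt ω ({v} ×ˢ {v}ᶜ) ≤ Fintype.card V * p / 2)
    fun ω _ h => ?_).trans ?_
  · refine le_trans (Nat.cast_le.2 ?_) h
    rw [card_nb_eq_cnt]
    exact cnt_mono subset_rfl (product_subset_product_right (subset_univ _))
  -- With l = 1/8 the exponent is np / 16 - 3 (n - 1) p / 32; the summand 1 in the bound absorbs the
  -- missing pair vv.
  · refine (Pr_cnt_le_le hp0 hp1 subset_rfl _ (l := 1 / 8) (by norm_num) (by norm_num) ?_ _).trans ?_
    · rintro ⟨a, b⟩ hq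
      obtain ⟨h1, h2⟩ := mem_product.1 hq
      simp only [mem_singleton, mem_compl] at h1 h2
      exact mem_pairs.2 fun h => h2 ((show a = b from h) ▸ h1)
    · rw [card_product, card_singleton, one_mul, card_compl, card_singleton, Nat.cast_sub hV]
      refine Real.exp_le_exp.2 ?_
      push_cast
      nlinarith

theorem sum_nonempty_pow_le {x : ℝ} :
    ∑ A : Finset V with A.Nonempty, x ^ #A ≤ Real.exp (Fintype.card V * |x|) - 1 := by
  have h1 : ∑ A : Finset V, |x| ^ #A = (|x| + 1) ^ Fintype.card V := by
    have := Fintype.sum_pow_mul_eq_add_pow V |x| 1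
    simpa using this
  have h2 : (univ.filter fun A : Finset V => A.Nonempty) = univ.erase ∅ := by
    ext A
    simp [nonempty_iff_ne_empty]
  rw [h2]
  calc _ ≤ ∑ A ∈ univ.erase ∅, |x| ^ #(A : Finset V) :=
        sum_le_sum fun A _ => (le_abs_self _).trans (abs_pow _ _).le
    _ = (|x| + 1) ^ Fintype.card V - 1 := by
        rw [← h1, ← sum_erase_add _ _ (mem_univ (∅ : Finset V)), card_empty, pow_zero]
        ring
    _ ≤ _ := by
        rw [Real.exp_nat_mul]
        gcongr
        exact Real.add_one_le_exp _

/-- The sum of exp(-c |A|) over nonempty A is (1 + exp(-c))ⁿ - 1, so the union bound over all sets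
is harmless once n exp(-c) is small. -/
theorem Pr_exists_nonempty_le (hp0 : 0 ≤ p) (hp1 : p ≤ 1) (P : Finset V → Finset (Sym2 V) → Prop)
    (c : ℝ) (h : ∀ A, A.Nonempty → Pr p (pairs V) (P A) ≤ Real.exp (-(c * #A))) :
    Pr p (pairs V) (fun ω => ∃ A : Finset V, A.Nonempty ∧ P A ω) ≤
      Real.exp (Fintype.card V * Real.exp (-c)) - 1 := by
  calc _ ≤ Pr p (pairs V) (fun ω => ∃ A ∈ univ.filter fun A : Finset V => A.Nonempty, P A ω) :=
        Pr_mono hp0 hp1 fun ω _ ⟨A, hA, h⟩ => ⟨A, by simpa using hA, h⟩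
    _ ≤ ∑ A : Finset V with A.Nonempty, Pr p (pairs V) (P A) := Pr_exists_le hp0 hp1 _ _
    _ ≤ ∑ A : Finset V with A.Nonempty, Real.exp (-c) ^ #A := by
        refine sum_le_sum fun A hA => (h A (by simpa using hA)).trans_eq ?_
        rw [← Real.exp_nat_mul]
        ring_nf
    _ ≤ _ := by
        refine sum_nonempty_pow_le.trans_eq ?_
        rw [abs_of_pos (Real.exp_pos _)]

/-- Sets of size at most a small multiple of the average degree are sparse. -/
theorem Pr_small_dense_le (hp0 : 0 ≤ p) (hp1 : p ≤ 1) {η : ℝ} (hη : 0 < η) :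
    Pr p (pairs V) (fun ω => ∃ A : Finset V, A.Nonempty ∧
      #A ≤ 2 * Real.exp (-(6 / η)) * (Fintype.card V * p) ∧
      η * (Fintype.card V * p ^ 2) * #A ≤ cnt ω (A ×ˢ A)) ≤
      Real.exp (Fintype.card V * Real.exp (-(2 * (Fintype.card V * p ^ 2)))) - 1 := by
  refine Pr_exists_nonempty_le hp0 hp1 _ _ fun A hA => ?_
  by_cases hc : (#A : ℝ) ≤ 2 * Real.exp (-(6 / η)) * (Fintype.card V * p)
  -- With m = np², l = 3 / η turns the linear term into -3 m |A|, and the size restriction on A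
  -- bounds the other by m |A|.
  · refine (Pr_mono hp0 hp1 fun ω _ h => h.2).trans
      ((Pr_le_cnt_self_le hp0 hp1 subset_rfl A (l := 3 / η) (by positivity) _).trans ?_)
    refine Real.exp_le_exp.2 ?_
    have h1 : Real.exp (2 * (3 / η)) * Real.exp (-(6 / η)) = 1 := by
      rw [← Real.exp_add, ← Real.exp_zero]
      congr 1
      ring
    have h2 : 3 / η * (η * (Fintype.card V * p ^ 2) * #A) = 3 * (Fintype.card V * p ^ 2) * #A := by
      field_simp
    have h3 : p * (#A : ℝ) ^ 2 * (Real.exp (2 * (3 / η)) / 2) ≤ Fintype.card V * p ^ 2 * #A := by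
      calc p * (#A : ℝ) ^ 2 * (Real.exp (2 * (3 / η)) / 2)
          = p * #A * (Real.exp (2 * (3 / η)) / 2) * #A := by ring
        _ ≤ p * #A * (Real.exp (2 * (3 / η)) / 2) *
            (2 * Real.exp (-(6 / η)) * (Fintype.card V * p)) := by gcongr
        _ = Fintype.card V * p ^ 2 * #A * (Real.exp (2 * (3 / η)) * Real.exp (-(6 / η))) := by ring
        _ = _ := by rw [h1, mul_one]
    rw [h2]
    linarith
  · refine (Pr_mono hp0 hp1 (Q := fun _ => False) fun ω _ h => hc h.1).trans ?_
    rw [Pr_eq_Ex]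
    simp only [if_false, Ex_const]
    positivity

/-- Sets of less than `n / 64` vertices span few edges. -/
theorem Pr_large_dense_le (hp0 : 0 ≤ p) (hp1 : p ≤ 1) :
    Pr p (pairs V) (fun ω => ∃ A : Finset V, A.Nonempty ∧ #A ≤ (Fintype.card V : ℝ) / 64 ∧
      Fintype.card V * p * #A / 16 ≤ cnt ω (A ×ˢ A)) ≤
      Real.exp (Fintype.card V * Real.exp (-(Fintype.card V * p / 64))) - 1 := by
  refine Pr_exists_nonempty_le hp0 hp1 _ _ fun A hA => ?_
  by_cases hc : (#A : ℝ) ≤ (Fintype.card V : ℝ) / 64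
  · refine (Pr_mono hp0 hp1 fun ω _ h => h.2).trans
      ((Pr_le_cnt_le hp0 hp1 subset_rfl _ (l := 1 / 2) (by norm_num) le_rfl _).trans ?_)
    refine Real.exp_le_exp.2 ?_
    rw [card_product]
    push_cast
    have : p * #A * #A ≤ p * #A * (Fintype.card V / 64) := by gcongr
    linarith
  · refine (Pr_mono hp0 hp1 (Q := fun _ => False) fun ω _ h => hc h.1).trans ?_
    rw [Pr_eq_Ex]
    simp only [if_false, Ex_const]
    positivity

/-- The difference is treated as a single weighted count, with weight -l on A × B and l on A × A. -/
theorem Pr_cut_le (hp0 : 0 ≤ p) (hp1 : p ≤ 1) {E : Finset (Sym2 V)} (hE : E ⊆ pairs V)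
    {A B : Finset V} (hAB : Disjoint A B)
    (hE' : ∀ x ∈ A, ∀ y ∈ A ∪ B, x ≠ y → s(x, y) ∈ E) {l : ℝ} (hl0 : 0 ≤ l) (hl : l ≤ 1 / 2)
    (T : ℝ) :
    Pr p E (fun ω => (cnt ω (A ×ˢ B) : ℝ) - cnt ω (A ×ˢ A) ≤ T) ≤
      Real.exp (l * T - l * (p * #A * (#B - #A)) + 2 * l ^ 2 * (p * #A * (#A + #B))) := by
  set g : V → V → ℝ := fun x y =>
    (if (x, y) ∈ A ×ˢ B then -l else 0) + (if (x, y) ∈ A ×ˢ A then l else 0) with hg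
  have hexcl : ∀ q : V × V, q ∈ A ×ˢ B → q ∉ A ×ˢ A := fun q h h' =>
    disjoint_left.1 hAB (mem_product.1 h').2 (mem_product.1 h).2
  have hgle : ∀ x y, |g x y| ≤ 1 / 2 := fun x y => by
    have := hexcl (x, y)
    simp only [hg]
    split_ifs with h1 h2 h2
    · exact absurd h2 (this h1)
    · rw [add_zero, abs_neg, abs_of_nonneg hl0]; exact hl
    · rw [zero_add, abs_of_nonneg hl0]; exact hl
    · norm_num
  have hsum : ∀ ω : Finset (Sym2 V),
      (∑ q : V × V, if s(q.1, q.2) ∈ ω then g q.1 q.2 else 0) =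
        cnt ω (A ×ˢ B) * (-l) + cnt ω (A ×ˢ A) * l := fun ω => by
    rw [← sum_ite_mem_eq_cnt, ← sum_ite_mem_eq_cnt, ← sum_add_distrib]
    refine sum_congr rfl fun q _ => ?_
    simp only [hg]
    by_cases h : s(q.1, q.2) ∈ ω <;> simp [h]
  refine (Pr_mono hp0 hp1 ?_).trans ((Pr_pairs_le hp0 hp1 hE g hgle (-(l * T))).trans ?_)
  · intro ω _ h
    rw [hsum]
    nlinarith
  · refine Real.exp_le_exp.2 ?_
    have h1 : (∑ q : V × V, if s(q.1, q.2) ∈ E then g q.1 q.2 + 2 * g q.1 q.2 ^ 2 else 0) =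
        cnt E (A ×ˢ B) * (-l) + cnt E (A ×ˢ A) * l +
          (cnt E (A ×ˢ B) * (2 * l ^ 2) + cnt E (A ×ˢ A) * (2 * l ^ 2)) := by
      rw [← hsum, ← sum_ite_mem_eq_cnt, ← sum_ite_mem_eq_cnt, ← sum_add_distrib, ← sum_add_distrib]
      refine sum_congr rfl fun q _ => ?_
      have := hexcl q
      simp only [hg]
      by_cases h : s(q.1, q.2) ∈ E
      · by_cases h1 : q ∈ A ×ˢ B
        · simp [h, h1, this h1]
        · by_cases h2 : q ∈ A ×ˢ A <;> simp [h, h1, h2]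
      · simp [h]
    have h2 : (cnt E (A ×ˢ B) : ℝ) = #A * #B := by
      rw [cnt, filter_true_of_mem, card_product, Nat.cast_mul]
      intro q hq
      obtain ⟨ha, hb⟩ := mem_product.1 hq
      exact hE' _ ha _ (mem_union_right _ hb) fun h => disjoint_left.1 hAB ha (h ▸ hb)
    have h3 : (cnt E (A ×ˢ A) : ℝ) ≤ #A * #A := by
      have := cnt_le_card E (A ×ˢ A)
      rw [card_product] at this
      exact_mod_cast this
    rw [h1, h2]
    have h4 : p * (cnt E (A ×ˢ A) * (l + 2 * l ^ 2)) ≤ p * (#A * #A * (l + 2 * l ^ 2)) := by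
      gcongr
    nlinarith

/-- Every large subset of the neighbourhood of `v` sends about the expected number of edges to the
rest of the neighbourhood. -/
theorem Pr_link_le (hp0 : 0 ≤ p) (hp1 : p ≤ 1) (v : V) {ε a₀ : ℝ} (hε0 : 0 < ε) (hε : ε ≤ 4) :
    Pr p (pairs V) (fun ω => ∃ A ⊆ nb ω v, #(nb ω v) ≤ 2 * (Fintype.card V * p) ∧ a₀ ≤ #A ∧
      (cnt ω (A ×ˢ (nb ω v \ A)) : ℝ) - cnt ω (A ×ˢ A) ≤
        p * #A * (#(nb ω v \ A) - #A) - ε * (Fintype.card V * p ^ 2) * #A) ≤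
      Real.exp (p * Fintype.card V - ε ^ 2 / 16 * (Fintype.card V * p ^ 2) * a₀) := by
  classical
  set n : ℝ := ((Fintype.card V : ℕ) : ℝ) with hn
  -- The edges at v are exposed first and fix its neighbourhood; the counts then depend on the
  -- remaining edges. The choice of A among subsets of the neighbourhood costs at most exp(p n) on
  -- average.
  set E₁ := (pairs V).filter fun e => v ∈ e with hE₁
  set E₂ := (pairs V).filter fun e => ¬ v ∈ e with hE₂
  have hE : pairs V = E₁ ∪ E₂ := (filter_union_filter_not_eq _ _).symm
  have hdis : Disjoint E₁ E₂ := disjoint_filter_filter_not _ _ _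
  set β := Real.exp (-(ε ^ 2 / 16 * (n * p ^ 2) * a₀)) with hβ
  have hfix : ∀ ω₁ ⊆ E₁, Pr p E₂ (fun ω₂ => ∃ A ⊆ nb (ω₁ ∪ ω₂) v, #(nb (ω₁ ∪ ω₂) v) ≤ 2 * (n * p) ∧
      a₀ ≤ #A ∧ (cnt (ω₁ ∪ ω₂) (A ×ˢ (nb (ω₁ ∪ ω₂) v \ A)) : ℝ) - cnt (ω₁ ∪ ω₂) (A ×ˢ A) ≤
        p * #A * (#(nb (ω₁ ∪ ω₂) v \ A) - #A) - ε * (n * p ^ 2) * #A) ≤ 2 ^ #ω₁ * β := by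
    intro ω₁ hω₁
    have hnb : ∀ ω₂ ⊆ E₂, nb (ω₁ ∪ ω₂) v = nb ω₁ v := fun ω₂ h₂ => by
      ext x
      have : s(v, x) ∉ ω₂ := fun h => (mem_filter.1 (h₂ h)).2 (Sym2.mem_mk_left _ _)
      simp [this]
    have hv : v ∉ nb ω₁ v := fun h =>
      ne_of_mem (hω₁.trans (filter_subset _ _)) (mem_nb.1 h) rfl
    have hcnt : ∀ ω₂, ∀ A B, A ⊆ nb ω₁ v → B ⊆ nb ω₁ v →
        cnt (ω₁ ∪ ω₂) (A ×ˢ B) = cnt ω₂ (A ×ˢ B) := fun ω₂ A B hA hB => by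
      unfold cnt
      congr 1
      refine filter_congr fun q hq => ?_
      rw [mem_union, or_iff_right]
      intro h
      obtain ⟨h1, h2⟩ := mem_product.1 hq
      rcases Sym2.mem_iff.1 (mem_filter.1 (hω₁ h)).2 with h' | h'
      · exact hv (h' ▸ hA h1)
      · exact hv (h' ▸ hB h2)
    by_cases hD : (#(nb ω₁ v) : ℝ) ≤ 2 * (n * p)
    swap
    · refine (Pr_mono hp0 hp1 (Q := fun _ => False) ?_).trans ?_
      · rintro ω₂ h₂ ⟨A, -, h, -⟩
        rw [hnb ω₂ h₂] at h
        exact hD h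
      · rw [Pr_eq_Ex]
        simp only [if_false, Ex_const]
        positivity
    calc _ ≤ Pr p E₂ (fun ω₂ => ∃ A ∈ (nb ω₁ v).powerset, a₀ ≤ #A ∧
              (cnt ω₂ (A ×ˢ (nb ω₁ v \ A)) : ℝ) - cnt ω₂ (A ×ˢ A) ≤
              p * #A * (#(nb ω₁ v \ A) - #A) - ε * (n * p ^ 2) * #A) := by
          refine Pr_mono hp0 hp1 ?_
          rintro ω₂ h₂ ⟨A, hA, -, h1, h2⟩
          rw [hnb ω₂ h₂] at hA h2
          rw [hcnt ω₂ A _ hA sdiff_subset, hcnt ω₂ A A hA hA] at h2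
          exact ⟨A, mem_powerset.2 hA, h1, h2⟩
      _ ≤ #(nb ω₁ v).powerset * β := by
          refine Pr_exists_le_card_mul hp0 hp1 _ _ fun A hA => ?_
          have hA := mem_powerset.1 hA
          by_cases ha : a₀ ≤ #A
          swap
          · refine (Pr_mono hp0 hp1 (Q := fun _ => False) fun ω _ h => ha h.1).trans ?_
            rw [Pr_eq_Ex]
            simp only [if_false, Ex_const]
            positivity
          -- With l = ε / 8 the linear gain ε² / 8 · np² |A| is twice the bound on the quadratic
          -- loss, because the degree of v is at most 2np.
          refine (Pr_mono hp0 hp1 fun ω _ h => h.2).trans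
            ((Pr_cut_le hp0 hp1 (filter_subset _ _) disjoint_sdiff (l := ε / 8) ?_ (by positivity)
              (by linarith) _).trans (Real.exp_le_exp.2 ?_))
          · intro x hx y hy hxy
            rw [union_sdiff_of_subset hA] at hy
            refine mem_filter.2 ⟨mem_pairs.2 hxy, fun h => ?_⟩
            rcases Sym2.mem_iff.1 h with rfl | rfl
            exacts [hv (hA hx), hv hy]
          · have hcard : (#A : ℝ) + #(nb ω₁ v \ A) ≤ 2 * (n * p) := by
              refine le_trans (le_of_eq ?_) hD
              rw [add_comm]
              exact_mod_cast card_sdiff_add_card_eq_card hA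
            have h1 : p * #A * (#A + #(nb ω₁ v \ A)) ≤ p * #A * (2 * (n * p)) :=
              mul_le_mul_of_nonneg_left hcard (mul_nonneg hp0 (Nat.cast_nonneg _))
            have h2 : ε ^ 2 / 16 * (n * p ^ 2) * a₀ ≤ ε ^ 2 / 16 * (n * p ^ 2) * #A := by gcongr
            nlinarith [sq_nonneg ε]
      _ ≤ _ := by
          rw [card_powerset]
          push_cast
          gcongr
          · norm_num
          · rw [← card_image_of_injective _ (mk_right_injective v)]
            refine card_le_card fun e he => ?_
            obtain ⟨x, hx, rfl⟩ := mem_image.1 he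
            exact mem_nb.1 hx
  rw [hE, Pr_union hdis]
  calc _ ≤ Ex p E₁ (fun ω₁ => 2 ^ #ω₁ * β) := Ex_mono hp0 hp1 hfix
    _ = (1 + p * (2 - 1)) ^ #E₁ * β := by rw [Ex_mul_const, Ex_pow_card]
    _ ≤ Real.exp p ^ #E₁ * β := by
        gcongr
        linarith [Real.add_one_le_exp p]
    _ ≤ _ := by
        rw [← Real.exp_nat_mul, hβ, ← Real.exp_add]
        refine Real.exp_le_exp.2 ?_
        have hsub : E₁ ⊆ univ.image fun x : V => s(v, x) := by
          intro e he
          obtain ⟨y, rfl⟩ := Sym2.mem_iff_exists.1 (mem_filter.1 he).2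
          exact mem_image.2 ⟨y, mem_univ _, rfl⟩
        have h := (card_le_card hsub).trans card_image_le
        rw [card_univ] at h
        have h : (#E₁ : ℝ) ≤ n := by rw [hn]; exact_mod_cast h
        nlinarith

end Pseudorandom


/-! ### From close to a coboundary to equal to one -/

section Endgame

variable {V : Type*} [Fintype V] [DecidableEq V]

/-- The neighbours `x` of `v` such that `f` differs from the coboundary of `h` at `vx`. -/
def oddNb (ω : Finset (Sym2 V)) (f : Sym2 V → ZMod 2) (h : V → ZMod 2) (v : V) : Finset V :=
  (nb ω v).filter fun x => f s(v, x) ≠ h v + h x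

variable {ω : Finset (Sym2 V)} {f : Sym2 V → ZMod 2} {h : V → ZMod 2}

@[simp] theorem mem_oddNb {v x : V} :
    x ∈ oddNb ω f h v ↔ s(v, x) ∈ ω ∧ f s(v, x) ≠ h v + h x := by simp [oddNb]

theorem mem_oddNb_comm {v x : V} : x ∈ oddNb ω f h v ↔ v ∈ oddNb ω f h x := by
  rw [mem_oddNb, mem_oddNb, Sym2.eq_swap, add_comm]

theorem oddNb_subset (v : V) : oddNb ω f h v ⊆ nb ω v := filter_subset _ _

theorem card_eq_sum_card_fiber (Q : Finset (V × V)) :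
    #Q = ∑ v, #(univ.filter fun x => (v, x) ∈ Q) := by
  rw [card_eq_sum_card_fiberwise (f := Prod.fst) (t := univ) (fun q _ => mem_coe.2 (mem_univ _))]
  refine sum_congr rfl fun x _ => ?_
  rw [← card_image_of_injective (univ.filter fun y => (x, y) ∈ Q) (Prod.mk_right_injective x)]
  congr 1
  ext ⟨b, c⟩
  simp only [mem_filter, mem_image, mem_univ, true_and, Prod.mk.injEq]
  constructor
  · rintro ⟨h, rfl⟩
    exact ⟨c, h, rfl, rfl⟩
  · rintro ⟨y, h, rfl, rfl⟩
    exact ⟨h, rfl⟩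

theorem card_defect : #(defect ω f h univ) = ∑ v, #(oddNb ω f h v) := by
  rw [card_eq_sum_card_fiber]
  refine sum_congr rfl fun v _ => ?_
  congr 1
  ext x
  simp

theorem cnt_eq_sum (A B : Finset V) :
    cnt ω (A ×ˢ B) = ∑ x, ∑ y, if x ∈ A ∧ y ∈ B ∧ s(x, y) ∈ ω then 1 else 0 := by
  rw [cnt, card_eq_sum_card_fiber]
  refine sum_congr rfl fun x _ => ?_
  rw [← card_filter]
  congr 1
  ext y
  simp [and_assoc]

/-- Defects form a cocycle: in a triangle with vx a defect and vy not, xy is a defect. Interchanging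
v and x therefore matches the triples counted on the two sides. -/
theorem sum_cnt_oddNb (hf : IsCocycle ω f) :
    ∑ v, cnt ω (oddNb ω f h v ×ˢ (nb ω v \ oddNb ω f h v)) =
      ∑ v, cnt ω (oddNb ω f h v ×ˢ oddNb ω f h v) := by
  simp only [cnt_eq_sum]
  rw [sum_comm]
  refine sum_congr rfl fun x _ => sum_congr rfl fun v _ => sum_congr rfl fun y _ => ?_
  congr 1
  simp only [Finset.mem_sdiff, mem_nb, mem_oddNb, eq_iff_iff]
  rw [Sym2.eq_swap (a := v) (b := x)]
  by_cases hxv : s(x, v) ∈ ω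
  swap
  · simp [hxv]
  by_cases hxy : s(x, y) ∈ ω
  swap
  · simp [hxy]
  by_cases hvy : s(v, y) ∈ ω
  swap
  · simp [hvy]
  have hcoc := hf.eq_add hxy (Sym2.eq_swap ▸ hxv) hvy
  rw [Sym2.eq_swap (a := v) (b := x)] at hcoc
  simp only [hxv, hxy, hvy, true_and, and_true, not_not, hcoc]
  generalize f s(x, v) = a
  generalize f s(v, y) = b
  generalize h x = c
  generalize h v = d
  generalize h y = e
  revert a b c d e
  decide

/-- Isolates the defects at v, the only ones affected by a change of h at v. -/
theorem card_defect_split (hω : ω ⊆ pairs V) (v : V) :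
    #(defect ω f h univ) =
      #((defect ω f h univ).filter fun q => q.1 ≠ v ∧ q.2 ≠ v) + 2 * #(oddNb ω f h v) := by
  rw [← card_filter_add_card_filter_not (s := defect ω f h univ) fun q => q.1 ≠ v ∧ q.2 ≠ v]
  congr 1
  have hd : Disjoint ((oddNb ω f h v).image fun x => (v, x))
      ((oddNb ω f h v).image fun x => (x, v)) := by
    rw [disjoint_left]
    intro q hq hq'
    obtain ⟨x, hx, rfl⟩ := mem_image.1 hq
    obtain ⟨y, hy, hxy⟩ := mem_image.1 hq'
    rw [Prod.mk.injEq] at hxy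
    rw [mem_oddNb] at hy
    exact ne_of_mem hω hy.1 hxy.1.symm
  have : (defect ω f h univ).filter (fun q => ¬ (q.1 ≠ v ∧ q.2 ≠ v)) =
      ((oddNb ω f h v).image fun x => (v, x)) ∪ ((oddNb ω f h v).image fun x => (x, v)) := by
    ext ⟨a, b⟩
    simp only [mem_filter, mem_defect, mem_univ, true_and, mem_union, mem_image, Prod.mk.injEq]
    constructor
    · rintro ⟨h1, h2⟩
      by_cases ha : a = v
      · subst ha
        exact Or.inl ⟨b, mem_oddNb.2 h1, rfl, rfl⟩
      · have hb : b = v := by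
          by_contra hb
          exact h2 ⟨ha, hb⟩
        subst hb
        exact Or.inr ⟨a, mem_oddNb_comm.1 (mem_oddNb.2 h1), rfl, rfl⟩
    · rintro (⟨x, hx, rfl, rfl⟩ | ⟨x, hx, rfl, rfl⟩)
      · exact ⟨mem_oddNb.1 hx, fun h => h.1 rfl⟩
      · exact ⟨mem_oddNb.1 (mem_oddNb_comm.1 hx), fun h => h.2 rfl⟩
  rw [this, card_union_of_disjoint hd, card_image_of_injective _ (Prod.mk_right_injective v),
    card_image_of_injective _ (Prod.mk_left_injective v), two_mul]

/-- Flipping h at v exchanges defects and non-defects among the edges at v and changes nothing else.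
-/
theorem two_mul_card_oddNb_le (hω : ω ⊆ pairs V)
    (hmin : ∀ h', #(defect ω f h univ) ≤ #(defect ω f h' univ)) (v : V) :
    2 * #(oddNb ω f h v) ≤ #(nb ω v) := by
  have h1 := hmin (Function.update h v (h v + 1))
  rw [card_defect_split hω v, card_defect_split hω v] at h1
  have h2 : ((defect ω f (Function.update h v (h v + 1)) univ).filter
      fun q => q.1 ≠ v ∧ q.2 ≠ v) = (defect ω f h univ).filter fun q => q.1 ≠ v ∧ q.2 ≠ v := by
    ext ⟨a, b⟩
    simp only [mem_filter, mem_defect, mem_univ, true_and]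
    refine and_congr_left fun hab => ?_
    rw [Function.update_of_ne hab.1, Function.update_of_ne hab.2]
  have h3 : oddNb ω f (Function.update h v (h v + 1)) v = nb ω v \ oddNb ω f h v := by
    ext x
    simp only [mem_oddNb, Finset.mem_sdiff, mem_nb, not_and, not_not]
    refine and_congr_right fun hx => ?_
    rw [Function.update_self, Function.update_of_ne (ne_of_mem hω hx).symm]
    simp only [hx, true_implies]
    generalize f s(v, x) = a
    generalize h v = b
    generalize h x = c
    revert a b c
    decide
  rw [h2, h3, card_sdiff_of_subset (oddNb_subset v)] at h1
  omega

/-- In a sufficiently pseudorandom graph, every cocycle that is close to a coboundary is a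
coboundary. -/
theorem exists_eq_coboundary (hω : ω ⊆ pairs V) (hf : IsCocycle ω f) {n p c ε κ : ℝ}
    (hp : 0 < p) (hn : 0 < n) (hc : 0 < c) (hε : 0 < ε) (hε1 : 4 * ε ≤ c) (hε2 : 16 * ε ≤ 1)
    (hcodeg : ∀ x y, s(x, y) ∈ ω → c * (n * p ^ 2) ≤ #(conb ω x y))
    (hsmall : ∀ A : Finset V, A.Nonempty → #A ≤ κ * (n * p) →
      cnt ω (A ×ˢ A) ≤ c / 4 * (n * p ^ 2) * #A)
    (hlarge : ∀ v, ∀ A ⊆ nb ω v, κ * (n * p) ≤ #A →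
      p * #A * (#(nb ω v \ A) - #A) - ε * (n * p ^ 2) * #A ≤
        (cnt ω (A ×ˢ (nb ω v \ A)) : ℝ) - cnt ω (A ×ˢ A))
    (hdeg : ∀ v, n * p / 2 ≤ #(nb ω v))
    (hW : ∀ A : Finset V, A.Nonempty → #A ≤ n / 64 → cnt ω (A ×ˢ A) < n * p * #A / 16)
    (hclose : ∃ h, #(defect ω f h univ) ≤ n ^ 2 * p / 512) :
    ∃ h : V → ZMod 2, ∀ x y, s(x, y) ∈ ω → f s(x, y) = h x + h y := by
  obtain ⟨h, hmin⟩ := Finite.exists_min fun h : V → ZMod 2 => #(defect ω f h univ)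
  obtain ⟨h₀, hh₀⟩ := hclose
  have hdef : (#(defect ω f h univ) : ℝ) ≤ n ^ 2 * p / 512 :=
    le_trans (by exact_mod_cast hmin h₀) hh₀
  set A := oddNb ω f h with hA
  set a : V → ℝ := fun v => #(A v) with ha
  set X : V → ℝ := fun v => (cnt ω (A v ×ˢ (nb ω v \ A v)) : ℝ) - cnt ω (A v ×ˢ A v) with hX
  have ha0 : ∀ v, 0 ≤ a v := fun v => Nat.cast_nonneg _
  have hsuma : ∑ v, a v ≤ n ^ 2 * p / 512 := by
    rw [card_defect] at hdef
    push_cast at hdef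
    exact hdef
  have hXsum : ∑ v, X v = 0 := by
    rw [hX, sum_sub_distrib, sub_eq_zero]
    exact_mod_cast sum_cnt_oddNb hf
  have hb : ∀ v, (#(nb ω v \ A v) : ℝ) = #(nb ω v) - a v := fun v => by
    rw [card_sdiff_of_subset (oddNb_subset v), Nat.cast_sub (card_le_card (oddNb_subset v))]
  have hhalf : ∀ v, 2 * a v ≤ #(nb ω v) := fun v => by
    have := Nat.cast_le (α := ℝ).2 (two_mul_card_oddNb_le hω hmin v)
    rwa [Nat.cast_mul] at this
  have hX0 : ∀ v, a v = 0 → X v = 0 := fun v hv => by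
    have : A v = ∅ := by
      rw [← card_eq_zero]
      exact Nat.cast_eq_zero.1 hv
    simp [hX, this, cnt]
  -- The two counts add up to the sum of the codegrees of v with x ∈ A v, at least c np² |A v|.
  -- Subtracting twice the inner count, at most c / 4 · np² |A v|, leaves the factor c / 2.
  have hXsmall : ∀ v, a v < κ * (n * p) → c / 2 * (n * p ^ 2) * a v ≤ X v := by
    intro v hv
    rcases (A v).eq_empty_or_nonempty with h0 | h0
    · have : a v = 0 := by simp [ha, h0]
      rw [hX0 v this, this, mul_zero]
    have h1 := hsmall (A v) h0 hv.le
    have h2 : (cnt ω (A v ×ˢ (nb ω v \ A v)) : ℝ) + cnt ω (A v ×ˢ A v) =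
        ∑ x ∈ A v, (#(conb ω x v) : ℝ) := by
      rw [cnt_product, cnt_product]
      push_cast
      rw [← sum_add_distrib]
      refine sum_congr rfl fun x _ => ?_
      rw [conb]
      norm_cast
      rw [← card_union_of_disjoint, ← inter_union_distrib_left,
        sdiff_union_of_subset (oddNb_subset v)]
      exact disjoint_sdiff_self_left.mono inter_subset_right inter_subset_right
    have h3 : ∑ x ∈ A v, c * (n * p ^ 2) ≤ ∑ x ∈ A v, (#(conb ω x v) : ℝ) :=
      sum_le_sum fun x hx => hcodeg x v (mem_oddNb.1 (mem_oddNb_comm.1 hx)).1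
    rw [sum_const, nsmul_eq_mul] at h3
    simp only [hX, ha] at *
    linarith
  have hXlarge : ∀ v, κ * (n * p) ≤ a v →
      p * a v * (#(nb ω v) - 2 * a v) - ε * (n * p ^ 2) * a v ≤ X v := by
    intro v hv
    have := hlarge v (A v) (oddNb_subset v) hv
    rw [hb v] at this
    refine le_trans (le_of_eq ?_) this
    ring
  -- On W the main term p |A| (deg - 2 |A|) may vanish and only the error bound survives; off W it
  -- is at least np² |A| / 4.
  set W := univ.filter fun v => #(nb ω v) < 4 * a v with hWdef
  have hm : 0 < n * p ^ 2 := by positivity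
  have hXW : ∀ v ∈ W, -(ε * (n * p ^ 2)) * a v ≤ X v := by
    intro v _
    rcases lt_or_ge (a v) (κ * (n * p)) with hv | hv
    · refine le_trans ?_ (hXsmall v hv)
      have : 0 ≤ (n * p ^ 2) * a v := mul_nonneg hm.le (ha0 v)
      nlinarith
    · refine le_trans ?_ (hXlarge v hv)
      have : 0 ≤ p * a v * (#(nb ω v) - 2 * a v) :=
        mul_nonneg (mul_nonneg hp.le (ha0 v)) (by linarith [hhalf v])
      linarith
  have hXW' : ∀ v ∈ Wᶜ, 2 * (ε * (n * p ^ 2)) * a v ≤ X v := by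
    intro v hv
    have hv' : 4 * a v ≤ #(nb ω v) := by simpa [hWdef] using hv
    have hma : 0 ≤ (n * p ^ 2) * a v := mul_nonneg hm.le (ha0 v)
    rcases lt_or_ge (a v) (κ * (n * p)) with hv | hv
    · refine le_trans ?_ (hXsmall v hv)
      nlinarith
    · refine le_trans ?_ (hXlarge v hv)
      have h1 : n * p / 4 ≤ #(nb ω v) - 2 * a v := by linarith [hdeg v]
      have h2 : p * a v * (n * p / 4) ≤ p * a v * (#(nb ω v) - 2 * a v) :=
        mul_le_mul_of_nonneg_left h1 (mul_nonneg hp.le (ha0 v))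
      nlinarith
  have hWc : 2 * ∑ v ∈ Wᶜ, a v ≤ ∑ v ∈ W, a v := by
    have h1 := sum_le_sum hXW
    have h2 := sum_le_sum hXW'
    rw [← mul_sum] at h1 h2
    have h3 := sum_add_sum_compl W X
    rw [hXsum] at h3
    have h4 : (ε * (n * p ^ 2)) * (2 * ∑ v ∈ Wᶜ, a v) ≤ (ε * (n * p ^ 2)) * ∑ v ∈ W, a v := by
      linarith
    exact le_of_mul_le_mul_left h4 (by positivity)
  -- The defect degrees on W total at least |W| np / 8, and the vertices outside W carry at most
  -- half as much. So W × W contains at least |W| np / 16 adjacent pairs, which contradicts sparsity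
  -- because closeness yields |W| ≤ n / 64.
  have hWempty : W = ∅ := by
    by_contra hne
    have hne := nonempty_iff_ne_empty.2 hne
    have hlow : #W * (n * p / 8) ≤ ∑ v ∈ W, a v := by
      rw [← nsmul_eq_mul, ← sum_const]
      refine sum_le_sum fun v hv => ?_
      have := (mem_filter.1 hv).2
      linarith [hdeg v]
    have hle : ∑ v ∈ W, a v ≤ ∑ v, a v :=
      sum_le_sum_of_subset_of_nonneg (subset_univ _) fun v _ _ => ha0 v
    have hcard : (#W : ℝ) ≤ n / 64 := by
      have h1 : #W * (n * p / 8) ≤ n / 64 * (n * p / 8) := by nlinarith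
      exact le_of_mul_le_mul_right h1 (by positivity)
    have hW1 := hW W hne hcard
    have hinside : ∑ v ∈ W, a v ≤ cnt ω (W ×ˢ W) + ∑ v ∈ Wᶜ, a v := by
      have h1 : ∀ v, a v = #(A v ∩ W) + #(A v ∩ Wᶜ) := fun v => by
        rw [ha]
        norm_cast
        rw [← card_union_of_disjoint, ← inter_union_distrib_left, union_compl, inter_univ]
        exact disjoint_compl_right.mono inter_subset_right inter_subset_right
      rw [sum_congr rfl fun v _ => h1 v, sum_add_distrib]
      refine add_le_add ?_ ?_
      · rw [cnt_product]
        push_cast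
        exact sum_le_sum fun v _ => Nat.cast_le.2
          (card_le_card (inter_subset_inter_right (oddNb_subset v)))
      · have h2 : ∑ v ∈ W, #(A v ∩ Wᶜ) = ∑ x ∈ Wᶜ, #(A x ∩ W) := by
          have h3 : ∀ (S : Finset V) v, #(A v ∩ S) = ∑ x ∈ S, if x ∈ A v then 1 else 0 :=
            fun S v => by
              rw [← card_filter]
              congr 1
              ext x
              simp [and_comm]
          simp only [h3]
          rw [sum_comm]
          refine sum_congr rfl fun x _ => sum_congr rfl fun v _ => ?_
          simp only [hA, mem_oddNb_comm (v := v) (x := x)]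
        have h4 : (∑ v ∈ W, (#(A v ∩ Wᶜ) : ℝ)) = ∑ x ∈ Wᶜ, (#(A x ∩ W) : ℝ) := by
          exact_mod_cast h2
        rw [h4]
        exact sum_le_sum fun v _ => Nat.cast_le.2 (card_le_card inter_subset_left)
    linarith
  have hsum0 : ∑ v, a v = 0 := by
    rw [hWempty, sum_empty, compl_empty] at hWc
    exact le_antisymm (by linarith) (sum_nonneg fun v _ => ha0 v)
  refine ⟨h, fun x y hxy => ?_⟩
  by_contra hne
  have h1 := (sum_eq_zero_iff_of_nonneg fun v _ => ha0 v).1 hsum0 x (mem_univ x)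
  have h2 : A x = ∅ := by
    rw [← card_eq_zero]
    exact Nat.cast_eq_zero.1 h1
  have h3 : y ∈ A x := mem_oddNb.2 ⟨hxy, hne⟩
  rw [h2] at h3
  exact notMem_empty _ h3

end Endgame


/-! ### Failure probabilities tend to zero -/

section Asymptotics

/-- The edge probability `p` is, up to a constant factor greater than one, above the threshold
`√(3 log n / (2 n))`. -/
structure AboveThreshold (p : ℕ → ℝ) (K : ℝ) : Prop where
  nonneg : ∀ n, 0 ≤ p n
  le_one : ∀ n, p n ≤ 1
  lt : 3 / 2 < K
  log_le : ∀ᶠ n : ℕ in atTop, K * Real.log n ≤ n * p n ^ 2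

variable {p : ℕ → ℝ} {K : ℝ}

theorem AboveThreshold.tendsto (h : AboveThreshold p K) :
    Tendsto (fun n : ℕ => n * p n ^ 2) atTop atTop := by
  refine tendsto_atTop_mono' _ h.log_le ?_
  exact (Real.tendsto_log_atTop.comp tendsto_natCast_atTop_atTop).const_mul_atTop
    (by linarith [h.lt])

theorem AboveThreshold.exp_neg_le (h : AboveThreshold p K) :
    ∀ᶠ n : ℕ in atTop, Real.exp (-(2 * (n * p n ^ 2))) ≤ ((n : ℝ) ^ 3)⁻¹ := by
  filter_upwards [h.log_le, eventually_ge_atTop 1] with n hn h1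
  have hn0 : (0 : ℝ) < n := by exact_mod_cast h1
  have hlog : 0 ≤ Real.log n := Real.log_nonneg (by exact_mod_cast h1)
  have : Real.exp (-(3 * Real.log n)) = ((n : ℝ) ^ 3)⁻¹ := by
    rw [Real.exp_neg, ← Real.exp_log (pow_pos hn0 3), Real.log_pow]
    norm_num
  rw [← this]
  refine Real.exp_le_exp.2 ?_
  nlinarith [h.lt]

/-- A crude bound from np² ≥ 1. It suffices for exponentials in -np to beat a factor n. -/
theorem AboveThreshold.sqrt_le (h : AboveThreshold p K) :
    ∀ᶠ n : ℕ in atTop, √(n : ℝ) ≤ n * p n := by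
  filter_upwards [h.tendsto.eventually_ge_atTop 1] with n hn
  refine Real.sqrt_le_iff.2 ⟨mul_nonneg (Nat.cast_nonneg _) (h.nonneg n), ?_⟩
  have : (n : ℝ) * 1 ≤ n * (n * p n ^ 2) := mul_le_mul_of_nonneg_left hn (Nat.cast_nonneg _)
  linarith

theorem AboveThreshold.tendsto_mul (h : AboveThreshold p K) :
    Tendsto (fun n : ℕ => n * p n) atTop atTop :=
  tendsto_atTop_mono' _ h.sqrt_le (Real.tendsto_sqrt_atTop.comp tendsto_natCast_atTop_atTop)

theorem tendsto_mul_exp_neg_sqrt {a : ℝ} (ha : 0 < a) :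
    Tendsto (fun n : ℕ => (n : ℝ) * Real.exp (-(a * √(n : ℝ)))) atTop (𝓝 0) := by
  have h := (tendsto_rpow_mul_exp_neg_mul_atTop_nhds_zero 2 a ha).comp
    (Real.tendsto_sqrt_atTop.comp tendsto_natCast_atTop_atTop)
  refine h.congr fun n => ?_
  simp only [Function.comp_apply, Real.rpow_two, Real.sq_sqrt (Nat.cast_nonneg n), neg_mul]

theorem AboveThreshold.tendsto_mul_exp (h : AboveThreshold p K) {a : ℝ} (ha : 0 < a) :
    Tendsto (fun n : ℕ => (n : ℝ) * Real.exp (-(n * p n * a))) atTop (𝓝 0) := by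
  refine squeeze_zero' (Eventually.of_forall fun n => by positivity) ?_
    (tendsto_mul_exp_neg_sqrt ha)
  filter_upwards [h.sqrt_le] with n hn
  refine mul_le_mul_of_nonneg_left (Real.exp_le_exp.2 ?_) (Nat.cast_nonneg _)
  nlinarith

theorem tendsto_exp_sub_one {u : ℕ → ℝ} (hu : Tendsto u atTop (𝓝 0)) :
    Tendsto (fun n => Real.exp (u n) - 1) atTop (𝓝 0) := by
  have := ((Real.continuous_exp.tendsto 0).comp hu).sub_const 1
  simpa using this

theorem Pr_forall_vertex_le {V : Type*} [Fintype V] [DecidableEq V] {q : ℝ} (h0 : 0 ≤ q)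
    (h1 : q ≤ 1) (P : V → Finset (Sym2 V) → Prop) {c : ℝ} (h : ∀ v, Pr q (pairs V) (P v) ≤ c) :
    Pr q (pairs V) (fun ω => ∃ v, P v ω) ≤ Fintype.card V * c := by
  refine le_trans (Pr_mono h0 h1 ?_) (Pr_exists_le_card_mul h0 h1 univ P fun v _ => h v)
  rintro ω - ⟨v, hv⟩
  exact ⟨v, mem_univ _, hv⟩

theorem tendsto_degree_upper (h : AboveThreshold p K) :
    Tendsto (fun n : ℕ => Pr (p n) (pairs (Fin n)) (fun ω => ∃ v, 2 * (n * p n) ≤ #(nb ω v)))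
      atTop (𝓝 0) := by
  refine squeeze_zero (fun n => Pr_nonneg (h.nonneg n) (h.le_one n)) (fun n => ?_)
    (h.tendsto_mul_exp (a := 1 / 8) (by norm_num))
  refine (Pr_forall_vertex_le (h.nonneg n) (h.le_one n) _ fun v => ?_).trans_eq
    (by rw [Fintype.card_fin])
  have := Pr_le_card_nb_le (h.nonneg n) (h.le_one n) v
  rw [Fintype.card_fin] at this
  refine this.trans_eq (by ring_nf)

theorem tendsto_degree_lower (h : AboveThreshold p K) :
    Tendsto (fun n : ℕ => Pr (p n) (pairs (Fin n)) (fun ω => ∃ v, #(nb ω v) ≤ n * p n / 2))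
      atTop (𝓝 0) := by
  have h2 := (h.tendsto_mul_exp (a := 1 / 32) (by norm_num)).mul_const (Real.exp 1)
  rw [zero_mul] at h2
  refine squeeze_zero (fun n => Pr_nonneg (h.nonneg n) (h.le_one n)) (fun n => ?_) h2
  refine (Pr_forall_vertex_le (h.nonneg n) (h.le_one n) _ fun v => ?_).trans_eq
    (by rw [Fintype.card_fin, mul_assoc])
  have := Pr_card_nb_le_le (h.nonneg n) (h.le_one n) v
  rw [Fintype.card_fin] at this
  refine this.trans_eq ?_
  rw [← Real.exp_add]
  ring_nf

theorem tendsto_codegree_upper (h : AboveThreshold p K) :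
    Tendsto (fun n : ℕ => Pr (p n) (pairs (Fin n))
      (fun ω => ∃ x y, x ≠ y ∧ 4 * (n * p n ^ 2) ≤ #(conb ω x y))) atTop (𝓝 0) := by
  refine squeeze_zero' (Eventually.of_forall fun n => Pr_nonneg (h.nonneg n) (h.le_one n)) ?_
    tendsto_inv_atTop_nhds_zero_nat
  filter_upwards [h.exp_neg_le, eventually_ge_atTop 1] with n hn h1
  have hn0 : (0 : ℝ) < n := by exact_mod_cast h1
  calc _ ≤ Pr (p n) (pairs (Fin n)) (fun ω => ∃ q ∈ (univ : Finset (Fin n × Fin n)).filter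
            fun q => q.1 ≠ q.2, 4 * (n * p n ^ 2) ≤ #(conb ω q.1 q.2)) := by
        refine Pr_mono (h.nonneg n) (h.le_one n) ?_
        rintro ω - ⟨x, y, hxy, hc⟩
        exact ⟨(x, y), by simpa using hxy, hc⟩
    _ ≤ #((univ : Finset (Fin n × Fin n)).filter fun q => q.1 ≠ q.2) * ((n : ℝ) ^ 3)⁻¹ := by
        refine Pr_exists_le_card_mul (h.nonneg n) (h.le_one n) _ _ fun q hq => ?_
        refine (Pr_le_card_conb_le (h.le_one n) (h.nonneg n) (mem_filter.1 hq).2 _).trans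
          (le_trans (Real.exp_le_exp.2 ?_) hn)
        rw [Fintype.card_fin]
        linarith
    _ ≤ ((n * n : ℕ) : ℝ) * ((n : ℝ) ^ 3)⁻¹ := by
        gcongr
        exact (card_le_univ _).trans_eq (by simp)
    _ = (n : ℝ)⁻¹ := by
        push_cast
        field_simp

theorem tendsto_small_dense (h : AboveThreshold p K) {η : ℝ} (hη : 0 < η) :
    Tendsto (fun n : ℕ => Pr (p n) (pairs (Fin n)) (fun ω => ∃ A : Finset (Fin n), A.Nonempty ∧
      #A ≤ 2 * Real.exp (-(6 / η)) * (n * p n) ∧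
      η * (n * p n ^ 2) * #A ≤ cnt ω (A ×ˢ A))) atTop (𝓝 0) := by
  have h2 : Tendsto (fun n : ℕ => (n : ℝ) * Real.exp (-(2 * (n * p n ^ 2)))) atTop (𝓝 0) := by
    refine squeeze_zero' (Eventually.of_forall fun n => by positivity) ?_
      tendsto_inv_atTop_nhds_zero_nat
    filter_upwards [h.exp_neg_le, eventually_ge_atTop 1] with n hn h1
    have hn0 : (1 : ℝ) ≤ n := by exact_mod_cast h1
    calc (n : ℝ) * Real.exp (-(2 * (n * p n ^ 2))) ≤ n * ((n : ℝ) ^ 3)⁻¹ := by gcongr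
      _ = ((n : ℝ) ^ 2)⁻¹ := by field_simp
      _ ≤ _ := inv_anti₀ (by positivity) (by nlinarith)
  refine squeeze_zero (fun n => Pr_nonneg (h.nonneg n) (h.le_one n)) (fun n => ?_)
    (tendsto_exp_sub_one h2)
  have := Pr_small_dense_le (V := Fin n) (h.nonneg n) (h.le_one n) hη
  rwa [Fintype.card_fin] at this

theorem tendsto_large_dense (h : AboveThreshold p K) :
    Tendsto (fun n : ℕ => Pr (p n) (pairs (Fin n)) (fun ω => ∃ A : Finset (Fin n), A.Nonempty ∧
      #A ≤ (n : ℝ) / 64 ∧ n * p n * #A / 16 ≤ cnt ω (A ×ˢ A))) atTop (𝓝 0) := by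
  refine squeeze_zero (fun n => Pr_nonneg (h.nonneg n) (h.le_one n)) (fun n => ?_)
    (tendsto_exp_sub_one (h.tendsto_mul_exp (a := 1 / 64) (by norm_num)))
  have := Pr_large_dense_le (V := Fin n) (h.nonneg n) (h.le_one n)
  rw [Fintype.card_fin] at this
  refine this.trans_eq (by ring_nf)

theorem tendsto_link (h : AboveThreshold p K) {ε κ : ℝ} (hε0 : 0 < ε) (hε : ε ≤ 4) (hκ : 0 < κ) :
    Tendsto (fun n : ℕ => Pr (p n) (pairs (Fin n)) (fun ω => ∃ v, ∃ A ⊆ nb ω v,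
      #(nb ω v) ≤ 2 * (n * p n) ∧ κ * (n * p n) ≤ #A ∧
      (cnt ω (A ×ˢ (nb ω v \ A)) : ℝ) - cnt ω (A ×ˢ A) ≤
        p n * #A * (#(nb ω v \ A) - #A) - ε * (n * p n ^ 2) * #A)) atTop (𝓝 0) := by
  refine squeeze_zero' (Eventually.of_forall fun n => Pr_nonneg (h.nonneg n) (h.le_one n)) ?_
    (h.tendsto_mul_exp (a := 1) one_pos)
  -- As np² → ∞, the exponent eventually exceeds twice the cost np of choosing A.
  filter_upwards [(h.tendsto.const_mul_atTop (show 0 < ε ^ 2 / 16 * κ by positivity)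
    ).eventually_ge_atTop 2] with n hn
  refine (Pr_forall_vertex_le (h.nonneg n) (h.le_one n) _ (c := Real.exp (-(n * p n * 1)))
    fun v => ?_).trans_eq (by rw [Fintype.card_fin])
  have := Pr_link_le (h.nonneg n) (h.le_one n) v (a₀ := κ * (n * p n)) hε0 hε
  rw [Fintype.card_fin] at this
  refine this.trans (Real.exp_le_exp.2 ?_)
  have h2 : 2 * (n * p n) ≤ ε ^ 2 / 16 * κ * (n * p n ^ 2) * (n * p n) :=
    mul_le_mul_of_nonneg_right hn (mul_nonneg (Nat.cast_nonneg _) (h.nonneg n))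
  linarith

/-- Every edge of the random graph is in many triangles. -/
theorem exists_tendsto_codegree_lower (h : AboveThreshold p K) : ∃ c > 0,
    Tendsto (fun n : ℕ => Pr (p n) (pairs (Fin n))
      (fun ω => ∃ x y, s(x, y) ∈ ω ∧ #(conb ω x y) ≤ c * (n * p n ^ 2))) atTop (𝓝 0) := by
  have hK := h.lt
  -- The choice makes (1 - 3θ) K = 3 / 2. With l = -log θ, one θ is lost to exp(-l) and one to l t =
  -- θ np²; the third leaves the decay exp(-θ √(np²)).
  set θ := (K - 3 / 2) / (3 * K) with hθ
  have hθ0 : 0 < θ := div_pos (by linarith) (by linarith)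
  have hθK : (1 - 3 * θ) * K = 3 / 2 := by rw [hθ]; field_simp; ring
  have hθ1 : θ < 1 := by rw [hθ, div_lt_one (by linarith)]; linarith
  have hl : 0 < -Real.log θ := neg_pos.2 (Real.log_neg hθ0 hθ1)
  refine ⟨θ / (-Real.log θ), div_pos hθ0 hl, ?_⟩
  have h2 : Tendsto (fun n : ℕ => Real.exp 2 * ((√(n * p n ^ 2)) ^ (1 : ℝ) *
      Real.exp (-θ * √(n * p n ^ 2)))) atTop (𝓝 0) := by
    have := ((tendsto_rpow_mul_exp_neg_mul_atTop_nhds_zero 1 θ hθ0).comp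
      (Real.tendsto_sqrt_atTop.comp h.tendsto)).const_mul (Real.exp 2)
    rw [mul_zero] at this
    exact this
  refine squeeze_zero' (Eventually.of_forall fun n => Pr_nonneg (h.nonneg n) (h.le_one n)) ?_ h2
  filter_upwards [h.log_le, eventually_ge_atTop 1, h.tendsto.eventually_ge_atTop 1] with n hn h1 hm
  have hn1 : (1 : ℝ) ≤ n := by exact_mod_cast h1
  have hn0 : (0 : ℝ) < n := by linarith
  have hp0 := h.nonneg n
  set m := (n : ℝ) * p n ^ 2 with hmdef
  calc _ ≤ Pr (p n) (pairs (Fin n)) (fun ω => ∃ q ∈ (univ : Finset (Fin n × Fin n)).filter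
            fun q => q.1 ≠ q.2, s(q.1, q.2) ∈ ω ∧
              #(conb ω q.1 q.2) ≤ θ / (-Real.log θ) * m) := by
        refine Pr_mono (h.nonneg n) (h.le_one n) ?_
        rintro ω hω ⟨x, y, hxy, hc⟩
        exact ⟨(x, y), by simpa using ne_of_mem hω hxy, hxy, hc⟩
    _ ≤ #((univ : Finset (Fin n × Fin n)).filter fun q => q.1 ≠ q.2) *
          (p n * Real.exp (2 - (1 - 2 * θ) * m)) := by
        refine Pr_exists_le_card_mul (h.nonneg n) (h.le_one n) _ _ fun q hq => ?_
        refine (Pr_mem_and_card_conb_le (h.le_one n) (h.nonneg n) (mem_filter.1 hq).2 hl.le _).trans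
          (mul_le_mul_of_nonneg_left (Real.exp_le_exp.2 ?_) hp0)
        rw [Fintype.card_fin, neg_neg, Real.exp_log hθ0, ← mul_assoc, mul_div_cancel₀ _ hl.ne']
        linarith
    _ ≤ ((n * n : ℕ) : ℝ) * (p n * Real.exp (2 - (1 - 2 * θ) * m)) := by
        gcongr
        exact (card_le_univ _).trans_eq (by simp)
    _ ≤ ((n * n : ℕ) : ℝ) * (p n * (Real.exp 2 * Real.exp (-θ * √m) *
          Real.exp (-(3 / 2 * Real.log n)))) := by
        rw [← Real.exp_add, ← Real.exp_add]
        gcongr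
        have hsq : √m ≤ m := Real.sqrt_le_iff.2 ⟨by linarith, by nlinarith⟩
        have h3 : 3 / 2 * Real.log n ≤ (1 - 3 * θ) * m := by
          have h4 : 0 < 1 - 3 * θ := by
            by_contra hneg
            nlinarith
          calc 3 / 2 * Real.log n = (1 - 3 * θ) * (K * Real.log n) := by rw [← hθK]; ring
            _ ≤ _ := by gcongr
        nlinarith
    -- Here n² p n^(-3/2) = √n p = √m, a factor that exp(-θ √m) absorbs.
    _ = Real.exp 2 * (√m ^ (1 : ℝ) * Real.exp (-θ * √m)) := by
        have h5 : Real.exp (-(3 / 2 * Real.log n)) = (n * √(n : ℝ))⁻¹ := by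
          rw [Real.exp_neg]
          congr 1
          rw [Real.sqrt_eq_rpow, show 3 / 2 * Real.log n = Real.log n * 1 + Real.log n * (1 / 2) by
            ring, Real.exp_add, mul_one, Real.exp_log hn0, Real.rpow_def_of_pos hn0]
        have h6 : √m = √(n : ℝ) * p n := by
          rw [hmdef, Real.sqrt_mul hn0.le, Real.sqrt_sq hp0]
        have h7 : √(n : ℝ) * √(n : ℝ) = n := Real.mul_self_sqrt hn0.le
        have h8 : 0 < √(n : ℝ) := Real.sqrt_pos.2 hn0
        rw [h5, Real.rpow_one]
        generalize Real.exp (-θ * √m) = e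
        rw [h6]
        push_cast
        generalize √(n : ℝ) = r at *
        field_simp
        rw [← h7]
        ring

end Asymptotics


/-! ### Parameters for the closeness of cocycles -/

section Stability

/-- The choice t ≈ δ² / (8192 p) keeps p t of constant order, while t codegrees of size 4np² stay
within half of d, of order np. Each exponential is at most exp(-2B) with B = δ⁴ np / 2²⁵, and 2
exp(-B) ≤ 1. -/
theorem exp_add_exp_le {n p δ : ℝ} (hp0 : 0 < p) (hδ0 : 0 < δ) (hδ1 : δ ≤ 1)
    (hm : 1 ≤ n * p ^ 2) (ha1 : 16384 ≤ δ ^ 2 * (n * p)) (ha2 : 2 ^ 25 ≤ δ ^ 4 * (n * p)) {t : ℕ}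
    (ht : t = ⌈δ ^ 2 / 8192 / p⌉₊) :
    (t - 1) * (4 * (n * p ^ 2)) ≤ δ ^ 2 / 1024 * (n * p) / 2 ∧
    Real.exp (t - p * (δ ^ 2 / 2048 * n) / 2) + Real.exp (-(p * t * (δ ^ 2 / 1024 * (n * p) / 2))) ≤
      Real.exp (-(δ ^ 4 / 2 ^ 25 * (n * p))) := by
  set b := δ ^ 2 / 8192 with hb
  have hb0 : 0 < b := by positivity
  have ht1 : b / p ≤ t := by rw [ht]; exact Nat.le_ceil _
  have ht2 : (t : ℝ) ≤ b / p + 1 := by rw [ht]; exact (Nat.ceil_lt_add_one (by positivity)).le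
  have hbp : b / p * p = b := div_mul_cancel₀ _ hp0.ne'
  have ha : 0 < n * p := by
    by_contra h
    nlinarith [sq_nonneg δ]
  have hba : b / p ≤ b * (n * p) := by
    rw [div_le_iff₀ hp0]
    nlinarith
  constructor
  · have h1 : ((t : ℝ) - 1) * (4 * (n * p ^ 2)) ≤ b / p * (4 * (n * p ^ 2)) :=
      mul_le_mul_of_nonneg_right (by linarith) (by linarith)
    have h2 : b / p * (4 * (n * p ^ 2)) = 4 * b * (n * p) := by
      field_simp
    rw [h2] at h1
    refine h1.trans_eq ?_
    rw [hb]
    ring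
  · set B := δ ^ 4 / 2 ^ 25 * (n * p) with hB
    have hB1 : 1 ≤ B := by rw [hB]; linarith
    have hδ4 : δ ^ 4 ≤ δ ^ 2 := pow_le_pow_of_le_one hδ0.le hδ1 (by norm_num)
    have hδ4a : δ ^ 4 * (n * p) ≤ δ ^ 2 * (n * p) := by gcongr
    have h1 : t - p * (δ ^ 2 / 2048 * n) / 2 ≤ -(2 * B) := by
      have : b * (n * p) = δ ^ 2 * (n * p) / 8192 := by rw [hb]; ring
      have : p * (δ ^ 2 / 2048 * n) / 2 = δ ^ 2 * (n * p) / 4096 := by ring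
      have : 2 * B = δ ^ 4 * (n * p) / 2 ^ 24 := by rw [hB]; ring
      linarith
    have h2 : -(p * t * (δ ^ 2 / 1024 * (n * p) / 2)) ≤ -(2 * B) := by
      have h3 : b ≤ p * t := by
        rw [div_le_iff₀ hp0] at ht1
        linarith
      have h4 : b * (δ ^ 2 / 1024 * (n * p) / 2) ≤ p * t * (δ ^ 2 / 1024 * (n * p) / 2) :=
        mul_le_mul_of_nonneg_right h3 (by positivity)
      have : b * (δ ^ 2 / 1024 * (n * p) / 2) = 2 * B := by rw [hb, hB]; ring
      linarith
    have h3 : Real.exp (-B) ≤ 1 / 2 := by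
      calc Real.exp (-B) ≤ Real.exp (-1) := Real.exp_le_exp.2 (by linarith)
        _ ≤ 1 / 2 := by
          rw [Real.exp_neg, inv_eq_one_div]
          gcongr
          linarith [Real.add_one_le_exp (1 : ℝ)]
    have h4 : Real.exp (-(2 * B)) = Real.exp (-B) * Real.exp (-B) := by
      rw [← Real.exp_add]; congr 1; ring
    have h5 := Real.exp_le_exp.2 h1
    have h6 := Real.exp_le_exp.2 h2
    nlinarith [Real.exp_pos (-B)]

variable {p : ℕ → ℝ} {K : ℝ}

theorem exists_disjoint_card_eq {V : Type*} [Fintype V] [DecidableEq V] {s z : ℕ}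
    (h : s + z ≤ Fintype.card V) : ∃ S Z : Finset V, Disjoint S Z ∧ #S = s ∧ #Z = z := by
  obtain ⟨T, -, hT⟩ := exists_subset_card_eq (s := (univ : Finset V)) (n := s + z) (by simpa using h)
  obtain ⟨S, hS, hSc⟩ := exists_subset_card_eq (s := T) (n := s) (by omega)
  exact ⟨S, T \ S, disjoint_sdiff, hSc, by rw [card_sdiff_of_subset hS]; omega⟩

/-- With N = n² q the three failure terms decay at rates 1/4096, δ² / 2048 and b per unit of N, and
b is the smallest. The exposed values cost exp(b N / 2), so half of the rate survives. -/
theorem far_cocycle_sum_le {n q δ b s z x : ℝ} (hq : 0 ≤ q) (hn : 2 ^ 16 ≤ n)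
    (hb0 : 0 < b) (hb : b = δ ^ 4 / 2 ^ 25 / 2 ^ 15) (hδ0 : 0 < δ) (hδ : δ = 1 / 4096)
    (hx : x ≤ Real.exp (-(δ ^ 4 / 2 ^ 25 * (n * q)))) (hx0 : 0 ≤ x) (hz : n / 2 ^ 14 ≤ z)
    (hs : q * (s * n) ≤ b / 2 * (n * (n * q))) :
    Real.exp (q * (s * n)) * (Real.exp (-(n ^ 2 * q / 1024 / 2) + q * (δ * n ^ 2)) +
      (n * Real.exp (-(q * (δ ^ 2 / 128 * n ^ 2) / 16)) + x ^ (z / 2))) ≤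
      3 * (n * Real.exp (-(n * q * (b / 2)))) := by
  have hn0 : 0 < n := by linarith
  obtain ⟨N, hN⟩ : ∃ N : ℝ, N = n * (n * q) := ⟨_, rfl⟩
  have hN0 : 0 ≤ N := by rw [hN]; positivity
  have hb1 : b ≤ 1 / 4096 := by rw [hb, hδ]; norm_num
  have hb2 : b ≤ δ ^ 2 / 128 / 16 := by rw [hb, hδ]; norm_num
  have e1 : Real.exp (-(n ^ 2 * q / 1024 / 2) + q * (δ * n ^ 2)) ≤ Real.exp (-(b * N)) := by
    have h1 := mul_le_mul_of_nonneg_right hb1 hN0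
    have h2 : -(n ^ 2 * q / 1024 / 2) + q * (δ * n ^ 2) = -(1 / 4096 * N) := by rw [hδ, hN]; ring
    rw [h2]
    exact Real.exp_le_exp.2 (by linarith)
  have e2 : Real.exp (-(q * (δ ^ 2 / 128 * n ^ 2) / 16)) ≤ Real.exp (-(b * N)) := by
    have h1 := mul_le_mul_of_nonneg_right hb2 hN0
    have h2 : q * (δ ^ 2 / 128 * n ^ 2) / 16 = δ ^ 2 / 128 / 16 * N := by rw [hN]; ring
    rw [h2]
    exact Real.exp_le_exp.2 (by linarith)
  have e3 : x ^ (z / 2) ≤ Real.exp (-(b * N)) := by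
    have hz0 : 0 ≤ z := le_trans (by positivity) hz
    refine (Real.rpow_le_rpow hx0 hx (by linarith)).trans ?_
    rw [← Real.exp_mul]
    refine Real.exp_le_exp.2 ?_
    have h0 : 0 ≤ δ ^ 4 / 2 ^ 25 * (n * q) := by positivity
    have h1 := mul_le_mul_of_nonneg_left (show n / 2 ^ 15 ≤ z / 2 by linarith) h0
    have h2 : δ ^ 4 / 2 ^ 25 * (n * q) * (n / 2 ^ 15) = b * N := by rw [hb, hN]; ring
    linarith
  have e4 : Real.exp (q * (s * n)) ≤ Real.exp (b / 2 * N) := Real.exp_le_exp.2 (hN ▸ hs)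
  have e5 : Real.exp (-(N * (b / 2))) ≤ Real.exp (-(n * q * (b / 2))) := by
    refine Real.exp_le_exp.2 (neg_le_neg (mul_le_mul_of_nonneg_right ?_ (by linarith)))
    rw [hN]
    exact le_mul_of_one_le_left (by positivity) (by linarith)
  calc _ ≤ Real.exp (b / 2 * N) * (Real.exp (-(b * N)) +
        (n * Real.exp (-(b * N)) + Real.exp (-(b * N)))) :=
        mul_le_mul e4 (add_le_add e1 (add_le_add (mul_le_mul_of_nonneg_left e2 hn0.le) e3))
          (by positivity) (by positivity)
    _ = (n + 2) * (Real.exp (b / 2 * N) * Real.exp (-(b * N))) := by ring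
    _ = (n + 2) * Real.exp (-(N * (b / 2))) := by
        rw [← Real.exp_add]
        congr 2
        ring
    _ ≤ (3 * n) * Real.exp (-(n * q * (b / 2))) :=
        mul_le_mul (by linarith) e5 (by positivity) (by positivity)
    _ = _ := by ring

/-- In a random graph above the threshold, every cocycle is close to a coboundary. -/
theorem tendsto_far_cocycle (h : AboveThreshold p K) :
    Tendsto (fun n : ℕ => Pr (p n) (pairs (Fin n)) (fun ω =>
      BoundedDegrees (2 * (n * p n)) (4 * (n * p n ^ 2)) ω ∧ ∃ f, IsCocycle ω f ∧
        ∀ h, (n : ℝ) ^ 2 * p n / 512 < #(defect ω f h univ))) atTop (𝓝 0) := by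
  -- With τ = n² p / 1024, this δ makes δ n² p half of τ / 2.
  obtain ⟨δ, hδ⟩ : ∃ δ : ℝ, δ = 1 / 4096 := ⟨_, rfl⟩
  have hδ0 : 0 < δ := by rw [hδ]; norm_num
  have hδ1 : δ ≤ 1 := by rw [hδ]; norm_num
  obtain ⟨b, hb⟩ : ∃ b : ℝ, b = δ ^ 4 / 2 ^ 25 / 2 ^ 15 := ⟨_, rfl⟩
  have hb0 : 0 < b := by rw [hb]; positivity
  have hlim : Tendsto (fun n : ℕ => 2 ^ 18 / δ * Real.exp (-√(n * p n ^ 2)) +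
      3 * ((n : ℝ) * Real.exp (-(n * p n * (b / 2))))) atTop (𝓝 0) := by
    have h1 := ((Real.tendsto_exp_atBot.comp tendsto_neg_atTop_atBot).comp
      (Real.tendsto_sqrt_atTop.comp h.tendsto)).const_mul (2 ^ 18 / δ)
    have h2 := (h.tendsto_mul_exp (half_pos hb0)).const_mul 3
    have := h1.add h2
    simpa using this
  refine squeeze_zero' (Eventually.of_forall fun n => Pr_nonneg (h.nonneg n) (h.le_one n)) ?_ hlim
  filter_upwards [h.tendsto.eventually_ge_atTop 1, h.tendsto_mul.eventually_ge_atTop 1,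
    (h.tendsto_mul.const_mul_atTop (pow_pos hδ0 2)).eventually_ge_atTop 16384,
    (h.tendsto_mul.const_mul_atTop (pow_pos hδ0 4)).eventually_ge_atTop (2 ^ 25),
    (Real.tendsto_sqrt_atTop.comp h.tendsto).eventually_ge_atTop (2 ^ 15),
    (Real.tendsto_sqrt_atTop.comp h.tendsto).eventually_ge_atTop (4 / b),
    (tendsto_natCast_atTop_atTop (R := ℝ)).eventually_ge_atTop (2 ^ 16),
    (tendsto_natCast_atTop_atTop (R := ℝ)).eventually_ge_atTop (4 / b)]
    with n hm ha ha1 ha2 hsm1 hsm2 hn1 hn2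
  have hp0 := h.nonneg n
  have hp1 := h.le_one n
  set q := p n with hq
  simp only [Function.comp_apply] at hsm1 hsm2
  have hn0 : (0 : ℝ) < n := by linarith
  have hq0 : 0 < q := hp0.lt_of_ne fun h0 => by rw [← h0] at ha; linarith
  have hsqrt : √((n : ℝ) * q ^ 2) = √(n : ℝ) * q := by
    rw [Real.sqrt_mul hn0.le, Real.sqrt_sq hp0]
  have hsn : √(n : ℝ) * √(n : ℝ) = n := Real.mul_self_sqrt hn0.le
  have hsn0 : 0 < √(n : ℝ) := Real.sqrt_pos.2 hn0
  set r := √((n : ℝ) * q ^ 2) with hr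
  -- The size √n / q balances two demands: q² s ≥ r → ∞ covers most pairs, and q s n ≈ n² q / r is
  -- of smaller order than n² q.
  obtain ⟨s, hs⟩ : ∃ s : ℕ, s = ⌈√(n : ℝ) / q⌉₊ := ⟨_, rfl⟩
  obtain ⟨z, hz⟩ : ∃ z : ℕ, z = ⌊(n : ℝ) / 8192⌋₊ := ⟨_, rfl⟩
  have hs1 : √(n : ℝ) ≤ s * q := by
    rw [← div_le_iff₀ hq0, hs]
    exact Nat.le_ceil _
  have hs2 : (s : ℝ) * q ≤ √(n : ℝ) + q := by
    have : (s : ℝ) ≤ √(n : ℝ) / q + 1 := by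
      rw [hs]; exact (Nat.ceil_lt_add_one (by positivity)).le
    have := mul_le_mul_of_nonneg_right this hp0
    rwa [add_mul, div_mul_cancel₀ _ hq0.ne', one_mul] at this
  have hsr : √(n : ℝ) * r = n * q := by rw [hsqrt, ← mul_assoc, hsn]
  have hsn' : ∀ x, x ≤ r → x * √(n : ℝ) ≤ n * q := fun x hx => by
    rw [← hsr, mul_comm]
    gcongr
  have hs3 : (s : ℝ) ≤ n / 2 ^ 14 := by
    have h1 := hsn' _ hsm1
    have h2 : (s : ℝ) * q ≤ (n / 2 ^ 15 + 1) * q := by linarith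
    have := le_of_mul_le_mul_right h2 hq0
    linarith
  have hz1 : (n : ℝ) / 2 ^ 14 ≤ z := by
    have := Nat.lt_floor_add_one ((n : ℝ) / 8192)
    rw [← hz] at this
    linarith
  have hz2 : (z : ℝ) ≤ n / 8192 := by rw [hz]; exact Nat.floor_le (by positivity)
  have hsz : s + z ≤ Fintype.card (Fin n) := by
    rw [Fintype.card_fin]
    have : ((s + z : ℕ) : ℝ) ≤ n := by push_cast; linarith
    exact_mod_cast this
  obtain ⟨S, Z, hSZ, hS, hZ⟩ := exists_disjoint_card_eq hsz
  obtain ⟨ht, hexp⟩ := exp_add_exp_le hq0 hδ0 hδ1 hm ha1 ha2 rfl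
  have hone : Real.exp (-(δ ^ 4 / 2 ^ 25 * (n * q))) ≤ 1 := Real.exp_le_one_iff.2 (by
    have : 0 < δ ^ 4 / 2 ^ 25 * (n * q) := by positivity
    linarith)
  -- The bound δ n² / 2¹⁸ on uncovered pairs is δ z n / 16 at the least possible z = n / 2¹⁴.
  have hc0 : 0 < δ / 2 ^ 18 * (n : ℝ) ^ 2 := by positivity
  have hunc := Pr_lt_card_uncovered_le hp0 hp1 S hc0
  have hfar := Pr_far_cocycle_le (V := Fin n) hp0 hp1 hSZ (D := 2 * (n * q)) (k := 4 * (n * q ^ 2))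
    (d := δ ^ 2 / 1024 * (n * q)) (r := δ ^ 2 / 2048 * n) (δ := δ) (τ := n ^ 2 * q / 1024)
    (c := δ / 2 ^ 18 * (n : ℝ) ^ 2) (by positivity) (by positivity) (by positivity) hδ0
    (by rw [Fintype.card_fin, hδ]; linarith)
    (by rw [Fintype.card_fin]; refine le_of_eq ?_; ring) _ ht (hexp.trans hone)
    (by
      rw [Fintype.card_fin]
      have : 0 ≤ δ * (n : ℝ) ^ 2 := by positivity
      linarith)
    (by
      rw [Fintype.card_fin, hZ]
      have : δ * (n : ℝ) * (n / 2 ^ 14) ≤ δ * n * z := by gcongr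
      linarith)
  rw [Fintype.card_fin] at hunc hfar
  refine (Pr_mono hp0 hp1 (Q := fun ω => δ / 2 ^ 18 * (n : ℝ) ^ 2 < #(uncovered S ω) ∨
    (BoundedDegrees (2 * (n * q)) (4 * (n * q ^ 2)) ω ∧
      #(uncovered S ω) ≤ δ / 2 ^ 18 * (n : ℝ) ^ 2 ∧ ∃ f, IsCocycle ω f ∧
      ∀ h, n ^ 2 * q / 1024 + 2 * ((#S + #Z) * (2 * (n * q))) < #(defect ω f h univ))) ?_).trans
    ((Pr_or_le hp0 hp1).trans (add_le_add (hunc.trans ?_) (hfar.trans ?_)))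
  · rintro ω - ⟨hb, f, hf, hh⟩
    rcases lt_or_ge (δ / 2 ^ 18 * (n : ℝ) ^ 2) (#(uncovered S ω) : ℝ) with hu | hu
    · exact Or.inl hu
    · refine Or.inr ⟨hb, hu, f, hf, fun h => lt_of_le_of_lt ?_ (hh h)⟩
      rw [hS, hZ]
      -- Half of the allowance n² q / 512 is τ; the other half pays for the edges at S ∪ Z.
      have h1 : ((s : ℝ) + z) * (4 * (n * q)) ≤ n / 4096 * (4 * (n * q)) := by
        gcongr
        linarith
      linarith
  · rw [hS]
    have h1 : r ≤ q ^ 2 * s := by rw [hsqrt]; nlinarith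
    have h2 : Real.exp (-(q ^ 2 * s)) ≤ Real.exp (-r) := Real.exp_le_exp.2 (by linarith)
    calc (n : ℝ) ^ 2 * Real.exp (-(q ^ 2 * s)) / (δ / 2 ^ 18 * n ^ 2)
        = 2 ^ 18 / δ * Real.exp (-(q ^ 2 * s)) := by field_simp
      _ ≤ _ := by gcongr
  · rw [hS, hZ]
    refine far_cocycle_sum_le hq0.le hn1 hb0 hb hδ0 hδ hexp (by positivity) (by linarith) ?_
    have h1 : (s : ℝ) * q * n ≤ (√(n : ℝ) + q) * n := mul_le_mul_of_nonneg_right hs2 hn0.le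
    have h2 : √(n : ℝ) ≤ b / 4 * (n * q) := by
      have := hsn' _ hsm2
      rw [div_mul_eq_mul_div, div_le_iff₀ hb0] at this
      linarith
    have h3 : √(n : ℝ) * n ≤ b / 4 * (n * q) * n := mul_le_mul_of_nonneg_right h2 hn0.le
    have h4 : 4 * (n * q) ≤ n * b * (n * q) := by
      rw [div_le_iff₀ hb0] at hn2
      exact mul_le_mul_of_nonneg_right hn2 (by positivity)
    linarith

end Stability

/-! ### Combining the typical properties -/

section Main

variable {p : ℕ → ℝ} {K : ℝ}

/-- With high probability, every cocycle of a random graph above the threshold is a coboundary. -/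
theorem tendsto_exists_nontrivial_cocycle (h : AboveThreshold p K) :
    Tendsto (fun n : ℕ => Pr (p n) (pairs (Fin n)) (fun ω => ¬ ∀ f, IsCocycle ω f →
      ∃ h : Fin n → ZMod 2, ∀ x y, s(x, y) ∈ ω → f s(x, y) = h x + h y)) atTop (𝓝 0) := by
  obtain ⟨c, hc, h1⟩ := exists_tendsto_codegree_lower h
  obtain ⟨ε, hε⟩ : ∃ ε : ℝ, ε = min (c / 4) (1 / 16) := ⟨_, rfl⟩
  have hε0 : 0 < ε := by rw [hε]; positivity
  have hεc : ε ≤ c / 4 := hε ▸ min_le_left _ _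
  have hε1 : ε ≤ 1 / 16 := hε ▸ min_le_right _ _
  have hη : 0 < c / 4 := by positivity
  -- Sparsity of small sets with η = c / 4 dictates κ; the link estimate handles all sets of size at
  -- least κ n p.
  obtain ⟨κ, hκ⟩ : ∃ κ : ℝ, κ = 2 * Real.exp (-(6 / (c / 4))) := ⟨_, rfl⟩
  have hκ0 : 0 < κ := by rw [hκ]; positivity
  have h2 := tendsto_codegree_upper h
  have h3 := tendsto_degree_upper h
  have h4 := tendsto_degree_lower h
  have h5 := tendsto_small_dense h hη
  have h6 := tendsto_large_dense h
  have h7 := tendsto_link h hε0 (by linarith) hκ0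
  have h8 := tendsto_far_cocycle h
  have hsum := h1.add (h2.add (h3.add (h4.add (h5.add (h6.add (h7.add h8))))))
  simp only [add_zero] at hsum
  refine squeeze_zero' (Eventually.of_forall fun n => Pr_nonneg (h.nonneg n) (h.le_one n)) ?_ hsum
  filter_upwards [h.tendsto_mul.eventually_ge_atTop 1] with n ha
  have hp0 := h.nonneg n
  have hp1 := h.le_one n
  have hq0 : 0 < p n := hp0.lt_of_ne fun h0 => by rw [← h0] at ha; linarith
  have hn0 : (0 : ℝ) < n := by
    by_contra hneg
    nlinarith
  refine le_trans (Pr_mono hp0 hp1 ?_) <|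
    (Pr_or_le hp0 hp1).trans <| add_le_add le_rfl <| (Pr_or_le hp0 hp1).trans <|
    add_le_add le_rfl <| (Pr_or_le hp0 hp1).trans <| add_le_add le_rfl <|
    (Pr_or_le hp0 hp1).trans <| add_le_add le_rfl <| (Pr_or_le hp0 hp1).trans <|
    add_le_add le_rfl <| (Pr_or_le hp0 hp1).trans <| add_le_add le_rfl (Pr_or_le hp0 hp1)
  intro ω hω hbad
  by_contra hgood
  simp only [not_or] at hgood
  obtain ⟨g1, g2, g3, g4, g5, g6, g7, g8⟩ := hgood
  push Not at g1 g2 g3 g4 g5 g6 g7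
  refine hbad fun f hf => ?_
  refine exists_eq_coboundary hω hf (n := n) (p := p n) (c := c) (ε := ε) (κ := κ) hq0 hn0 hc hε0
    (by linarith) (by linarith) (fun x y hxy => (g1 x y hxy).le) ?_ ?_ (fun v => (g4 v).le) g6 ?_
  · intro A hA hAκ
    exact (g5 A hA (hκ ▸ hAκ)).le
  · intro v A hA hAκ
    exact (g7 v A hA (g3 v).le hAκ).le
  · by_contra hfar
    push Not at hfar
    exact g8 ⟨⟨fun v => (g3 v).le, fun x y hxy => (g2 x y hxy).le⟩, f, hf, hfar⟩

end Main

end RandomSubset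

/-! ### From cocycles to the cycle space and to H₁ -/

namespace TriangleSpace

variable {V : Type*} {G : SimpleGraph V}

theorem edgeVec_insert {e : Sym2 V} {F : Set (Sym2 V)} (he : e ∉ F) :
    edgeVec G (insert e F) = edgeVec G {e} + edgeVec G F := by
  funext d
  by_cases hd : (d : Sym2 V) = e
  · simp [edgeVec, hd, he]
  · have h1 : (d : Sym2 V) ∈ insert e F ↔ (d : Sym2 V) ∈ F := by simp [hd]
    have h2 : edgeVec G (insert e F) d = edgeVec G F d := by
      by_cases hF : (d : Sym2 V) ∈ F
      · exact (if_pos (h1.2 hF)).trans (if_pos hF).symm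
      · exact (if_neg (mt h1.1 hF)).trans (if_neg hF).symm
    have h3 : edgeVec G {e} d = 0 := by simp [edgeVec, hd]
    rw [h2, Pi.add_apply, h3, zero_add]

theorem edgeVec_triangle {u v w : V} (huv : G.Adj u v) (hvw : G.Adj v w) (huw : G.Adj u w) :
    edgeVec G {s(u, v), s(v, w), s(u, w)} =
      edgeVec G {s(u, v)} + (edgeVec G {s(v, w)} + edgeVec G {s(u, w)}) := by
  rw [edgeVec_insert, edgeVec_insert]
  · simp [huv.ne', huw.ne', hvw.ne]
  · simp [huv.ne, huw.ne, huv.ne', hvw.ne]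

theorem triangleSpace_le_cycleSpace : triangleSpace G ≤ cycleSpace G := by
  refine Submodule.span_mono ?_
  rintro _ ⟨u, v, w, huv, hvw, huw, rfl⟩
  refine ⟨u, .cons huv (.cons hvw (.cons huw.symm .nil)), ?_, ?_⟩
  · simp [SimpleGraph.Walk.isCycle_def, SimpleGraph.Walk.isTrail_def, huv.ne, huv.ne', hvw.ne,
      huw.ne, huw.ne']
  · congr 1
    ext e
    simp [Sym2.eq_swap (a := w)]

/-- The sum telescopes along the walk. Edges must not repeat, since `edgeVec` records a set without
multiplicities. -/
theorem map_edgeVec_edges {f : EdgeSpace G →ₗ[ZMod 2] ZMod 2} {h : V → ZMod 2}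
    (hf : ∀ x y, G.Adj x y → f (edgeVec G {s(x, y)}) = h x + h y) {u v : V} (c : G.Walk u v)
    (hc : c.edges.Nodup) : f (edgeVec G {e | e ∈ c.edges}) = h u + h v := by
  induction c with
  | nil =>
    have h0 : edgeVec G {e | e ∈ ([] : List (Sym2 V))} = 0 := by
      funext d
      simp [edgeVec]
    simp only [SimpleGraph.Walk.edges_nil, h0, map_zero, CharTwo.add_self_eq_zero]
  | @cons a b _ hab c ih =>
    simp only [SimpleGraph.Walk.edges_cons, List.nodup_cons] at hc
    have h1 : {e | e ∈ (SimpleGraph.Walk.cons hab c).edges} = insert s(a, b) {e | e ∈ c.edges} := by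
      ext e
      simp
    rw [h1, edgeVec_insert hc.1, map_add, ih hc.2, hf _ _ hab]
    linear_combination CharTwo.add_self_eq_zero (h b)

/-- A cycle outside the triangle space would be separated from it by a functional. This functional
is a cocycle on edges, hence a coboundary, hence zero on the cycle. -/
theorem triangleSpace_eq_cycleSpace
    (hG : ∀ f : Sym2 V → ZMod 2, (∀ x y z, G.Adj x y → G.Adj y z → G.Adj x z →
      f s(x, y) + f s(y, z) + f s(x, z) = 0) →
      ∃ h : V → ZMod 2, ∀ x y, G.Adj x y → f s(x, y) = h x + h y) :
    triangleSpace G = cycleSpace G := by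
  refine le_antisymm triangleSpace_le_cycleSpace (Submodule.span_le.2 ?_)
  rintro _ ⟨v, c, hc, rfl⟩
  by_contra hv
  obtain ⟨f, hfv, hf⟩ := Submodule.exists_le_ker_of_notMem hv
  obtain ⟨h, hh⟩ := hG (fun e => f (edgeVec G {e})) fun x y z hxy hyz hxz => by
    have h1 := hf (Submodule.subset_span ⟨x, y, z, hxy, hyz, hxz, rfl⟩)
    rw [LinearMap.mem_ker, edgeVec_triangle hxy hyz hxz, map_add, map_add] at h1
    rw [← h1, add_assoc]
  exact hfv ((map_edgeVec_edges hh c hc.1.1.1).trans (CharTwo.add_self_eq_zero _))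

variable [DecidableEq V]

theorem map_boundary_single {K : AbstractSimplicialComplex V} {k : ℕ}
    {f : Chain K k →ₗ[ZMod 2] ZMod 2} {F : Finset V → ZMod 2}
    (hf : ∀ t : Face K k, f (Finsupp.single t 1) = F t.1) (s : Face K (k + 1)) :
    f (boundary K k (Finsupp.single s 1)) = ∑ v ∈ s.1, F (s.1.erase v) := by
  rw [boundary, Finsupp.linearCombination_single, one_smul, map_sum,
    ← Finset.sum_coe_sort s.1 fun v => F (s.1.erase v)]
  exact Finset.sum_congr rfl fun v _ => hf (facet s v)

/-- The same duality for chains: a functional that kills the 1-boundaries is a cocycle, so it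
factors through the boundary map to 0-chains and kills every 1-cycle. -/
theorem subsingleton_H1_cliqueComplex
    (hG : ∀ f : Sym2 V → ZMod 2, (∀ x y z, G.Adj x y → G.Adj y z → G.Adj x z →
      f s(x, y) + f s(y, z) + f s(x, z) = 0) →
      ∃ h : V → ZMod 2, ∀ x y, G.Adj x y → f s(x, y) = h x + h y) :
    Subsingleton (H1 (cliqueComplex G)) := by
  classical
  refine Submodule.Quotient.subsingleton_iff.2 ?_
  rw [Submodule.submoduleOf,    Submodule.comap_subtype_eq_top]
  intro c hc
  by_contra hcr
  obtain ⟨f, hfc, hf⟩ := Submodule.exists_le_ker_of_notMem hcr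
  -- Extending f by 0 to all finite sets allows facets to be written as erasures without membership
  -- proofs.
  obtain ⟨F, hF⟩ : ∃ F : Finset V → ZMod 2,
      ∀ t : Face (cliqueComplex G) 1, f (Finsupp.single t 1) = F t.1 :=
    ⟨fun s => if hs : s ∈ (cliqueComplex G).faces ∧ s.card = 1 + 1 then
      f (Finsupp.single ⟨s, hs⟩ 1) else 0, fun t => by
        dsimp only
        rw [dif_pos t.2]⟩
  obtain ⟨h, hh⟩ := hG (fun e => F e.toFinset) fun x y z hxy hyz hxz => by
    have hs : ({x, y, z} : Finset V) ∈ (cliqueComplex G).faces ∧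
        ({x, y, z} : Finset V).card = 1 + 1 + 1 := by
      refine ⟨⟨by simp, ?_⟩, ?_⟩
      · simp [SimpleGraph.isClique_iff, Set.pairwise_insert, hxy, hyz, hxz, hxy.symm, hyz.symm,
          hxz.symm]
      · rw [Finset.card_eq_three.2 ⟨x, y, z, hxy.ne, hxz.ne, hyz.ne, rfl⟩]
    have h1 := map_boundary_single hF ⟨_, hs⟩
    have h2 := hf (LinearMap.mem_range_self (boundary (cliqueComplex G) 1)
      (Finsupp.single ⟨_, hs⟩ 1))
    rw [LinearMap.mem_ker, h1] at h2
    have e1 : ({x, y, z} : Finset V).erase x = {y, z} := by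
      ext a; simp; grind [SimpleGraph.Adj.ne]
    have e2 : ({x, y, z} : Finset V).erase y = {x, z} := by
      ext a; simp; grind [SimpleGraph.Adj.ne]
    have e3 : ({x, y, z} : Finset V).erase z = {x, y} := by
      ext a; simp; grind [SimpleGraph.Adj.ne]
    dsimp only at h2
    rw [Finset.sum_insert (by simp [hxy.ne, hxz.ne]), Finset.sum_insert (by simp [hyz.ne]),
      Finset.sum_singleton, e1, e2, e3] at h2
    simp only [Sym2.toFinset_mk_eq]
    linear_combination h2
  obtain ⟨g, hg⟩ : ∃ g : Chain (cliqueComplex G) 0 →ₗ[ZMod 2] ZMod 2,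
      ∀ t, g (Finsupp.single t 1) = ∑ v ∈ t.1, h v :=
    ⟨Finsupp.linearCombination (ZMod 2) fun t => ∑ v ∈ t.1, h v, fun t => by
      rw [Finsupp.linearCombination_single, one_smul]⟩
  have hfg : f = g ∘ₗ boundary (cliqueComplex G) 0 := by
    refine Finsupp.lhom_ext' fun s => LinearMap.ext_ring ?_
    simp only [LinearMap.comp_apply, Finsupp.lsingle_apply]
    rw [map_boundary_single (F := fun t => ∑ v ∈ t, h v) hg, hF]
    obtain ⟨s, ⟨-, hs⟩, hs2⟩ := s
    obtain ⟨x, y, hxy, rfl⟩ := Finset.card_eq_two.1 hs2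
    have hadj : G.Adj x y := hs (by simp) (by simp) hxy
    have h1 := hh x y hadj
    have e1 : ({x, y} : Finset V).erase x = {y} := by
      ext a; simp; grind
    have e2 : ({x, y} : Finset V).erase y = {x} := by
      ext a; simp; grind
    dsimp only
    rw [Finset.sum_pair hxy, e1, e2, Finset.sum_singleton, Finset.sum_singleton, add_comm, ← h1,
      Sym2.toFinset_mk_eq]
  refine hfc ?_
  rw [hfg, LinearMap.comp_apply, LinearMap.mem_ker.1 hc, map_zero]

end TriangleSpace

/-! ### Transfer to the random graph measure -/

namespace RandomSubset

open Finset MeasureTheory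

theorem edgeSet_fromEdgeSet_of_subset {V : Type*} [Fintype V] [DecidableEq V]
    {ω : Finset (Sym2 V)} (hω : ω ⊆ pairs V) :
    (SimpleGraph.fromEdgeSet (ω : Set (Sym2 V))).edgeSet = ω := by
  rw [SimpleGraph.edgeSet_fromEdgeSet]
  ext e
  simp only [Set.mem_sdiff, mem_coe, and_iff_left_iff_imp]
  intro he
  simpa [pairs] using hω he

theorem card_pairs {V : Type*} [Fintype V] [DecidableEq V] :
    #(pairs V) = (Fintype.card V).choose 2 := by
  rw [← Sym2.card_subtype_not_diag, Fintype.card_subtype, pairs]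

/-- The law of the binomial random graph, expressed through its edge set. -/
theorem binomialRandom_eq_Pr {V : Type*} [Fintype V] [DecidableEq V] (p : unitInterval)
    (P : SimpleGraph V → Prop) :
    SimpleGraph.binomialRandom V p {G | P G} =
      ENNReal.ofReal (Pr p (pairs V) fun ω => P (SimpleGraph.fromEdgeSet ω)) := by
  classical
  have h0 : ((univ.filter P : Finset (SimpleGraph V)) : Set (SimpleGraph V)) = {G | P G} := by
    ext; simp
  have hp0 : (0 : ℝ) ≤ p := p.2.1
  have hp1 : (0 : ℝ) ≤ 1 - p := sub_nonneg.2 p.2.2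
  have : MeasurableSingletonClass (SimpleGraph V) := ⟨fun G => by
    refine ⟨{G.Adj}, measurableSet_singleton _, ?_⟩
    ext H
    simp [SimpleGraph.adj_inj]⟩
  rw [← h0, ← sum_measure_singleton, Pr, Ex, ENNReal.ofReal_sum_of_nonneg fun ω _ => by positivity,
    sum_filter]
  symm
  refine sum_bij' (fun ω _ => SimpleGraph.fromEdgeSet (ω : Set (Sym2 V)))
    (fun G _ => G.edgeFinset) (fun _ _ => mem_univ _) (fun G _ => ?_) (fun ω hω => ?_)
    (fun G _ => ?_) fun ω hω => ?_
  · rw [mem_powerset]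
    intro e he
    simpa [pairs] using G.not_isDiag_of_mem_edgeFinset he
  · rw [← coe_inj, SimpleGraph.coe_edgeFinset, edgeSet_fromEdgeSet_of_subset (mem_powerset.1 hω)]
  · simp
  · split_ifs
    · rw [SimpleGraph.binomialRandom_singleton,
        edgeSet_fromEdgeSet_of_subset (mem_powerset.1 hω), Set.ncard_coe_finset,
        Nat.card_eq_fintype_card, ← card_pairs, ← card_sdiff_of_subset (mem_powerset.1 hω), mul_one,
        ENNReal.ofReal_mul (by positivity), ENNReal.ofReal_pow hp0, ENNReal.ofReal_pow hp1]
      congr 2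
      · rw [ENNReal.ofReal, Real.toNNReal_of_nonneg hp0]
        rfl
      · rw [ENNReal.ofReal, Real.toNNReal_of_nonneg hp1]
        rfl
    · simp

theorem triangleSpace_eq_and_subsingleton {V : Type*} [DecidableEq V] {ω : Finset (Sym2 V)}
    {G : SimpleGraph V} (hadj : ∀ x y, G.Adj x y ↔ s(x, y) ∈ ω)
    (h : ∀ f, IsCocycle ω f → ∃ h : V → ZMod 2, ∀ x y, s(x, y) ∈ ω → f s(x, y) = h x + h y) :
    TriangleSpace.triangleSpace G = TriangleSpace.cycleSpace G ∧
      Subsingleton (TriangleSpace.H1 (TriangleSpace.cliqueComplex G)) := by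
  have hG : ∀ f : Sym2 V → ZMod 2, (∀ x y z, G.Adj x y → G.Adj y z → G.Adj x z →
      f s(x, y) + f s(y, z) + f s(x, z) = 0) →
      ∃ h : V → ZMod 2, ∀ x y, G.Adj x y → f s(x, y) = h x + h y := by
    simp only [hadj]
    exact h
  exact ⟨TriangleSpace.triangleSpace_eq_cycleSpace hG,
    TriangleSpace.subsingleton_H1_cliqueComplex hG⟩

theorem AboveThreshold.of_sqrt_lt {C : ℝ} (hC : √(3 / 2 : ℝ) < C) {p : ℕ → unitInterval}
    (hp : ∀ᶠ n : ℕ in atTop, C * √(Real.log n / n) < (p n : ℝ)) :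
    AboveThreshold (fun n => (p n : ℝ)) (C ^ 2) where
  nonneg n := (p n).2.1
  le_one n := (p n).2.2
  lt := by
    have := Real.sq_sqrt (show (0 : ℝ) ≤ 3 / 2 by norm_num)
    rw [← this]
    exact pow_lt_pow_left₀ hC (Real.sqrt_nonneg _) two_ne_zero
  log_le := by
    have hC0 : 0 ≤ C := (Real.sqrt_nonneg _).trans hC.le
    filter_upwards [hp, eventually_ge_atTop 1] with n hn hn1
    have hn0 : (0 : ℝ) < n := by exact_mod_cast hn1
    have h1 := pow_le_pow_left₀ (by positivity) hn.le 2
    rw [mul_pow, Real.sq_sqrt (div_nonneg (Real.log_natCast_nonneg n) hn0.le), ← mul_div_assoc,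
      div_le_iff₀ hn0] at h1
    linarith

end RandomSubset

theorem theorem1p2 (C : ℝ) (hC : √(3 / 2 : ℝ) < C) (p : ℕ → unitInterval)
    (hp : ∀ᶠ n : ℕ in atTop, C * √(Real.log n / n) < (p n : ℝ)) :
    Tendsto
      (fun n : ℕ => SimpleGraph.binomialRandom (Fin n) (p n)
        {G | TriangleSpace.triangleSpace G = TriangleSpace.cycleSpace G ∧
          Subsingleton (TriangleSpace.H1 (TriangleSpace.cliqueComplex G))})
      atTop (𝓝 1) := by
  have h1 := RandomSubset.tendsto_exists_nontrivial_cocycle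
    (RandomSubset.AboveThreshold.of_sqrt_lt hC hp)
  have h2 := ENNReal.Tendsto.sub tendsto_const_nhds (ENNReal.tendsto_ofReal h1)
    (Or.inl ENNReal.one_ne_top)
  rw [ENNReal.ofReal_zero, tsub_zero] at h2
  refine tendsto_of_tendsto_of_tendsto_of_le_of_le h2 tendsto_const_nhds (fun n => ?_)
    fun n => MeasureTheory.prob_le_one
  refine tsub_le_iff_right.2 ?_
  -- Subadditivity alone reduces the claim to the complement, so measurability of the event is not
  -- needed.
  have h3 := MeasureTheory.measure_univ_le_add_compl (μ := SimpleGraph.binomialRandom (Fin n) (p n))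
    {G | TriangleSpace.triangleSpace G = TriangleSpace.cycleSpace G ∧
      Subsingleton (TriangleSpace.H1 (TriangleSpace.cliqueComplex G))}
  rw [MeasureTheory.measure_univ] at h3
  refine h3.trans (add_le_add_right ?_ _)
  rw [Set.compl_ofPred, RandomSubset.binomialRandom_eq_Pr]
  refine ENNReal.ofReal_le_ofReal (RandomSubset.Pr_mono (p n).2.1 (p n).2.2 fun ω hω => ?_)
  refine mt (RandomSubset.triangleSpace_eq_and_subsingleton fun x y => ?_)
  rw [SimpleGraph.fromEdgeSet_adj, Finset.mem_coe, and_iff_left_iff_imp]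
  exact fun h => RandomSubset.mem_pairs.1 (hω h)

end
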